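/- Let $p$ be an odd prime. For a commutative ring $R$, let $R/\!/p$ denote the differential graded $R$-algebra with underlying graded algebra $R[x]$, $x$ in degree $1$, and with the differential $\delta$ (satisfying the graded Leibniz rule) given by $\delta x = p$; thus $\delta x^n = p\,x^{n-1}$ for $n$ odd and $\delta x^n = 0$ for $n$ even. Let $\mathrm{HC}_i(R/\!/p)$ and $\mathrm{HC}^-_i(R/\!/p)$ denote the cyclic and negative cyclic homology over $R$ of $R/\!/p$, that is, the homology of the cyclic and of the (product-totalized) negative cyclic complex of its Hochschild mixed complex over $R$. Let $A_1 := p$ and $A_j := p^2A_{j-2}/j$ for odd $j\ge 3$, and let $a_j$ be the $p$-adic valuation of $A_j$ (a non-negative integer). There are infinite sets $\overline Z\subseteq Z$ of positive even integers, depending only on $p$, such that $\overline Z$ contains all even numbers of the form $\frac{p^a\pm 1}{2}+1$ with $a>0$, and such that for every $p$-torsion-free commutative $\mathbb Z_{(p)}$-algebra $R$, with $p$-adic completion $R^\wedge$, the following holds. 1. $\mathrm{HC}^-_i(R/\!/p)=0$ for every odd integer $i$. 2. For every non-positive even integer $i$ there is an isomorphism of $R$-modules $$\mathrm{HC}^-_i(R/\!/p)\;\cong\;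 R^\wedge\times R/1\times R/3\times R/5\times\cdots .$$ 3. For every $i\in\overline Z$ there is an isomorphism of $R$-modules $$\mathrm{HC}^-_i(R/\!/p)\;\cong\; R^\wedge\times R/(i-1)\times R/(i+1)\times R/(i+3)\times\cdots .$$ 4. (The property that characterizes $Z$.) For every $i\in Z$ there is an isomorphism of $R$-modules $$\mathrm{HC}_i(R/\!/p)\;\cong\; R/p^{a_{i-1}+2}\oplus R/1\oplus R/3\oplus\cdots\oplus R/(i-1).$$ -/

import Mathlib

universe u v

noncomputable section

/-! ## Differential graded algebras -/

/-- A differential on a non-negatively graded (associative, unital, not necessarily graded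
commutative) `R`-algebra `A = ⨁ 𝒜 k`: homological grading, so the differential lowers the degree
by one, squares to zero and satisfies the graded Leibniz rule. -/
structure DGDifferential (R : Type u) (A : Type v) [CommRing R] [Ring A] [Algebra R A]
    (𝒜 : ℕ → Submodule R A) [GradedAlgebra 𝒜] where
  δ : A →ₗ[R] A
  map_deg_zero : ∀ a ∈ 𝒜 0, δ a = 0
  map_deg_succ : ∀ k : ℕ, ∀ a ∈ 𝒜 (k + 1), δ a ∈ 𝒜 k
  sq_zero : ∀ a : A, δ (δ a) = 0
  leibniz : ∀ k : ℕ, ∀ a ∈ 𝒜 k, ∀ b : A, δ (a * b) = δ a * b + (-1 : ℤ) ^ k • (a * δ b)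

/-! ## The Hochschild mixed complex of a differential graded algebra -/

namespace Hoch

/-- `A ⊗ ⋯ ⊗ A` (over `R`) with `n + 1` factors, the module of Hochschild `n`-chains. -/
abbrev T (R : Type u) (A : Type v) [CommRing R] [Ring A] [Algebra R A] (n : ℕ) : Type (max u v) :=
  PiTensorProduct R (fun _ : Fin (n + 1) => A)

section Graded

variable {R : Type u} {A : Type v} [CommRing R] [Ring A] [Algebra R A]
  (𝒜 : ℕ → Submodule R A) [GradedAlgebra 𝒜]

/-- The linear endomorphism of `A` that multiplies the elements of degree `k` by the integer
`w k`. -/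
def weight (w : ℕ → ℤ) : A →ₗ[R] A :=
  (DirectSum.toModule R ℕ A (fun k => w k • (𝒜 k).subtype)) ∘ₗ
    (DirectSum.decomposeLinearEquiv 𝒜).toLinearMap

/-- The parity involution `a ↦ (-1)^|a| a`. -/
def eps : A →ₗ[R] A := weight 𝒜 (fun k => (-1) ^ k)

/-- The projection of `A` to the sum of its even parts. -/
def ev : A →ₗ[R] A := weight 𝒜 (fun k => if Even k then 1 else 0)

/-- The projection of `A` to the sum of its odd parts. -/
def od : A →ₗ[R] A := weight 𝒜 (fun k => if Even k then 0 else 1)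

/-- The cyclic rotation with its Koszul sign,
`a₀ ⊗ ⋯ ⊗ aₙ ↦ (-1)^(|aₙ| (|a₀| + ⋯ + |aₙ₋₁|)) aₙ ⊗ a₀ ⊗ ⋯ ⊗ aₙ₋₁` on homogeneous elements:
if `|aₙ|` is even there is no sign, if it is odd each `aᵢ` with `i < n` contributes
`(-1)^|aᵢ|`. -/
def rot (n : ℕ) : T R A n →ₗ[R] T R A n :=
  (PiTensorProduct.reindex R (fun _ : Fin (n + 1) => A) (finRotate (n + 1))).toLinearMap ∘ₗ
    (PiTensorProduct.map (fun i : Fin (n + 1) => if i = Fin.last n then ev 𝒜 else LinearMap.id) +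
      PiTensorProduct.map (fun i : Fin (n + 1) => if i = Fin.last n then od 𝒜 else eps 𝒜))

theorem contractNth_update {A : Type v} [Mul A] {n : ℕ} (i : Fin (n + 1)) [DecidableEq (Fin (n + 2))]
    (a : Fin (n + 2) → A) (l : Fin (n + 2)) :
    ∃ (k : Fin (n + 1)) (f : A → A),
      (f = id ∨ (∃ c, f = fun x => x * c) ∨ (∃ c, f = fun x => c * x)) ∧
      ∀ x, (fun j => i.castSucc.contractNth (fun x y => x * y) (Function.update a l x) j) =
        Function.update (fun j => i.castSucc.contractNth (fun x y => x * y) a j) k (f x) := by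
  rcases lt_trichotomy (l : ℕ) (i : ℕ) with h | h | h
  · refine ⟨⟨l, by omega⟩, id, Or.inl rfl, fun x => ?_⟩
    funext j
    simp only [Fin.contractNth, Function.update_apply, Fin.ext_iff, Fin.val_castSucc, Fin.val_succ]
    split_ifs <;> first | rfl | omega
  · refine ⟨i, fun x => x * a i.succ, Or.inr (Or.inl ⟨_, rfl⟩), fun x => ?_⟩
    funext j
    have e1 : (j : ℕ) = i → j.succ = i.succ := fun hj => by ext; simp [hj]
    simp only [Fin.contractNth, Function.update_apply, Fin.ext_iff, Fin.val_castSucc, Fin.val_succ]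
    split_ifs <;> first | rfl | omega | (rw [e1 (by omega)])
  · by_cases h' : (l : ℕ) = i + 1
    · refine ⟨i, fun x => a i.castSucc * x, Or.inr (Or.inr ⟨_, rfl⟩), fun x => ?_⟩
      funext j
      have e1 : (j : ℕ) = i → j.castSucc = i.castSucc := fun hj => by ext; simp [hj]
      simp only [Fin.contractNth, Function.update_apply, Fin.ext_iff, Fin.val_castSucc,
        Fin.val_succ]
      split_ifs <;> first | rfl | omega | (rw [e1 (by omega)])
    · refine ⟨⟨l - 1, by omega⟩, id, Or.inl rfl, fun x => ?_⟩
      funext j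
      simp only [Fin.contractNth, Function.update_apply, Fin.ext_iff, Fin.val_castSucc,
        Fin.val_succ]
      split_ifs <;> first | rfl | omega

theorem map_update_add_aux (R : Type u) (A : Type v) [CommRing R] [Ring A] [Algebra R A] (n : ℕ)
    (i : Fin (n + 1)) [DecidableEq (Fin (n + 2))] (a : Fin (n + 2) → A) (l : Fin (n + 2))
    (x y : A) :
    PiTensorProduct.tprod R (fun j : Fin (n + 1) =>
        i.castSucc.contractNth (fun x y => x * y) (Function.update a l (x + y)) j) =
      PiTensorProduct.tprod R (fun j : Fin (n + 1) =>
        i.castSucc.contractNth (fun x y => x * y) (Function.update a l x) j) +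
      PiTensorProduct.tprod R (fun j : Fin (n + 1) =>
        i.castSucc.contractNth (fun x y => x * y) (Function.update a l y) j) := by
  obtain ⟨k, f, hf, h⟩ := contractNth_update i a l
  have hadd : f (x + y) = f x + f y := by
    rcases hf with rfl | ⟨c, rfl⟩ | ⟨c, rfl⟩ <;> simp [add_mul, mul_add]
  rw [h, h, h, hadd, MultilinearMap.map_update_add]

theorem map_update_smul_aux (R : Type u) (A : Type v) [CommRing R] [Ring A] [Algebra R A] (n : ℕ)
    (i : Fin (n + 1)) [DecidableEq (Fin (n + 2))] (a : Fin (n + 2) → A) (l : Fin (n + 2))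
    (r : R) (x : A) :
    PiTensorProduct.tprod R (fun j : Fin (n + 1) =>
        i.castSucc.contractNth (fun x y => x * y) (Function.update a l (r • x)) j) =
      r • PiTensorProduct.tprod R (fun j : Fin (n + 1) =>
        i.castSucc.contractNth (fun x y => x * y) (Function.update a l x) j) := by
  obtain ⟨k, f, hf, h⟩ := contractNth_update i a l
  have hsmul : f (r • x) = r • f x := by
    rcases hf with rfl | ⟨c, rfl⟩ | ⟨c, rfl⟩ <;> simp
  rw [h, h, hsmul, MultilinearMap.map_update_smul]

/-- The face `a₀ ⊗ ⋯ ⊗ aₙ₊₁ ↦ a₀ ⊗ ⋯ ⊗ aᵢ aᵢ₊₁ ⊗ ⋯ ⊗ aₙ₊₁` for `0 ≤ i ≤ n`. -/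
def face (R : Type u) (A : Type v) [CommRing R] [Ring A] [Algebra R A] (n : ℕ) (i : Fin (n + 1)) :
    T R A (n + 1) →ₗ[R] T R A n :=
  PiTensorProduct.lift
    { toFun := fun a => PiTensorProduct.tprod R
        (fun j : Fin (n + 1) => i.castSucc.contractNth (fun x y => x * y) a j)
      map_update_add' := by
        intro _ a l x y
        exact map_update_add_aux R A n i a l x y
      map_update_smul' := by
        intro _ a l r x
        exact map_update_smul_aux R A n i a l r x }

/-- The Hochschild boundary `b = ∑_{i ≤ n} (-1)^i dᵢ + (-1)^(n+1) dₙ₊₁` on `n + 1`-chains, where the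
last face is `dₙ₊₁ (a₀ ⊗ ⋯ ⊗ aₙ₊₁) = ± aₙ₊₁ a₀ ⊗ a₁ ⊗ ⋯ ⊗ aₙ` with the Koszul sign. -/
def b (n : ℕ) : T R A (n + 1) →ₗ[R] T R A n :=
  ∑ i : Fin (n + 1), (-1 : ℤ) ^ (i : ℕ) • face R A n i +
    (-1 : ℤ) ^ (n + 1) • (face R A n 0 ∘ₗ rot 𝒜 (n + 1))

/-- The signed cyclic operator `t = (-1)^n · rot` on `n`-chains. -/
def t (n : ℕ) : T R A n →ₗ[R] T R A n := (-1 : ℤ) ^ n • rot 𝒜 n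

/-- The norm operator `N = 1 + t + ⋯ + t^n` on `n`-chains. -/
def N (n : ℕ) : T R A n →ₗ[R] T R A n := ∑ i ∈ Finset.range (n + 1), t 𝒜 n ^ i

/-- The extra degeneracy `a₀ ⊗ ⋯ ⊗ aₙ ↦ 1 ⊗ a₀ ⊗ ⋯ ⊗ aₙ`. -/
def s (R : Type u) (A : Type v) [CommRing R] [Ring A] [Algebra R A] (n : ℕ) :
    T R A n →ₗ[R] T R A (n + 1) :=
  PiTensorProduct.lift
    ((PiTensorProduct.tprod R (s := fun _ : Fin (n + 1 + 1) => A)).curryLeft 1)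

/-- Connes' operator `B = (1 - t) s N` from `n`-chains to `n + 1`-chains. -/
def B (n : ℕ) : T R A n →ₗ[R] T R A (n + 1) :=
  (LinearMap.id - t 𝒜 (n + 1)) ∘ₗ s R A n ∘ₗ N 𝒜 n

variable {𝒜} in
/-- The internal differential on `n`-chains induced by the differential of `A`,
`a₀ ⊗ ⋯ ⊗ aₙ ↦ ∑ᵢ (-1)^(|a₀| + ⋯ + |aᵢ₋₁|) a₀ ⊗ ⋯ ⊗ δ aᵢ ⊗ ⋯ ⊗ aₙ`. -/
def int (D : DGDifferential R A 𝒜) (n : ℕ) : T R A n →ₗ[R] T R A n :=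
  ∑ i : Fin (n + 1), PiTensorProduct.map
    (fun j : Fin (n + 1) => if j < i then eps 𝒜 else if j = i then D.δ else LinearMap.id)

/-- The `n`-chains of internal degree `q`: the span of the tensors of homogeneous elements whose
degrees add up to `q`. -/
def intDeg (n : ℕ) (q : ℤ) : Submodule R (T R A n) :=
  Submodule.span R {x | ∃ (e : Fin (n + 1) → ℕ) (a : Fin (n + 1) → A),
    (∀ i, a i ∈ 𝒜 (e i)) ∧ ∑ i, (e i : ℤ) = q ∧ PiTensorProduct.tprod R a = x}

/-- The Hochschild chains of total degree `m`: families `(cₙ)` with `cₙ` an `n`-chain of internal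
degree `m - n`. As the algebra sits in non-negative degrees, only the finitely many `cₙ` with
`n ≤ m` can be nonzero (and none for `m < 0`). -/
def totDeg (m : ℤ) : Submodule R (∀ n, T R A n) where
  carrier := {c | ∀ n : ℕ, c n ∈ intDeg 𝒜 n (m - n)}
  add_mem' := fun hc hd n => Submodule.add_mem _ (hc n) (hd n)
  zero_mem' := fun _ => Submodule.zero_mem _
  smul_mem' := fun r _ hc n => Submodule.smul_mem _ r (hc n)

variable {𝒜} in
/-- The total Hochschild differential `b + (-1)^n · int`, of degree `-1`. -/
def totd (D : DGDifferential R A 𝒜) : (∀ n, T R A n) →ₗ[R] (∀ n, T R A n) :=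
  LinearMap.pi fun n =>
    b 𝒜 n ∘ₗ LinearMap.proj (n + 1) + (-1 : ℤ) ^ n • (int D n ∘ₗ LinearMap.proj n)

/-- Connes' operator on total Hochschild chains, of degree `+1`. -/
def totB : (∀ n, T R A n) →ₗ[R] (∀ n, T R A n) :=
  LinearMap.pi fun n => match n with
    | 0 => 0
    | n + 1 => B 𝒜 n ∘ₗ LinearMap.proj n

end Graded

end Hoch

/-! ## Cyclic and negative cyclic homology of a graded mixed complex -/

namespace Mixed

variable {R : Type u} {M : Type v} [CommRing R] [AddCommGroup M] [Module R M]

/-- The differential of the cyclic complex: `(D f)ⱼ = d fⱼ + B fⱼ₊₁`. -/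
def cycD (d B : M →ₗ[R] M) : (ℕ → M) →ₗ[R] (ℕ → M) :=
  LinearMap.pi fun j => d ∘ₗ LinearMap.proj j + B ∘ₗ LinearMap.proj (j + 1)

/-- The differential of the negative cyclic complex: `(D f)ⱼ = d fⱼ + B fⱼ₋₁`
(with `f₋₁ = 0`). -/
def negD (d B : M →ₗ[R] M) : (ℕ → M) →ₗ[R] (ℕ → M) :=
  LinearMap.pi fun j => match j with
    | 0 => d ∘ₗ LinearMap.proj 0
    | j + 1 => d ∘ₗ LinearMap.proj (j + 1) + B ∘ₗ LinearMap.proj j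

/-- The degree `i` part `∏_{j ≥ 0} M_{i + k j}` of a totalization (`k = -2` for the cyclic complex,
`k = 2` for the negative cyclic complex), where `M_m` is the degree `m` part of the mixed complex.
For a mixed complex that vanishes in negative degrees the product is a finite sum when `k = -2`;
for `k = 2` it is the product totalization. -/
def tot (M' : ℤ → Submodule R M) (k i : ℤ) : Submodule R (ℕ → M) where
  carrier := {f | ∀ j : ℕ, f j ∈ M' (i + k * j)}
  add_mem' := fun hf hg j => Submodule.add_mem _ (hf j) (hg j)
  zero_mem' := fun _ => Submodule.zero_mem _
  smul_mem' := fun r _ hf j => Submodule.smul_mem _ r (hf j)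

/-- Cycles in degree `i`. -/
def cycles (M' : ℤ → Submodule R M) (D : (ℕ → M) →ₗ[R] (ℕ → M)) (k i : ℤ) :
    Submodule R (ℕ → M) := tot M' k i ⊓ LinearMap.ker D

/-- Boundaries in degree `i`. -/
def boundaries (M' : ℤ → Submodule R M) (D : (ℕ → M) →ₗ[R] (ℕ → M)) (k i : ℤ) :
    Submodule R (ℕ → M) := (tot M' k (i + 1)).map D

/-- Homology in degree `i`: cycles modulo boundaries. -/
abbrev homology (M' : ℤ → Submodule R M) (D : (ℕ → M) →ₗ[R] (ℕ → M)) (k i : ℤ) : Type v :=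
  cycles M' D k i ⧸ (boundaries M' D k i).comap (cycles M' D k i).subtype

end Mixed

section CyclicHomology

variable {R : Type u} {A : Type v} [CommRing R] [Ring A] [Algebra R A]
  {𝒜 : ℕ → Submodule R A} [GradedAlgebra 𝒜]

/-- The cyclic homology `HC_i` over `R` of a differential graded `R`-algebra. -/
abbrev HC (D : DGDifferential R A 𝒜) (i : ℤ) : Type (max u v) :=
  Mixed.homology (Hoch.totDeg 𝒜) (Mixed.cycD (Hoch.totd D) (Hoch.totB 𝒜)) (-2) i

/-- The negative cyclic homology `HC⁻_i` over `R` of a differential graded `R`-algebra. -/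
abbrev HCneg (D : DGDifferential R A 𝒜) (i : ℤ) : Type (max u v) :=
  Mixed.homology (Hoch.totDeg 𝒜) (Mixed.negD (Hoch.totd D) (Hoch.totB 𝒜)) 2 i

end CyclicHomology

/-! ## The algebra `R//p` -/

/-- The differential of `R//p` on the polynomial algebra `R[x]`, `|x| = 1`: it sends `x^n` to
`p x^(n-1)` for odd `n` and to `0` for even `n`. -/
def killδ (R : Type u) [CommRing R] (p : ℕ) : AddMonoidAlgebra R ℕ →ₗ[R] AddMonoidAlgebra R ℕ :=
  Finsupp.linearCombination R
      (fun n : ℕ => if Odd n then AddMonoidAlgebra.single (n - 1) (p : R) else 0) ∘ₗ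
    (AddMonoidAlgebra.coeffLinearEquiv R).toLinearMap

theorem killδ_single (R : Type u) [CommRing R] (p n : ℕ) (r : R) :
    killδ R p (AddMonoidAlgebra.single n r) =
      if Odd n then AddMonoidAlgebra.single (n - 1) (r * p) else 0 := by
  have : (AddMonoidAlgebra.coeffLinearEquiv R) (AddMonoidAlgebra.single n r) =
    Finsupp.single n r := rfl
  simp only [killδ, LinearMap.comp_apply, LinearEquiv.coe_coe, this,
    Finsupp.linearCombination_single]
  split_ifs <;> simp

/-- The differential graded algebra `R//p`: the polynomial algebra `R[x]` (realized as the monoid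
algebra of `ℕ` over `R`, graded by the exponent) with `x` in degree `1` and `δ x = p`. -/
def killP (R : Type u) [CommRing R] (p : ℕ) :
    DGDifferential R (AddMonoidAlgebra R ℕ) (AddMonoidAlgebra.grade R (M := ℕ)) where
  δ := killδ R p
  map_deg_zero := by
    intro a ha
    obtain ⟨r, rfl⟩ := (AddMonoidAlgebra.mem_grade_iff' R 0 a).1 ha
    rw [AddMonoidAlgebra.lsingle_apply, killδ_single]
    simp
  map_deg_succ := by
    intro k a ha
    obtain ⟨r, rfl⟩ := (AddMonoidAlgebra.mem_grade_iff' R (k + 1) a).1 ha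
    rw [AddMonoidAlgebra.lsingle_apply, killδ_single]
    split_ifs
    · exact AddMonoidAlgebra.single_mem_grade _ _
    · exact Submodule.zero_mem _
  sq_zero := by
    intro a
    have h : killδ R p ∘ₗ killδ R p = 0 := by
      refine AddMonoidAlgebra.lhom_ext' fun n => LinearMap.ext fun r => ?_
      simp only [LinearMap.comp_apply, AddMonoidAlgebra.lsingle_apply, killδ_single,
        LinearMap.zero_apply]
      split_ifs with h1
      · rw [killδ_single, if_neg]
        rw [Nat.not_odd_iff_even]
        obtain ⟨m, rfl⟩ := h1
        exact ⟨m, by omega⟩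
      · exact map_zero _
    exact LinearMap.congr_fun h a
  leibniz := by
    intro k a ha b
    obtain ⟨r, rfl⟩ := (AddMonoidAlgebra.mem_grade_iff' R k a).1 ha
    rw [AddMonoidAlgebra.lsingle_apply]
    induction b using AddMonoidAlgebra.induction_linear with
    | zero => simp
    | add f g hf hg => rw [mul_add, map_add, map_add, hf, hg, mul_add, mul_add, smul_add]; abel
    | single m t =>
      simp only [AddMonoidAlgebra.single_mul_single, killδ_single]
      rcases Nat.even_or_odd k with hk | hk <;> rcases Nat.even_or_odd m with hm | hm
      · have h1 : ¬ Odd k := by simpa using hk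
        have h2 : ¬ Odd m := by simpa using hm
        have h3 : ¬ Odd (k + m) := by simpa using hk.add hm
        simp [h1, h2, h3]
      · have h1 : ¬ Odd k := by simpa using hk
        have h3 : Odd (k + m) := hk.add_odd hm
        have h4 : k + m - 1 = k + (m - 1) := by have := hm.pos; omega
        simp [h1, hm, h3, hk.neg_one_pow, AddMonoidAlgebra.single_mul_single, h4, mul_assoc]
      · have h2 : ¬ Odd m := by simpa using hm
        have h3 : Odd (k + m) := hk.add_even hm
        have h4 : k + m - 1 = k - 1 + m := by have := hk.pos; omega
        simp [hk, h2, h3, AddMonoidAlgebra.single_mul_single, h4, mul_right_comm]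
      · have h3 : ¬ Odd (k + m) := by simpa using hk.add_odd hm
        have h4 : k - 1 + m = k + (m - 1) := by have := hk.pos; have := hm.pos; omega
        rw [if_neg h3, if_pos hk, if_pos hm, hk.neg_one_pow, neg_one_smul,
          AddMonoidAlgebra.single_mul_single, AddMonoidAlgebra.single_mul_single, h4,
          mul_right_comm r, mul_assoc r, add_neg_cancel]

/-! ## Auxiliary arithmetic -/

instance isPrime_span_natCast (p : ℕ) [hp : Fact p.Prime] : (Ideal.span {(p : ℤ)}).IsPrime :=
  (Ideal.span_singleton_prime (by exact_mod_cast hp.out.ne_zero)).2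
    (Nat.prime_iff_prime_int.1 hp.out)

/-- The ring `ℤ_(p)`. -/
abbrev ZLoc (p : ℕ) [Fact p.Prime] : Type := Localization.AtPrime (Ideal.span {(p : ℤ)})

/-- The rational numbers `A_1 = p` and `A_j = p² A_{j-2} / j` for odd `j ≥ 3` (with the irrelevant
value `0` at even `j`). -/
def numA (p : ℕ) : ℕ → ℚ
  | 0 => 0
  | 1 => p
  | j + 2 => (p : ℚ) ^ 2 * numA p j / ((j + 2 : ℕ) : ℚ)

/-- The `p`-adic valuation `a_j` of `A_j`; for odd `j` and an odd prime `p` it is non-negative. -/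
def vala (p j : ℕ) : ℕ := (padicValRat p (numA p j)).toNat

end

/-! As `x` has odd degree and `R[x]` is free as an associative algebra, the Hochschild complex of
`R[x]` is contractible in tensor degrees at least two (`contr_homotopy`), and the rest is governed
by the commutators `[x, x^(n-1)]`, equal to `2 x^n` for even `n > 0` and to `0` otherwise. With `2`
invertible, the whole mixed complex therefore maps onto a small one with a single copy of `R` in
each degree `n ≥ 0`. There `d` goes from odd to even degrees and is multiplication by `p²` (by `p`
from degree 1 to 0), and Connes' operator from odd degree `n - 1` to `n` is multiplication by
`2(n-1)`. The map `proj` commutes strictly with both operators (`proj_totd`, `proj_totB`), is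
surjective and has acyclic kernel (`proj_acyclic`); this passes to both totalizations.

In the small model `d` is injective in odd degrees, so odd negative cyclic homology vanishes. In
even degrees every chain is a cycle, and the homology is the cokernel of a bidiagonal map, that is,
a module presented by a chain of relations `p² ε_m + 2(2(M+m)+1) ε_(m+1) = 0` (with `p` instead of
`p²` for `m = 0` if `M = 0`). The chain is finite for `HC` and infinite, in the product sense, for
`HC⁻`. Over a `ℤ_(p)`-algebra each nonzero integer is a power of `p` times a unit, so a diagonal
rescaling reduces to relations `q^(s m) ε_m = q^(r (m+1)) ε_(m+1)` with `q = p` and `r` the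
valuations of successive odd numbers.

Such a module is computed by explicit functionals (`finite_cokernel`, `infinite_cokernel`). Sending
`ε_m` to `q^(α m)`, where `α (m+1) + r (m+1) = α m + s m`, gives a weighted sum with values in the
completion, or in a cyclic module for a finite chain. For each `k`, a similar sum over a cluster of
indices starting at `k + 1` gives a value in `R/q^(r (k+1))`. Jointly these are surjective with
kernel the relations. Here `α m` is the valuation of `A_(2(M+m)-1)` minus that of `A_(2M-1)`. Its
non-negativity asks that the latter valuation be minimal among the later ones; the finite chain asks
that the last valuation be maximal among the earlier ones. These two conditions lead to `Z` and
`Zbar`.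

The arithmetic input is that valuations of distinct positive integers up to `N` add up to at most
that of `N!`, hence to less than `N/2`. Along a cluster, `2(M+k)+1+2t` has the valuation of `t`;
around `(p^a ± 1)/2`, doubling an odd number makes it congruent to a small number modulo `p^a`. So
in both cases the valuations of the odd numbers are replaced by those of small distinct integers
(`alph_cluster`, `alph_le_below`, `alph_le_above`). -/

noncomputable section

namespace Hoch

/-! ### The monomial basis of the Hochschild chains of `R[x]` -/

section Monomials

variable {R : Type u} [CommRing R]

variable (R) in
/-- The Hochschild chain `x^(w 0) ⊗ ⋯ ⊗ x^(w n)`. -/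
def X (n : ℕ) (w : ℕ → ℕ) : T R (AddMonoidAlgebra R ℕ) n :=
  PiTensorProduct.tprod R (fun i : Fin (n + 1) => AddMonoidAlgebra.single (w i) (1 : R))

/-- Multi-indices are functions on all of `ℕ`, which makes merging, rotating and shifting simple
formulas; the price is that entries beyond `n` are irrelevant and equalities of monomials are
checked only up to `n`. -/
theorem X_congr {n : ℕ} {w w' : ℕ → ℕ} (h : ∀ j ≤ n, w j = w' j) : X R n w = X R n w' := by
  unfold X
  congr 1
  funext i
  rw [h i (by omega)]

variable (R) in
/-- The monomial basis of the Hochschild `n`-chains. -/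
def monoBasis (n : ℕ) : Module.Basis (Fin (n + 1) → ℕ) R (T R (AddMonoidAlgebra R ℕ) n) :=
  Basis.piTensorProduct (fun _ => Module.Basis.ofRepr (AddMonoidAlgebra.coeffLinearEquiv R))

/-- The extension by zero of a finite multi-index. -/
def extendIdx {n : ℕ} (v : Fin (n + 1) → ℕ) (j : ℕ) : ℕ := if h : j < n + 1 then v ⟨j, h⟩ else 0

@[simp]
theorem extendIdx_val {n : ℕ} (v : Fin (n + 1) → ℕ) (i : Fin (n + 1)) : extendIdx v i = v i :=
  dif_pos i.2

theorem monoBasis_apply (n : ℕ) (v : Fin (n + 1) → ℕ) : monoBasis R n v = X R n (extendIdx v) := by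
  rw [monoBasis, Basis.piTensorProduct_apply, X]
  congr 1
  funext i
  rw [extendIdx_val]
  rfl

theorem X_eq_monoBasis (n : ℕ) (w : ℕ → ℕ) : X R n w = monoBasis R n (fun i => w i) := by
  rw [monoBasis_apply]
  exact X_congr fun j hj => by simp [extendIdx, Nat.lt_succ_of_le hj]

theorem hom_ext {N : Type*} [AddCommGroup N] [Module R N] {n : ℕ}
    {f g : T R (AddMonoidAlgebra R ℕ) n →ₗ[R] N} (h : ∀ w, f (X R n w) = g (X R n w)) : f = g :=
  (monoBasis R n).ext fun v => by rw [monoBasis_apply, h]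

/-- The linear map on `n`-chains with prescribed values on the monomials. -/
def lin {N : Type*} [AddCommGroup N] [Module R N] (n : ℕ) (F : (ℕ → ℕ) → N) :
    T R (AddMonoidAlgebra R ℕ) n →ₗ[R] N :=
  (monoBasis R n).constr R (fun v => F (extendIdx v))

theorem lin_X {N : Type*} [AddCommGroup N] [Module R N] {n : ℕ} {F : (ℕ → ℕ) → N}
    (hF : ∀ w w', (∀ j ≤ n, w j = w' j) → F w = F w') (w : ℕ → ℕ) :
    lin n F (X R n w) = F w := by
  rw [lin, X_eq_monoBasis, Module.Basis.constr_basis]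
  exact hF _ _ fun j hj => by simp [extendIdx, Nat.lt_succ_of_le hj]

/-- The total degree of a monomial. -/
def deg (n : ℕ) (w : ℕ → ℕ) : ℕ := ∑ j ∈ Finset.range (n + 1), w j

theorem deg_congr {n : ℕ} {w w' : ℕ → ℕ} (h : ∀ j ≤ n, w j = w' j) : deg n w = deg n w' :=
  Finset.sum_congr rfl fun j hj => h j (by simpa [Nat.lt_succ_iff] using hj)

/-- The multi-index with its entries `i` and `i + 1` added up. -/
def mrg (i : ℕ) (w : ℕ → ℕ) (j : ℕ) : ℕ :=
  if j < i then w j else if j = i then w i + w (i + 1) else w (j + 1)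

/-- The multi-index with its last entry moved to the front. -/
def rotIdx (n : ℕ) (w : ℕ → ℕ) (j : ℕ) : ℕ := if j = 0 then w n else w (j - 1)

/-- The multi-index with a zero inserted at the front. -/
def shiftIdx (w : ℕ → ℕ) (j : ℕ) : ℕ := if j = 0 then 0 else w (j - 1)

/-- The multi-index with its entry `i` lowered by one. -/
def dec (i : ℕ) (w : ℕ → ℕ) (j : ℕ) : ℕ := if j = i then w j - 1 else w j

theorem deg_mrg {n i : ℕ} (hi : i ≤ n) (w : ℕ → ℕ) : deg n (mrg i w) = deg (n + 1) w := by
  induction n with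
  | zero =>
    obtain rfl : i = 0 := by omega
    simp [deg, mrg, Finset.sum_range_succ]
  | succ n ih =>
    rcases Nat.lt_or_ge n i with h | h
    · obtain rfl : i = n + 1 := by omega
      have h1 : ∑ j ∈ Finset.range (n + 1), mrg (n + 1) w j = ∑ j ∈ Finset.range (n + 1), w j :=
        Finset.sum_congr rfl fun j hj => by
          have := Finset.mem_range.1 hj
          simp [mrg, this]
      rw [deg, Finset.sum_range_succ, h1, deg, Finset.sum_range_succ, Finset.sum_range_succ]
      simp [mrg, add_assoc, Finset.sum_range_succ]
    · rw [deg, Finset.sum_range_succ]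
      have := ih h
      rw [deg] at this
      rw [this, deg, deg, Finset.sum_range_succ _ (n + 2)]
      congr 1
      have h1 : ¬ n + 1 < i := by omega
      have h2 : ¬ n + 1 = i := by omega
      simp [mrg, h1, h2]

theorem deg_rotIdx (n : ℕ) (w : ℕ → ℕ) : deg n (rotIdx n w) = deg n w := by
  rw [deg, Finset.sum_range_succ', deg, Finset.sum_range_succ]
  simp [rotIdx]

theorem deg_shiftIdx (n : ℕ) (w : ℕ → ℕ) : deg (n + 1) (shiftIdx w) = deg n w := by
  rw [deg, Finset.sum_range_succ', deg]
  simp [shiftIdx]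

theorem deg_dec {n i : ℕ} (hi : i ≤ n) {w : ℕ → ℕ} (hw : w i ≠ 0) :
    deg n (dec i w) + 1 = deg n w := by
  have hmem : i ∈ Finset.range (n + 1) := by simp; omega
  rw [deg, deg, ← Finset.add_sum_erase _ _ hmem, ← Finset.add_sum_erase _ w hmem]
  have : ∑ j ∈ (Finset.range (n + 1)).erase i, dec i w j
      = ∑ j ∈ (Finset.range (n + 1)).erase i, w j :=
    Finset.sum_congr rfl fun j hj => by simp [dec, Finset.ne_of_mem_erase hj]
  rw [this]
  simp only [dec, if_true]
  omega

theorem weight_single (f : ℕ → ℤ) (k : ℕ) (r : R) :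
    weight (AddMonoidAlgebra.grade R (M := ℕ)) f (AddMonoidAlgebra.single k r) =
      f k • AddMonoidAlgebra.single k r := by
  have hm : AddMonoidAlgebra.single k r ∈ AddMonoidAlgebra.grade R (M := ℕ) k :=
    AddMonoidAlgebra.single_mem_grade _ _
  rw [weight, LinearMap.comp_apply]
  have : (DirectSum.decomposeLinearEquiv (AddMonoidAlgebra.grade R (M := ℕ))).toLinearMap
      (AddMonoidAlgebra.single k r) = DirectSum.lof R ℕ (fun k => AddMonoidAlgebra.grade R (M := ℕ) k) k
        ⟨AddMonoidAlgebra.single k r, hm⟩ := by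
    show DirectSum.decompose _ _ = _
    rw [DirectSum.decompose_of_mem _ hm]
    rfl
  rw [this, DirectSum.toModule_lof]
  rfl

theorem eps_single (k : ℕ) (r : R) :
    eps (AddMonoidAlgebra.grade R (M := ℕ)) (AddMonoidAlgebra.single k r) =
      (-1 : ℤ) ^ k • AddMonoidAlgebra.single k r := weight_single _ k r

theorem face_X (n : ℕ) (i : Fin (n + 1)) (w : ℕ → ℕ) :
    face R (AddMonoidAlgebra R ℕ) n i (X R (n + 1) w) = X R n (mrg i w) := by
  rw [face, X, PiTensorProduct.lift.tprod]
  show PiTensorProduct.tprod R _ = PiTensorProduct.tprod R _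
  congr 1
  funext j
  simp only [Fin.contractNth, mrg, Fin.val_castSucc, Fin.val_succ,
    AddMonoidAlgebra.single_mul_single, mul_one]
  split_ifs with h1 h2
  · rfl
  · rw [h2]
  · rfl

theorem s_X (n : ℕ) (w : ℕ → ℕ) :
    s R (AddMonoidAlgebra R ℕ) n (X R n w) = X R (n + 1) (shiftIdx w) := by
  rw [s, X, PiTensorProduct.lift.tprod, MultilinearMap.curryLeft_apply, X]
  congr 1
  funext j
  refine Fin.cases ?_ (fun j => ?_) j
  · simp [shiftIdx, AddMonoidAlgebra.one_def]
  · simp [shiftIdx]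

theorem map_smul_X {n : ℕ} (f : Fin (n + 1) → AddMonoidAlgebra R ℕ →ₗ[R] AddMonoidAlgebra R ℕ)
    (w : ℕ → ℕ) (c : Fin (n + 1) → ℤ)
    (h : ∀ i : Fin (n + 1), f i (AddMonoidAlgebra.single (w i) 1) =
      c i • AddMonoidAlgebra.single (w i) 1) :
    PiTensorProduct.map f (X R n w) = (∏ i, c i) • X R n w := by
  have h' : ∀ i : Fin (n + 1), f i (AddMonoidAlgebra.single (w i) 1) =
      (c i : R) • AddMonoidAlgebra.single (w i) 1 := fun i => by rw [h, Int.cast_smul_eq_zsmul]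
  rw [X, PiTensorProduct.map_tprod]
  simp only [h']
  rw [MultilinearMap.map_smul_univ, ← Int.cast_prod, Int.cast_smul_eq_zsmul]

/-- The Koszul exponent is `w n * (deg n w - w n)`; since `(w n)²` and `w n` have the same parity,
it can be written without subtraction as `w n * (deg n w + 1)`. -/
theorem rot_X (n : ℕ) (w : ℕ → ℕ) :
    rot (AddMonoidAlgebra.grade R (M := ℕ)) n (X R n w) =
      (-1 : ℤ) ^ (w n * (deg n w + 1)) • X R n (rotIdx n w) := by
  have hre : PiTensorProduct.reindex R (fun _ : Fin (n + 1) => AddMonoidAlgebra R ℕ)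
      (finRotate (n + 1)) (X R n w) = X R n (rotIdx n w) := by
    rw [X, PiTensorProduct.reindex_tprod, X]
    congr 1
    funext j
    congr 1
    obtain ⟨k, rfl⟩ := (finRotate (n + 1)).surjective j
    rw [Equiv.symm_apply_apply]
    rcases eq_or_ne k (Fin.last n) with rfl | hk
    · simp [rotIdx]
    · have : ((finRotate (n + 1) k : Fin (n + 1)) : ℕ) = k + 1 := by
        rw [coe_finRotate_of_ne_last hk]
      rw [this]
      simp [rotIdx]
  have hlast : deg n w = ∑ j ∈ Finset.range n, w j + w n := Finset.sum_range_succ _ _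
  rw [rot, LinearMap.comp_apply, LinearMap.add_apply]
  rw [map_smul_X _ w (fun i => if i = Fin.last n then (if Even (w n) then 1 else 0) else 1),
    map_smul_X _ w (fun i => if i = Fin.last n then (if Even (w n) then 0 else 1) else (-1) ^ w i)]
  · rw [← add_smul, map_zsmul, LinearEquiv.coe_coe, hre]
    congr 1
    rw [Fin.prod_univ_castSucc, Fin.prod_univ_castSucc]
    simp only [Fin.castSucc_ne_last, if_false, if_true, Finset.prod_const_one, one_mul,
      Fin.val_castSucc]
    rw [Fin.prod_univ_eq_prod_range (fun i => (-1 : ℤ) ^ w i) n, Finset.prod_pow_eq_pow_sum]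
    rcases Nat.even_or_odd (w n) with h | h
    · simp [h, Even.neg_one_pow (h.mul_right _)]
    · rw [if_neg (Nat.not_even_iff_odd.2 h), if_neg (Nat.not_even_iff_odd.2 h), zero_add, mul_one,
        pow_mul, h.neg_one_pow, hlast, add_assoc, pow_add _ _ (w n + 1), (h.add_odd odd_one).neg_one_pow,
        mul_one]
  · intro i
    split_ifs with h1 h2
    · subst h1; rw [od, weight_single]; simp [h2]
    · subst h1; rw [od, weight_single]; simp [h2]
    · exact eps_single _ _
  · intro i
    split_ifs with h1 h2
    · subst h1; rw [ev, weight_single]; simp [h2]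
    · subst h1; rw [ev, weight_single]; simp [h2]
    · simp

/-- The `i`-th summand of the internal differential on monomials. -/
def intTerm (R : Type u) [CommRing R] (p n i : ℕ) (w : ℕ → ℕ) : T R (AddMonoidAlgebra R ℕ) n :=
  if Odd (w i) then ((-1 : ℤ) ^ (∑ j ∈ Finset.range i, w j)) • (p : R) • X R n (dec i w) else 0

theorem int_X (p n : ℕ) (w : ℕ → ℕ) :
    int (killP R p) n (X R n w) = ∑ i ∈ Finset.range (n + 1), intTerm R p n i w := by
  rw [int, LinearMap.sum_apply, ← Fin.sum_univ_eq_sum_range]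
  refine Finset.sum_congr rfl fun i _ => ?_
  rw [X, PiTensorProduct.map_tprod, intTerm]
  have key : (fun j : Fin (n + 1) => (if j < i then eps (AddMonoidAlgebra.grade R (M := ℕ)) else
      if j = i then (killP R p).δ else LinearMap.id) (AddMonoidAlgebra.single (w j) (1 : R))) =
      fun j => (if j < i then (-1 : R) ^ w j else if j = i then (if Odd (w i) then (p : R) else 0)
        else 1) • AddMonoidAlgebra.single (dec i w j) (1 : R) := by
    funext j
    rcases lt_trichotomy j i with h | h | h
    · have h' : (j : ℕ) ≠ i := by omega
      have h'' : j ≠ i := h.ne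
      simp only [h, if_true, eps_single, dec, h', if_false]
      rcases Nat.even_or_odd (w j) with h2 | h2 <;> simp [h2.neg_one_pow]
    · subst h
      simp only [lt_irrefl, if_false, if_true, dec]
      show killδ R p _ = _
      rw [killδ_single]
      split_ifs <;> simp
    · have h' : ¬ j < i := by omega
      have h'' : j ≠ i := h.ne'
      have h3 : (j : ℕ) ≠ i := by omega
      simp [h', h'', dec, h3]
  rw [key, MultilinearMap.map_smul_univ]
  have : (PiTensorProduct.tprod R fun j : Fin (n + 1) =>
      AddMonoidAlgebra.single (dec i w j) (1 : R)) = X R n (dec i w) := rfl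
  rw [this]
  have hp : (∏ j : Fin (n + 1), (if j < i then (-1 : R) ^ w j else if j = i then
      (if Odd (w i) then (p : R) else 0) else 1)) =
      (-1) ^ (∑ j ∈ Finset.range i, w j) * (if Odd (w i) then (p : R) else 0) := by
    have h1 : ∀ j : Fin (n + 1), (if j < i then (-1 : R) ^ w j else if j = i then
      (if Odd (w i) then (p : R) else 0) else 1) = (if j < i then (-1 : R) ^ w j else 1) *
        (if j = i then (if Odd (w i) then (p : R) else 0) else 1) := by
      intro j
      split_ifs <;> first | omega | simp
    rw [Finset.prod_congr rfl fun j _ => h1 j, Finset.prod_mul_distrib, Finset.prod_ite_eq' Finset.univ i]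
    simp only [Finset.mem_univ, if_true]
    congr 1
    rw [← Finset.prod_pow_eq_pow_sum, ← Finset.prod_filter]
    refine Finset.prod_bij (fun j _ => (j : ℕ)) ?_ ?_ ?_ ?_
    · intro j hj; simpa using hj
    · intro a _ b _ h; exact Fin.ext h
    · intro b hb
      have := Finset.mem_range.1 hb
      exact ⟨⟨b, by omega⟩, by simpa [← Fin.val_fin_lt] using this, rfl⟩
    · intros; rfl
  rw [hp]
  split_ifs with h
  · rw [mul_smul]
    rcases Nat.even_or_odd (∑ j ∈ Finset.range i, w j) with h2 | h2 <;> simp [h2.neg_one_pow]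
  · simp

/-! ### Internal degrees and reduction to monomials -/

theorem X_mem_intDeg (n : ℕ) (w : ℕ → ℕ) {q : ℤ} (h : (deg n w : ℤ) = q) :
    X R n w ∈ intDeg (AddMonoidAlgebra.grade R (M := ℕ)) n q := by
  refine Submodule.subset_span ⟨fun i => w i, fun i => AddMonoidAlgebra.single (w i) 1,
    fun i => AddMonoidAlgebra.single_mem_grade _ _, ?_, rfl⟩
  rw [← h, deg, Fin.sum_univ_eq_sum_range (fun i => (w i : ℤ))]
  push_cast
  rfl

theorem intDeg_eq_span (n : ℕ) (q : ℤ) :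
    intDeg (AddMonoidAlgebra.grade R (M := ℕ)) n q =
      Submodule.span R {x | ∃ w : ℕ → ℕ, (deg n w : ℤ) = q ∧ X R n w = x} := by
  apply le_antisymm
  · refine Submodule.span_le.2 ?_
    rintro _ ⟨e, a, ha, he, rfl⟩
    choose r hr using fun i => (AddMonoidAlgebra.mem_grade_iff' R (e i) (a i)).1 (ha i)
    have : a = fun i => r i • AddMonoidAlgebra.single (extendIdx e i) (1 : R) := by
      funext i
      rw [← hr i]
      simp only [extendIdx_val]
      simp
    rw [this, MultilinearMap.map_smul_univ]
    refine Submodule.smul_mem _ _ (Submodule.subset_span ⟨extendIdx e, ?_, rfl⟩)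
    rw [← he, deg, ← Fin.sum_univ_eq_sum_range]
    push_cast
    exact Finset.sum_congr rfl fun i _ => by rw [extendIdx_val]
  · refine Submodule.span_le.2 ?_
    rintro _ ⟨w, hw, rfl⟩
    exact X_mem_intDeg n w hw

theorem intDeg_induction {n : ℕ} {q : ℤ} {S : Type*} [AddCommGroup S] [Module R S]
    {f : T R (AddMonoidAlgebra R ℕ) n →ₗ[R] S} {P : Submodule R S}
    (h : ∀ w, (deg n w : ℤ) = q → f (X R n w) ∈ P) {c : T R (AddMonoidAlgebra R ℕ) n}
    (hc : c ∈ intDeg (AddMonoidAlgebra.grade R (M := ℕ)) n q) : f c ∈ P := by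
  rw [intDeg_eq_span] at hc
  have : Submodule.span R {x | ∃ w : ℕ → ℕ, (deg n w : ℤ) = q ∧ X R n w = x} ≤ P.comap f :=
    Submodule.span_le.2 (by rintro _ ⟨w, hw, rfl⟩; exact h w hw)
  exact this hc

theorem eq_of_intDeg {n : ℕ} {q : ℤ} {S : Type*} [AddCommGroup S] [Module R S]
    {f g : T R (AddMonoidAlgebra R ℕ) n →ₗ[R] S}
    (h : ∀ w, (deg n w : ℤ) = q → f (X R n w) = g (X R n w)) {c : T R (AddMonoidAlgebra R ℕ) n}
    (hc : c ∈ intDeg (AddMonoidAlgebra.grade R (M := ℕ)) n q) : f c = g c := by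
  have := intDeg_induction (f := f - g) (P := ⊥) (fun w hw => by simp [h w hw]) hc
  simpa [sub_eq_zero] using this

end Monomials

end Hoch

namespace Hoch

/-! ### The cyclic identities -/

section Cyclic

variable {R : Type u} [CommRing R]

variable (R) in
/-- The grading of `R[x]` with `x` in degree one. -/
abbrev gr : ℕ → Submodule R (AddMonoidAlgebra R ℕ) := AddMonoidAlgebra.grade R (M := ℕ)

variable (R) in
/-- The face maps on the chains of `R[x]`, indexed by natural numbers. -/
def fc (n i : ℕ) : T R (AddMonoidAlgebra R ℕ) (n + 1) →ₗ[R] T R (AddMonoidAlgebra R ℕ) n :=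
  lin (n + 1) (fun w => X R n (mrg i w))

theorem fc_X (n i : ℕ) (w : ℕ → ℕ) : fc R n i (X R (n + 1) w) = X R n (mrg i w) := by
  refine lin_X (fun w w' h => X_congr fun j hj => ?_) w
  unfold mrg
  split_ifs with h1 h2
  · exact h _ (by omega)
  · rw [h i (by omega), h (i + 1) (by omega)]
  · exact h _ (by omega)

theorem face_eq_fc (n : ℕ) (i : Fin (n + 1)) : face R (AddMonoidAlgebra R ℕ) n i = fc R n i :=
  hom_ext fun w => by rw [face_X, fc_X]

theorem fc_comp_fc (n : ℕ) {i j : ℕ} (hij : i < j) :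
    fc R n i ∘ₗ fc R (n + 1) j = fc R n (j - 1) ∘ₗ fc R (n + 1) i := by
  refine hom_ext fun w => ?_
  simp only [LinearMap.comp_apply, fc_X]
  refine X_congr fun k _ => ?_
  grind [mrg]

theorem fc_succ_comp_rot {n i : ℕ} (hi : i + 1 ≤ n) :
    fc R n (i + 1) ∘ₗ rot (gr R) (n + 1) = rot (gr R) n ∘ₗ fc R n i := by
  refine hom_ext fun w => ?_
  simp only [LinearMap.comp_apply, rot_X, fc_X, map_zsmul, deg_mrg (show i ≤ n by omega)]
  have h : mrg i w n = w (n + 1) := by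
    rw [mrg, if_neg (by omega), if_neg (by omega)]
  rw [h]
  congr 1
  refine X_congr fun k hk => ?_
  grind [mrg, rotIdx]

/-- The last face followed by a rotation brings the product of the last two factors to the front,
which is also reached by two rotations and the first face; the two Koszul signs multiply to the one
for the product. -/
theorem rot_comp_fc_last (n : ℕ) :
    rot (gr R) n ∘ₗ fc R n n = fc R n 0 ∘ₗ rot (gr R) (n + 1) ∘ₗ rot (gr R) (n + 1) := by
  refine hom_ext fun w => ?_
  simp only [LinearMap.comp_apply, rot_X, fc_X, map_zsmul, deg_mrg le_rfl, deg_rotIdx, smul_smul,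
    ← pow_add]
  have h : mrg n w n = w n + w (n + 1) := by simp [mrg]
  have h' : rotIdx (n + 1) w (n + 1) = w n := by simp [rotIdx]
  rw [h, h', ← add_mul, add_comm (w n)]
  congr 1
  refine X_congr fun k hk => ?_
  grind [mrg, rotIdx]

theorem rot_pow_X (n k : ℕ) (hk : k ≤ n + 1) (w : ℕ → ℕ) :
    (rot (gr R) n ^ k) (X R n w) =
      (-1 : ℤ) ^ ((∑ j ∈ Finset.range k, w (n - j)) * (deg n w + 1)) •
        X R n (fun j => if j < k then w (n + 1 - k + j) else w (j - k)) := by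
  induction k with
  | zero => simp
  | succ k ih =>
    rw [pow_succ', Module.End.mul_apply, ih (by omega), map_zsmul, rot_X]
    have hdeg : deg n (fun j => if j < k then w (n + 1 - k + j) else w (j - k)) = deg n w := by
      rw [deg, deg, ← Finset.sum_range_add_sum_Ico _ (show k ≤ n + 1 by omega),
        Finset.sum_Ico_eq_sum_range, add_comm,
        ← Finset.sum_range_add_sum_Ico w (show n + 1 - k ≤ n + 1 by omega),
        Finset.sum_Ico_eq_sum_range w]
      congr 1
      · refine Finset.sum_congr rfl fun j _ => ?_
        rw [if_neg (by omega)]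
        congr 1; omega
      · have : n + 1 - (n + 1 - k) = k := by omega
        rw [this]
        refine Finset.sum_congr rfl fun j hj => ?_
        rw [if_pos (Finset.mem_range.1 hj)]
    rw [hdeg, smul_smul, ← pow_add, ← add_mul, Finset.sum_range_succ, if_neg (by omega)]
    congr 1
    refine X_congr fun j hj => ?_
    grind [rotIdx]

theorem rot_pow_card (n : ℕ) : rot (gr R) n ^ (n + 1) = 1 := by
  refine hom_ext fun w => ?_
  rw [rot_pow_X n (n + 1) le_rfl]
  have hre : ∑ j ∈ Finset.range (n + 1), w (n - j) = deg n w := Finset.sum_range_reflect w (n + 1)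
  have : Even (deg n w * (deg n w + 1)) := Nat.even_mul_succ_self _
  -- The accumulated sign has exponent `d (d + 1)` with `d` the total degree, an even number.
  rw [hre, this.neg_one_pow, one_smul]
  refine X_congr fun j hj => ?_
  rw [if_pos (by omega)]
  congr 1; omega

theorem fc_zero_comp_s (n : ℕ) : fc R n 0 ∘ₗ s R (AddMonoidAlgebra R ℕ) n = LinearMap.id := by
  refine hom_ext fun w => ?_
  simp only [LinearMap.comp_apply, fc_X, s_X, LinearMap.id_apply]
  refine X_congr fun j hj => ?_
  rcases Nat.eq_zero_or_pos j with rfl | h1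
  · simp [mrg, shiftIdx]
  · simp [mrg, shiftIdx, h1.ne']

theorem fc_succ_comp_s (n i : ℕ) :
    fc R (n + 1) (i + 1) ∘ₗ s R (AddMonoidAlgebra R ℕ) (n + 1) =
      s R (AddMonoidAlgebra R ℕ) n ∘ₗ fc R n i := by
  refine hom_ext fun w => ?_
  simp only [LinearMap.comp_apply, fc_X, s_X]
  refine X_congr fun j hj => ?_
  grind [mrg, shiftIdx]

end Cyclic

/-! ### The internal differential commutes with the cyclic structure -/

section Internal

variable {R : Type u} [CommRing R]

theorem sum_range_mrg {i k : ℕ} (w : ℕ → ℕ) :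
    ∑ j ∈ Finset.range i, mrg k w j =
      if i ≤ k then ∑ j ∈ Finset.range i, w j else ∑ j ∈ Finset.range (i + 1), w j := by
  split_ifs with h
  · refine Finset.sum_congr rfl fun j hj => ?_
    have := Finset.mem_range.1 hj
    rw [mrg, if_pos (by omega)]
  · obtain ⟨n, rfl⟩ : ∃ n, i = n + 1 := ⟨i - 1, by omega⟩
    exact deg_mrg (by omega) w

/-- Summation pattern for the Leibniz rule: differentiating the factors `k` and `k + 1` separately
adds up to differentiating their product, and all other terms correspond one to one. -/
theorem sum_range_merge {N : Type*} [AddCommMonoid N] {f g : ℕ → N} {k : ℕ}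
    (h1 : ∀ i < k, f i = g i) (h2 : f k + f (k + 1) = g k) (h3 : ∀ i > k, f (i + 1) = g i)
    {n : ℕ} (hn : k ≤ n) :
    ∑ i ∈ Finset.range (n + 2), f i = ∑ i ∈ Finset.range (n + 1), g i := by
  induction n, hn using Nat.le_induction with
  | base =>
    rw [Finset.sum_range_succ, Finset.sum_range_succ, Finset.sum_range_succ g, add_assoc, h2]
    congr 1
    exact Finset.sum_congr rfl fun i hi => h1 i (Finset.mem_range.1 hi)
  | succ n hn ih => rw [Finset.sum_range_succ, ih, Finset.sum_range_succ g (n + 1), h3 _ (by omega)]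

theorem neg_one_pow_congr_even {a c : ℕ} (h : Even a ↔ Even c) : (-1 : ℤ) ^ a = (-1) ^ c := by
  rcases Nat.even_or_odd c with h1 | h1
  · rw [h1.neg_one_pow, (h.2 h1).neg_one_pow]
  · rw [h1.neg_one_pow, (Nat.not_even_iff_odd.1 (fun h2 => Nat.not_even_iff_odd.2 h1 (h.1 h2))).neg_one_pow]

theorem int_comp_fc (p n k : ℕ) (hk : k ≤ n) :
    int (killP R p) n ∘ₗ fc R n k = fc R n k ∘ₗ int (killP R p) (n + 1) := by
  refine hom_ext fun w => ?_
  simp only [LinearMap.comp_apply, fc_X, int_X, map_sum]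
  symm
  refine sum_range_merge (k := k) ?_ ?_ ?_ hk
  · intro i hi
    have h1 : mrg k w i = w i := by rw [mrg, if_pos hi]
    rw [intTerm, intTerm, h1]
    split_ifs with h
    · rw [map_zsmul, map_smul, fc_X, sum_range_mrg, if_pos hi.le]
      congr 2
      refine X_congr fun j _ => ?_
      grind [mrg, dec]
    · simp
  · have h1 : mrg k w k = w k + w (k + 1) := by simp [mrg]
    have e1 : Odd (w k) → X R n (mrg k (dec k w)) = X R n (dec k (mrg k w)) := fun h =>
      X_congr fun j _ => by
        have := h.pos
        grind [mrg, dec]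
    have e2 : Odd (w (k + 1)) → X R n (mrg k (dec (k + 1) w)) = X R n (dec k (mrg k w)) := fun h =>
      X_congr fun j _ => by
        have := h.pos
        grind [mrg, dec]
    simp only [intTerm, h1, sum_range_mrg, le_rfl, if_true, Finset.sum_range_succ]
    rcases Nat.even_or_odd (w k) with ha | ha <;> rcases Nat.even_or_odd (w (k + 1)) with hb | hb
    · simp [-zsmul_eq_mul, Nat.not_odd_iff_even.2 ha, Nat.not_odd_iff_even.2 hb, Nat.not_odd_iff_even.2 (ha.add hb)]
    · simp [-zsmul_eq_mul, Nat.not_odd_iff_even.2 ha, hb, ha.add_odd hb, pow_add, ha.neg_one_pow, fc_X, e2 hb]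
    · simp [-zsmul_eq_mul, ha, Nat.not_odd_iff_even.2 hb, ha.add_even hb, fc_X, e1 ha]
    · simp [-zsmul_eq_mul, ha, hb, Nat.not_odd_iff_even.2 (ha.add_odd hb), pow_add, ha.neg_one_pow, fc_X, e2 hb,
        e1 ha]
  · intro i hi
    have h1 : mrg k w i = w (i + 1) := by rw [mrg, if_neg (by omega), if_neg (by omega)]
    rw [intTerm, intTerm, h1]
    split_ifs with h
    · rw [map_zsmul, map_smul, fc_X, sum_range_mrg, if_neg (by omega)]
      congr 2
      refine X_congr fun j _ => ?_
      grind [mrg, dec]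
    · simp

theorem int_comp_s (p n : ℕ) :
    int (killP R p) (n + 1) ∘ₗ s R (AddMonoidAlgebra R ℕ) n =
      s R (AddMonoidAlgebra R ℕ) n ∘ₗ int (killP R p) n := by
  refine hom_ext fun w => ?_
  simp only [LinearMap.comp_apply, s_X, int_X, map_sum]
  rw [Finset.sum_range_succ']
  have h0 : intTerm R p (n + 1) 0 (shiftIdx w) = 0 := by simp [intTerm, shiftIdx]
  rw [h0, add_zero]
  refine Finset.sum_congr rfl fun i _ => ?_
  have h1 : shiftIdx w (i + 1) = w i := by simp [shiftIdx]
  rw [intTerm, intTerm, h1]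
  split_ifs with h
  · rw [map_zsmul, map_smul, s_X, Finset.sum_range_succ']
    have h2 : ∑ j ∈ Finset.range i, shiftIdx w (j + 1) + shiftIdx w 0 = ∑ j ∈ Finset.range i, w j := by
      simp [shiftIdx]
    rw [h2]
    congr 2
    refine X_congr fun j _ => ?_
    grind [shiftIdx, dec]
  · simp

theorem int_comp_rot (p n : ℕ) :
    int (killP R p) n ∘ₗ rot (gr R) n = rot (gr R) n ∘ₗ int (killP R p) n := by
  refine hom_ext fun w => ?_
  simp only [LinearMap.comp_apply, rot_X, int_X, map_sum, map_zsmul]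
  rw [← Finset.sum_zsmul, Finset.sum_range_succ', Finset.sum_range_succ _ n]
  congr 1
  · refine Finset.sum_congr rfl fun i hi => ?_
    have hi := Finset.mem_range.1 hi
    have h1 : rotIdx n w (i + 1) = w i := by simp [rotIdx]
    rw [intTerm, intTerm, h1]
    split_ifs with h
    · have hd := deg_dec (n := n) (i := i) (by omega) (w := w) h.pos.ne'
      rw [map_zsmul, map_smul, rot_X, Finset.sum_range_succ']
      have h2 : ∑ j ∈ Finset.range i, rotIdx n w (j + 1) + rotIdx n w 0 =
          ∑ j ∈ Finset.range i, w j + w n := by simp [rotIdx]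
      have h3 : dec i w n = w n := by rw [dec, if_neg (by omega)]
      rw [h2, h3, hd, smul_comm (p : R), smul_smul, smul_smul, ← pow_add, ← pow_add]
      congr 1
      · apply neg_one_pow_congr_even
        simp only [Nat.even_add, Nat.even_mul, Nat.even_add_one]
        tauto
      congr 1
      refine X_congr fun j _ => ?_
      grind [rotIdx, dec]
    · simp
  · have h1 : rotIdx n w 0 = w n := by simp [rotIdx]
    rw [intTerm, intTerm, h1]
    split_ifs with h
    · have hd := deg_dec (n := n) (i := n) le_rfl (w := w) h.pos.ne'
      have hl : deg n w = ∑ j ∈ Finset.range n, w j + w n := Finset.sum_range_succ _ _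
      rw [map_zsmul, map_smul, rot_X]
      have h3 : dec n w n = w n - 1 := by rw [dec, if_pos rfl]
      have h4 : Even (w n - 1) := by
        obtain ⟨m, hm⟩ := h
        exact ⟨m, by omega⟩
      rw [h3, hd, smul_comm (p : R), smul_smul, smul_smul, ← pow_add, ← pow_add]
      congr 1
      · apply neg_one_pow_congr_even
        have := Nat.not_even_iff_odd.2 h
        rw [hl]
        simp only [Nat.even_add, Nat.even_mul, Nat.even_add_one, Finset.range_zero,
          Finset.sum_empty]
        tauto
      congr 1
      refine X_congr fun j _ => ?_
      grind [rotIdx, dec]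
    · simp

theorem int_intTerm (p n i : ℕ) (w : ℕ → ℕ) :
    int (killP R p) n (intTerm R p n i w) = ∑ j ∈ Finset.range (n + 1),
      if Odd (w i) then ((-1 : ℤ) ^ (∑ j ∈ Finset.range i, w j)) • (p : R) • intTerm R p n j (dec i w)
        else 0 := by
  rw [intTerm]
  split_ifs
  · rw [map_zsmul, map_smul, int_X, Finset.smul_sum, ← Finset.sum_zsmul]
  · simp

theorem intTerm_swap (p n i j : ℕ) (w : ℕ → ℕ) (hij : i < j) :
    (if Odd (w i) then ((-1 : ℤ) ^ (∑ k ∈ Finset.range i, w k)) • (p : R) •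
      intTerm R p n j (dec i w) else 0) +
    (if Odd (w j) then ((-1 : ℤ) ^ (∑ k ∈ Finset.range j, w k)) • (p : R) •
      intTerm R p n i (dec j w) else 0) = 0 := by
  have h1 : dec i w j = w j := by rw [dec, if_neg (by omega)]
  have h2 : dec j w i = w i := by rw [dec, if_neg (by omega)]
  rw [intTerm, intTerm, h1, h2]
  by_cases hi : Odd (w i)
  swap; · simp [hi]
  by_cases hj : Odd (w j)
  swap; · simp [hj]
  simp only [hi, hj, if_true]
  have h3 : ∑ k ∈ Finset.range i, dec j w k = ∑ k ∈ Finset.range i, w k :=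
    Finset.sum_congr rfl fun k hk => by
      have := Finset.mem_range.1 hk
      rw [dec, if_neg (by omega)]
  have h4 : ∑ k ∈ Finset.range j, dec i w k + 1 = ∑ k ∈ Finset.range j, w k := by
    obtain ⟨m, rfl⟩ : ∃ m, j = m + 1 := ⟨j - 1, by omega⟩
    exact deg_dec (by omega) hi.pos.ne'
  have h5 : X R n (dec i (dec j w)) = X R n (dec j (dec i w)) := X_congr fun k _ => by
    grind [dec]
  rw [h3, ← h4, h5, smul_comm (p : R) ((-1 : ℤ) ^ _), smul_comm (p : R) ((-1 : ℤ) ^ _), smul_smul,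
    smul_smul ((-1 : ℤ) ^ _), ← add_smul, pow_succ]
  ring_nf

/-- Applying the differential to two different factors in either order gives opposite signs, and
twice to one factor gives zero. The double sum equals its own transpose, hence twice it vanishes,
and `2` is a unit. -/
theorem int_comp_int (h2 : IsUnit (2 : R)) (p n : ℕ) :
    int (killP R p) n ∘ₗ int (killP R p) n = 0 := by
  refine hom_ext fun w => ?_
  simp only [LinearMap.comp_apply, int_X, map_sum, int_intTerm, LinearMap.zero_apply]
  set c : ℕ → ℕ → T R (AddMonoidAlgebra R ℕ) n := fun i j => if Odd (w i) then
    ((-1 : ℤ) ^ (∑ j ∈ Finset.range i, w j)) • (p : R) • intTerm R p n j (dec i w) else 0 with hc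
  have hanti : ∀ i j, c i j + c j i = 0 := by
    intro i j
    rcases lt_trichotomy i j with h | h | h
    · exact intTerm_swap p n i j w h
    · subst h
      have : c i i = 0 := by
        simp only [hc]
        split_ifs with hi
        · have : ¬ Odd (dec i w i) := by
            rw [dec, if_pos rfl, Nat.not_odd_iff_even]
            obtain ⟨m, hm⟩ := hi
            exact ⟨m, by omega⟩
          rw [intTerm, if_neg this]
          simp
        · rfl
      simp [this]
    · rw [add_comm]; exact intTerm_swap p n j i w h
  have hS : (2 : R) • (∑ i ∈ Finset.range (n + 1), ∑ j ∈ Finset.range (n + 1), c i j) = 0 := by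
    rw [two_smul]
    nth_rewrite 2 [Finset.sum_comm]
    simp only [← Finset.sum_add_distrib, hanti, Finset.sum_const_zero]
  exact (h2.smul_eq_zero).1 hS

end Internal

end Hoch

namespace Hoch

/-! ### The Hochschild mixed complex of `R[x]` -/

section MixedIdentities

variable {R : Type u} [CommRing R]

variable (R) in
/-- The signed face maps. -/
def sfc (n i : ℕ) : T R (AddMonoidAlgebra R ℕ) (n + 1) →ₗ[R] T R (AddMonoidAlgebra R ℕ) n :=
  (-1 : ℤ) ^ i • fc R n i

variable (R) in
/-- The acyclic boundary `b' = ∑_{i ≤ n} (-1)^i dᵢ`. -/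
def bP (n : ℕ) : T R (AddMonoidAlgebra R ℕ) (n + 1) →ₗ[R] T R (AddMonoidAlgebra R ℕ) n :=
  ∑ i ∈ Finset.range (n + 1), sfc R n i

theorem bP_apply (n : ℕ) (c : T R (AddMonoidAlgebra R ℕ) (n + 1)) :
    bP R n c = ∑ i ∈ Finset.range (n + 1), sfc R n i c := by
  rw [bP, LinearMap.sum_apply]

theorem sfc_zero_apply (n : ℕ) (c : T R (AddMonoidAlgebra R ℕ) (n + 1)) :
    sfc R n 0 c = fc R n 0 c := by simp [sfc]

theorem t_apply (n : ℕ) (c : T R (AddMonoidAlgebra R ℕ) n) :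
    t (gr R) n c = (-1 : ℤ) ^ n • rot (gr R) n c := rfl

theorem sfc_apply (n i : ℕ) (c : T R (AddMonoidAlgebra R ℕ) (n + 1)) :
    sfc R n i c = (-1 : ℤ) ^ i • fc R n i c := rfl

theorem t_pow_card (n : ℕ) : t (gr R) n ^ (n + 1) = 1 := by
  rw [t, smul_pow, rot_pow_card, ← pow_mul, (Nat.even_mul_succ_self n).neg_one_pow, one_smul]

theorem t_pow_card_apply (n : ℕ) (c : T R (AddMonoidAlgebra R ℕ) n) :
    (t (gr R) n ^ (n + 1)) c = c := by rw [t_pow_card]; rfl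

theorem b_apply (n : ℕ) (c : T R (AddMonoidAlgebra R ℕ) (n + 1)) :
    b (gr R) n c = bP R n c + fc R n 0 (t (gr R) (n + 1) c) := by
  rw [b, LinearMap.add_apply, bP_apply, LinearMap.sum_apply, ← Fin.sum_univ_eq_sum_range
    (fun i => sfc R n i c), t_apply, map_zsmul, face_eq_fc]
  congr 1
  exact Finset.sum_congr rfl fun i _ => by rw [face_eq_fc]; rfl

theorem sfc_succ_t {n i : ℕ} (hi : i + 1 ≤ n) (c : T R (AddMonoidAlgebra R ℕ) (n + 1)) :
    sfc R n (i + 1) (t (gr R) (n + 1) c) = t (gr R) n (sfc R n i c) := by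
  have h := LinearMap.congr_fun (fc_succ_comp_rot (R := R) hi) c
  simp only [LinearMap.comp_apply] at h
  rw [sfc_apply, t_apply, map_zsmul, h, t_apply, sfc_apply, map_zsmul, smul_smul, smul_smul]
  congr 1
  ring

theorem t_sfc_last (n : ℕ) (c : T R (AddMonoidAlgebra R ℕ) (n + 1)) :
    t (gr R) n (sfc R n n c) = fc R n 0 (t (gr R) (n + 1) (t (gr R) (n + 1) c)) := by
  have h := LinearMap.congr_fun (rot_comp_fc_last (R := R) n) c
  simp only [LinearMap.comp_apply] at h
  simp only [sfc_apply, t_apply, map_zsmul, h, smul_smul]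
  congr 1
  ring

/-- This expresses every signed face `d_i` as a conjugate `t^i d_0 t^(-i)` of the first one, so that
after composing with the norm only `d_0` matters. -/
theorem sfc_t_pow {n i : ℕ} (hi : i ≤ n) (c : T R (AddMonoidAlgebra R ℕ) (n + 1)) :
    sfc R n i ((t (gr R) (n + 1) ^ i) c) = (t (gr R) n ^ i) (fc R n 0 c) := by
  induction i with
  | zero => simp [sfc_zero_apply]
  | succ i ih =>
    rw [pow_succ', Module.End.mul_apply, sfc_succ_t hi, ih (by omega), pow_succ',
      Module.End.mul_apply]

theorem N_t (n : ℕ) (c : T R (AddMonoidAlgebra R ℕ) n) :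
    N (gr R) n (t (gr R) n c) = N (gr R) n c := by
  have h := LinearMap.congr_fun (geom_sum_mul (t (gr R) n) (n + 1)) c
  rw [t_pow_card, sub_self] at h
  simpa [N, mul_sub, sub_eq_zero] using h

theorem t_N (n : ℕ) (c : T R (AddMonoidAlgebra R ℕ) n) :
    t (gr R) n (N (gr R) n c) = N (gr R) n c := by
  have h := LinearMap.congr_fun (mul_geom_sum (t (gr R) n) (n + 1)) c
  rw [t_pow_card, sub_self] at h
  simpa [N, sub_mul, sub_eq_zero] using h

theorem N_t_pow (n i : ℕ) (c : T R (AddMonoidAlgebra R ℕ) n) :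
    N (gr R) n ((t (gr R) n ^ i) c) = N (gr R) n c := by
  induction i with
  | zero => simp
  | succ i ih => rw [pow_succ', Module.End.mul_apply, N_t, ih]

theorem t_pow_N (n i : ℕ) (c : T R (AddMonoidAlgebra R ℕ) n) :
    (t (gr R) n ^ i) (N (gr R) n c) = N (gr R) n c := by
  induction i with
  | zero => simp
  | succ i ih => rw [pow_succ', Module.End.mul_apply, ih, t_N]

theorem N_apply (n : ℕ) (c : T R (AddMonoidAlgebra R ℕ) n) :
    N (gr R) n c = ∑ i ∈ Finset.range (n + 1), (t (gr R) n ^ i) c := by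
  rw [N, LinearMap.sum_apply]

theorem bP_N (n : ℕ) (c : T R (AddMonoidAlgebra R ℕ) (n + 1)) :
    bP R n (N (gr R) (n + 1) c) = N (gr R) n (fc R n 0 (N (gr R) (n + 1) c)) := by
  rw [bP_apply, N_apply n]
  refine Finset.sum_congr rfl fun i hi => ?_
  have := Finset.mem_range.1 hi
  conv_lhs => rw [← t_pow_N (n + 1) i c]
  rw [sfc_t_pow (by omega)]

/-- The `n + 2` faces in `b`, conjugated to `d_0`, involve each power of `t` exactly once; the norm
on the left absorbs the powers on that side and the sum of those on the right is the norm. -/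
theorem N_b (n : ℕ) (c : T R (AddMonoidAlgebra R ℕ) (n + 1)) :
    N (gr R) n (b (gr R) n c) = N (gr R) n (fc R n 0 (N (gr R) (n + 1) c)) := by
  have h : ∀ i ∈ Finset.range (n + 1), N (gr R) n (sfc R n i c) =
      N (gr R) n (fc R n 0 ((t (gr R) (n + 1) ^ (n + 2 - i)) c)) := fun i hi => by
    have := Finset.mem_range.1 hi
    have e : c = (t (gr R) (n + 1) ^ i) ((t (gr R) (n + 1) ^ (n + 2 - i)) c) := by
      rw [← Module.End.mul_apply, ← pow_add, show i + (n + 2 - i) = n + 1 + 1 by omega,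
        t_pow_card_apply]
    conv_lhs => rw [e]
    rw [sfc_t_pow (by omega), N_t_pow]
  rw [b_apply, bP_apply, map_add, map_sum, Finset.sum_congr rfl h, N_apply (n + 1), map_sum, map_sum,
    Finset.sum_range_succ' (fun i => N (gr R) n (fc R n 0 ((t (gr R) (n + 1) ^ i) c)))]
  have h0 : ((t (gr R) (n + 1) ^ 0) c) = (t (gr R) (n + 1) ^ (n + 1 + 1)) c := by
    rw [t_pow_card_apply, pow_zero, Module.End.one_apply]
  rw [h0, ← Finset.sum_range_succ (fun i => N (gr R) n (fc R n 0 ((t (gr R) (n + 1) ^ (i + 1)) c))),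
    ← Finset.sum_range_reflect (fun i => N (gr R) n (fc R n 0 ((t (gr R) (n + 1) ^ (i + 1)) c))),
    Finset.sum_range_succ _ (n + 1)]
  congr 1
  · refine Finset.sum_congr rfl fun i hi => ?_
    have := Finset.mem_range.1 hi
    rw [show n + 1 + 1 - 1 - i + 1 = n + 2 - i by omega]
  · rw [show n + 1 + 1 - 1 - (n + 1) + 1 = 1 by omega, pow_one]

theorem bP_N_eq_N_b (n : ℕ) (c : T R (AddMonoidAlgebra R ℕ) (n + 1)) :
    bP R n (N (gr R) (n + 1) c) = N (gr R) n (b (gr R) n c) := by rw [bP_N, N_b]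

/-- The classical identity `b (1 - t) = (1 - t) b'`: with `t` on the right all faces but one shift
by one index, and the sums cancel up to the two extreme terms. -/
theorem b_sub_t (n : ℕ) (c : T R (AddMonoidAlgebra R ℕ) (n + 1)) :
    b (gr R) n (c - t (gr R) (n + 1) c) = bP R n c - t (gr R) n (bP R n c) := by
  have h1 : bP R n (t (gr R) (n + 1) c) =
      ∑ i ∈ Finset.range n, t (gr R) n (sfc R n i c) + fc R n 0 (t (gr R) (n + 1) c) := by
    rw [bP_apply, Finset.sum_range_succ', sfc_zero_apply]
    congr 1
    refine Finset.sum_congr rfl fun i hi => ?_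
    have := Finset.mem_range.1 hi
    rw [sfc_succ_t (by omega)]
  have h2 : t (gr R) n (bP R n c) = ∑ i ∈ Finset.range n, t (gr R) n (sfc R n i c) +
      fc R n 0 (t (gr R) (n + 1) (t (gr R) (n + 1) c)) := by
    rw [bP_apply, map_sum, Finset.sum_range_succ, t_sfc_last]
  rw [map_sub, b_apply, b_apply, h1, h2]
  abel

theorem bP_s_succ (n : ℕ) (c : T R (AddMonoidAlgebra R ℕ) (n + 1)) :
    bP R (n + 1) (s R (AddMonoidAlgebra R ℕ) (n + 1) c) =
      c - s R (AddMonoidAlgebra R ℕ) n (bP R n c) := by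
  have h0 := LinearMap.congr_fun (fc_zero_comp_s (R := R) (n + 1)) c
  simp only [LinearMap.comp_apply, LinearMap.id_apply] at h0
  rw [bP_apply, Finset.sum_range_succ', sfc_zero_apply, h0, bP_apply, map_sum, sub_eq_neg_add,
    ← Finset.sum_neg_distrib]
  congr 1
  refine Finset.sum_congr rfl fun i _ => ?_
  have h := LinearMap.congr_fun (fc_succ_comp_s (R := R) n i) c
  simp only [LinearMap.comp_apply] at h
  rw [sfc_apply, h, sfc_apply, map_zsmul, pow_succ, mul_neg_one, neg_smul]

theorem bP_s_zero (c : T R (AddMonoidAlgebra R ℕ) 0) :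
    bP R 0 (s R (AddMonoidAlgebra R ℕ) 0 c) = c := by
  have h0 := LinearMap.congr_fun (fc_zero_comp_s (R := R) 0) c
  simp only [LinearMap.comp_apply, LinearMap.id_apply] at h0
  rw [bP_apply, Finset.sum_range_one, sfc_zero_apply, h0]

theorem B_apply (n : ℕ) (c : T R (AddMonoidAlgebra R ℕ) n) :
    B (gr R) n c = s R (AddMonoidAlgebra R ℕ) n (N (gr R) n c) -
      t (gr R) (n + 1) (s R (AddMonoidAlgebra R ℕ) n (N (gr R) n c)) := rfl

theorem b_B_zero (c : T R (AddMonoidAlgebra R ℕ) 0) : b (gr R) 0 (B (gr R) 0 c) = 0 := by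
  rw [B_apply, b_sub_t, bP_s_zero, t_N, sub_self]

/-- With `B = (1 - t) s N`, move `b` past `1 - t` to get `b'`, use `b' s = 1 - s b'` and `b' N = N
b`; the term coming from `1` dies because `(1 - t) N = 0`. -/
theorem b_B_succ (n : ℕ) (c : T R (AddMonoidAlgebra R ℕ) (n + 1)) :
    b (gr R) (n + 1) (B (gr R) (n + 1) c) + B (gr R) n (b (gr R) n c) = 0 := by
  rw [B_apply, b_sub_t, bP_s_succ, bP_N_eq_N_b, B_apply, map_sub, t_N]
  abel

theorem B_B (n : ℕ) (c : T R (AddMonoidAlgebra R ℕ) n) :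
    B (gr R) (n + 1) (B (gr R) n c) = 0 := by
  rw [B_apply (n + 1), B_apply n, map_sub, N_t, sub_self]
  simp

theorem int_t (p n : ℕ) (c : T R (AddMonoidAlgebra R ℕ) n) :
    int (killP R p) n (t (gr R) n c) = t (gr R) n (int (killP R p) n c) := by
  have h := LinearMap.congr_fun (int_comp_rot (R := R) p n) c
  simp only [LinearMap.comp_apply] at h
  rw [t_apply, map_zsmul, h, t_apply]

theorem int_s (p n : ℕ) (c : T R (AddMonoidAlgebra R ℕ) n) :
    int (killP R p) (n + 1) (s R (AddMonoidAlgebra R ℕ) n c) =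
      s R (AddMonoidAlgebra R ℕ) n (int (killP R p) n c) :=
  LinearMap.congr_fun (int_comp_s (R := R) p n) c

theorem int_N (p n : ℕ) (c : T R (AddMonoidAlgebra R ℕ) n) :
    int (killP R p) n (N (gr R) n c) = N (gr R) n (int (killP R p) n c) := by
  rw [N_apply, N_apply, map_sum]
  refine Finset.sum_congr rfl fun i hi => ?_
  clear hi
  induction i with
  | zero => simp
  | succ i ih => rw [pow_succ', Module.End.mul_apply, int_t, ih, Module.End.mul_apply]

theorem int_B (p n : ℕ) (c : T R (AddMonoidAlgebra R ℕ) n) :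
    int (killP R p) (n + 1) (B (gr R) n c) = B (gr R) n (int (killP R p) n c) := by
  rw [B_apply, map_sub, int_t, int_s, int_N, B_apply]

theorem int_fc (p : ℕ) {n k : ℕ} (hk : k ≤ n) (c : T R (AddMonoidAlgebra R ℕ) (n + 1)) :
    int (killP R p) n (fc R n k c) = fc R n k (int (killP R p) (n + 1) c) :=
  LinearMap.congr_fun (int_comp_fc p n k hk) c

theorem int_b (p n : ℕ) (c : T R (AddMonoidAlgebra R ℕ) (n + 1)) :
    int (killP R p) n (b (gr R) n c) = b (gr R) n (int (killP R p) (n + 1) c) := by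
  rw [b_apply, b_apply, map_add, int_fc p (Nat.zero_le n), int_t, bP_apply, bP_apply, map_sum]
  congr 1
  refine Finset.sum_congr rfl fun i hi => ?_
  have := Finset.mem_range.1 hi
  rw [sfc_apply, map_zsmul, int_fc p (by omega), sfc_apply]

/-! ### The Hochschild boundary squares to zero -/

theorem sum_split_at {N : Type*} [AddCommMonoid N] (f : ℕ → N) {i m : ℕ} (hi : i < m) :
    ∑ j ∈ Finset.range (m + 1), f j = ∑ j ∈ Finset.range m, (if j ≤ i then f j else 0) +
      ∑ j ∈ Finset.range m, (if i ≤ j then f (j + 1) else 0) := by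
  induction m, hi using Nat.le_induction with
  | base =>
    rw [Finset.sum_range_succ, Finset.sum_range_succ (fun j => if i ≤ j then f (j + 1) else 0),
      if_pos le_rfl]
    have h1 : ∑ j ∈ Finset.range i, (if i ≤ j then f (j + 1) else 0) = 0 :=
      Finset.sum_eq_zero fun j hj => by
        have := Finset.mem_range.1 hj
        rw [if_neg (by omega)]
    rw [h1, zero_add]
    congr 1
    exact Finset.sum_congr rfl fun j hj => by
      have := Finset.mem_range.1 hj
      rw [if_pos (by omega)]
  | succ m hm ih =>
    rw [Finset.sum_range_succ, ih, Finset.sum_range_succ _ m,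
      Finset.sum_range_succ (fun j => if i ≤ j then f (j + 1) else 0) m, if_neg (by omega),
      if_pos (by omega), add_zero, add_assoc]

/-- The simplicial identity pairs `(i, j)` with `i < j` against `(j - 1, i)`, whose sign is
opposite. `sum_split_at` separates the two triangles of index pairs. -/
theorem alternating_sum_sq {N : Type*} [AddCommGroup N] {m : ℕ} (a : ℕ → ℕ → N)
    (h : ∀ i j, i < j → j ≤ m → a i j = a (j - 1) i) :
    ∑ i ∈ Finset.range m, ∑ j ∈ Finset.range (m + 1), (-1 : ℤ) ^ (i + j) • a i j = 0 := by
  rw [Finset.sum_congr rfl fun i hi => sum_split_at (fun j => (-1 : ℤ) ^ (i + j) • a i j)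
    (Finset.mem_range.1 hi), Finset.sum_add_distrib]
  nth_rewrite 2 [Finset.sum_comm]
  rw [← Finset.sum_add_distrib]
  refine Finset.sum_eq_zero fun i hi => ?_
  rw [← Finset.sum_add_distrib]
  refine Finset.sum_eq_zero fun j _ => ?_
  have := Finset.mem_range.1 hi
  split_ifs with h1
  · rw [h j (i + 1) (by omega) (by omega), Nat.add_sub_cancel, ← add_smul]
    rw [show j + (i + 1) = i + j + 1 by ring, pow_succ]
    simp
  · simp

variable (R) in
/-- All `n + 2` face maps on `n + 1`-chains, including the cyclic one. -/
def fullFc (n i : ℕ) : T R (AddMonoidAlgebra R ℕ) (n + 1) →ₗ[R] T R (AddMonoidAlgebra R ℕ) n :=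
  if i ≤ n then fc R n i else fc R n 0 ∘ₗ rot (gr R) (n + 1)

theorem fullFc_comp_fullFc (n : ℕ) {i j : ℕ} (hij : i < j) (hj : j ≤ n + 2) :
    fullFc R n i ∘ₗ fullFc R (n + 1) j = fullFc R n (j - 1) ∘ₗ fullFc R (n + 1) i := by
  unfold fullFc
  by_cases h : j ≤ n + 1
  · rw [if_pos (by omega), if_pos h, if_pos (by omega), if_pos (by omega), fc_comp_fc n hij]
  · obtain rfl : j = n + 2 := by omega
    rw [if_neg h, if_neg (show ¬ n + 2 - 1 ≤ n by omega), if_pos (show i ≤ n + 1 by omega)]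
    by_cases hi : i ≤ n
    · rw [if_pos hi, ← LinearMap.comp_assoc, show fc R n i = fc R n (i + 1 - 1) from rfl,
        ← fc_comp_fc n (Nat.succ_pos i), LinearMap.comp_assoc, fc_succ_comp_rot (by omega),
        LinearMap.comp_assoc]
    · obtain rfl : i = n + 1 := by omega
      rw [if_neg hi, LinearMap.comp_assoc, LinearMap.comp_assoc, rot_comp_fc_last]
      refine LinearMap.ext fun c => ?_
      have h1 := LinearMap.congr_fun (fc_succ_comp_rot (R := R) (n := n + 1) (i := 0) (by omega))
        (rot (gr R) (n + 2) c)
      have h2 := LinearMap.congr_fun (fc_comp_fc (R := R) n (i := 0) (j := 1) (by omega))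
        (rot (gr R) (n + 2) (rot (gr R) (n + 2) c))
      simp only [LinearMap.comp_apply] at h1 h2 ⊢
      rw [← h1]
      exact h2

theorem b_eq_sum_fullFc (n : ℕ) (c : T R (AddMonoidAlgebra R ℕ) (n + 1)) :
    b (gr R) n c = ∑ i ∈ Finset.range (n + 2), (-1 : ℤ) ^ i • fullFc R n i c := by
  rw [Finset.sum_range_succ, b_apply, bP_apply]
  congr 1
  · refine Finset.sum_congr rfl fun i hi => ?_
    have := Finset.mem_range.1 hi
    rw [fullFc, if_pos (by omega), sfc_apply]
  · rw [fullFc, if_neg (by omega), t_apply, map_zsmul]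
    rfl

theorem b_b (n : ℕ) (c : T R (AddMonoidAlgebra R ℕ) (n + 2)) :
    b (gr R) n (b (gr R) (n + 1) c) = 0 := by
  rw [b_eq_sum_fullFc, b_eq_sum_fullFc, ← alternating_sum_sq (m := n + 2)
    (fun i j => fullFc R n i (fullFc R (n + 1) j c))
    (fun i j h1 h2 => LinearMap.congr_fun (fullFc_comp_fullFc n h1 h2) c)]
  refine Finset.sum_congr rfl fun i _ => ?_
  rw [map_sum, ← Finset.sum_zsmul]
  refine Finset.sum_congr rfl fun j _ => ?_
  rw [map_zsmul, smul_smul, pow_add]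

theorem totd_apply (p : ℕ) (c : ∀ n, T R (AddMonoidAlgebra R ℕ) n) (n : ℕ) :
    totd (killP R p) c n = b (gr R) n (c (n + 1)) + (-1 : ℤ) ^ n • int (killP R p) n (c n) := rfl

theorem totB_zero (c : ∀ n, T R (AddMonoidAlgebra R ℕ) n) : totB (gr R) c 0 = 0 := rfl

theorem totB_succ (c : ∀ n, T R (AddMonoidAlgebra R ℕ) n) (n : ℕ) :
    totB (gr R) c (n + 1) = B (gr R) n (c n) := rfl

theorem totd_totd (h2 : IsUnit (2 : R)) (p : ℕ) (c : ∀ n, T R (AddMonoidAlgebra R ℕ) n) :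
    totd (killP R p) (totd (killP R p) c) = 0 := by
  funext n
  have hii := LinearMap.congr_fun (int_comp_int h2 p n) (c n)
  simp only [LinearMap.comp_apply, LinearMap.zero_apply] at hii
  simp only [totd_apply, map_add, map_zsmul, b_b, int_b, hii, zsmul_zero, add_zero, zero_add,
    pow_succ, mul_neg_one, neg_smul, Pi.zero_apply, map_neg, neg_add_cancel]

theorem totB_totB (c : ∀ n, T R (AddMonoidAlgebra R ℕ) n) : totB (gr R) (totB (gr R) c) = 0 := by
  funext n
  rcases n with _ | _ | n
  · rfl
  · rw [totB_succ, totB_zero, map_zero, Pi.zero_apply]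
  · rw [totB_succ, totB_succ, B_B, Pi.zero_apply]

theorem totd_totB (p : ℕ) (c : ∀ n, T R (AddMonoidAlgebra R ℕ) n) :
    totd (killP R p) (totB (gr R) c) + totB (gr R) (totd (killP R p) c) = 0 := by
  funext n
  rcases n with _ | n
  · simp only [Pi.add_apply, totd_apply, totB_zero, totB_succ, b_B_zero, map_zero, zsmul_zero,
      add_zero, Pi.zero_apply]
  · simp only [Pi.add_apply, totd_apply, totB_succ, int_B, map_add, map_zsmul, Pi.zero_apply,
      pow_succ, mul_neg_one, neg_smul]
    have h := b_B_succ n (c (n + 1))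
    rw [← h]
    abel

/-! ### Behaviour of the operators on degrees -/

theorem rot_mem_intDeg {n : ℕ} {q : ℤ} {c : T R (AddMonoidAlgebra R ℕ) n} (hc : c ∈ intDeg (gr R) n q) :
    rot (gr R) n c ∈ intDeg (gr R) n q :=
  intDeg_induction (fun w hw => by
    rw [rot_X]
    exact zsmul_mem (X_mem_intDeg _ _ (by rw [deg_rotIdx, hw])) _) hc

theorem fc_mem_intDeg {n i : ℕ} (hi : i ≤ n) {q : ℤ} {c : T R (AddMonoidAlgebra R ℕ) (n + 1)}
    (hc : c ∈ intDeg (gr R) (n + 1) q) : fc R n i c ∈ intDeg (gr R) n q :=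
  intDeg_induction (fun w hw => by
    rw [fc_X]
    exact X_mem_intDeg _ _ (by rw [deg_mrg hi, hw])) hc

theorem s_mem_intDeg {n : ℕ} {q : ℤ} {c : T R (AddMonoidAlgebra R ℕ) n}
    (hc : c ∈ intDeg (gr R) n q) : s R (AddMonoidAlgebra R ℕ) n c ∈ intDeg (gr R) (n + 1) q :=
  intDeg_induction (fun w hw => by
    rw [s_X]
    exact X_mem_intDeg _ _ (by rw [deg_shiftIdx, hw])) hc

theorem t_mem_intDeg {n : ℕ} {q : ℤ} {c : T R (AddMonoidAlgebra R ℕ) n}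
    (hc : c ∈ intDeg (gr R) n q) : t (gr R) n c ∈ intDeg (gr R) n q :=
  zsmul_mem (rot_mem_intDeg hc) _

theorem b_mem_intDeg {n : ℕ} {q : ℤ} {c : T R (AddMonoidAlgebra R ℕ) (n + 1)}
    (hc : c ∈ intDeg (gr R) (n + 1) q) : b (gr R) n c ∈ intDeg (gr R) n q := by
  rw [b_apply, bP_apply]
  refine add_mem (sum_mem fun i hi => zsmul_mem (fc_mem_intDeg ?_ hc) _)
    (fc_mem_intDeg (Nat.zero_le n) (t_mem_intDeg hc))
  have := Finset.mem_range.1 hi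
  omega

theorem B_mem_intDeg {n : ℕ} {q : ℤ} {c : T R (AddMonoidAlgebra R ℕ) n}
    (hc : c ∈ intDeg (gr R) n q) : B (gr R) n c ∈ intDeg (gr R) (n + 1) q := by
  have h : N (gr R) n c ∈ intDeg (gr R) n q := by
    rw [N_apply]
    refine sum_mem fun i hi => ?_
    clear hi
    induction i with
    | zero => simpa using hc
    | succ i ih => rw [pow_succ', Module.End.mul_apply]; exact t_mem_intDeg ih
  rw [B_apply]
  exact sub_mem (s_mem_intDeg h) (t_mem_intDeg (s_mem_intDeg h))

theorem int_mem_intDeg {p n : ℕ} {q : ℤ} {c : T R (AddMonoidAlgebra R ℕ) n}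
    (hc : c ∈ intDeg (gr R) n q) : int (killP R p) n c ∈ intDeg (gr R) n (q - 1) :=
  intDeg_induction (fun w hw => by
    rw [int_X]
    refine sum_mem fun i hi => ?_
    rw [intTerm]
    split_ifs with h
    · refine zsmul_mem (Submodule.smul_mem _ _ (X_mem_intDeg _ _ ?_)) _
      have := Finset.mem_range.1 hi
      have := deg_dec (n := n) (i := i) (by omega) (w := w) h.pos.ne'
      omega
    · exact zero_mem _) hc

theorem totd_mem_totDeg {p : ℕ} {m : ℤ} {c : ∀ n, T R (AddMonoidAlgebra R ℕ) n}
    (hc : c ∈ totDeg (gr R) m) : totd (killP R p) c ∈ totDeg (gr R) (m - 1) := fun n => by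
  rw [totd_apply]
  have h1 := hc (n + 1)
  have h2 := hc n
  have e1 : m - 1 - (n : ℤ) = m - ((n + 1 : ℕ) : ℤ) := by push_cast; ring
  have e2 : m - 1 - (n : ℤ) = m - (n : ℤ) - 1 := by ring
  refine add_mem (b_mem_intDeg ?_) (zsmul_mem ?_ _)
  · rw [e1]; exact h1
  · rw [e2]; exact int_mem_intDeg h2

theorem totB_mem_totDeg {m : ℤ} {c : ∀ n, T R (AddMonoidAlgebra R ℕ) n}
    (hc : c ∈ totDeg (gr R) m) : totB (gr R) c ∈ totDeg (gr R) (m + 1) := fun n => by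
  rcases n with _ | n
  · exact zero_mem _
  · rw [totB_succ]
    have e : m + 1 - ((n + 1 : ℕ) : ℤ) = m - n := by push_cast; ring
    rw [e]
    exact B_mem_intDeg (hc n)

theorem intDeg_neg {n : ℕ} {q : ℤ} (hq : q < 0) {c : T R (AddMonoidAlgebra R ℕ) n}
    (hc : c ∈ intDeg (gr R) n q) : c = 0 :=
  eq_of_intDeg (f := LinearMap.id) (g := 0) (fun w hw => by omega) hc

theorem totDeg_neg {m : ℤ} (hm : m < 0) {c : ∀ n, T R (AddMonoidAlgebra R ℕ) n}
    (hc : c ∈ totDeg (gr R) m) : c = 0 :=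
  funext fun n => intDeg_neg (by omega) (hc n)

end MixedIdentities

end Hoch

namespace Hoch

/-! ### Acyclicity of the Hochschild complex of the free algebra `R[x]` -/

section Contraction

variable {R : Type u} [CommRing R]

/-- The multi-index of `x^(w 0 + l) ⊗ x ⊗ x^(w 1 - 1 - l) ⊗ x^(w 2) ⊗ ⋯`. -/
def splitIdx (l : ℕ) (w : ℕ → ℕ) (j : ℕ) : ℕ :=
  if j = 0 then w 0 + l else if j = 1 then 1 else if j = 2 then w 1 - 1 - l else w (j - 1)

/-- The multi-index of `x^(w 0 + w 1) ⊗ 1 ⊗ 1 ⊗ x^(w 2) ⊗ ⋯`. -/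
def padIdx (w : ℕ → ℕ) (j : ℕ) : ℕ :=
  if j = 0 then w 0 + w 1 else if j ≤ 2 then 0 else w (j - 1)

variable (R) in
/-- The operator splitting the second tensor factor. -/
def split (n : ℕ) : T R (AddMonoidAlgebra R ℕ) (n + 1) →ₗ[R] T R (AddMonoidAlgebra R ℕ) (n + 2) :=
  lin (n + 1) (fun w => ∑ l ∈ Finset.range (w 1), X R (n + 2) (splitIdx l w))

variable (R) in
/-- The operator merging the first two tensor factors and inserting two units. -/
def pad (n : ℕ) : T R (AddMonoidAlgebra R ℕ) (n + 1) →ₗ[R] T R (AddMonoidAlgebra R ℕ) (n + 2) :=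
  lin (n + 1) (fun w => X R (n + 2) (padIdx w))

theorem split_X (n : ℕ) (w : ℕ → ℕ) :
    split R n (X R (n + 1) w) = ∑ l ∈ Finset.range (w 1), X R (n + 2) (splitIdx l w) := by
  refine lin_X (fun w w' h => ?_) w
  rw [h 1 (by omega)]
  refine Finset.sum_congr rfl fun l _ => X_congr fun j hj => ?_
  have := h 0 (by omega)
  have := h 1 (by omega)
  have := h (j - 1) (by omega)
  grind [splitIdx]

theorem pad_X (n : ℕ) (w : ℕ → ℕ) : pad R n (X R (n + 1) w) = X R (n + 2) (padIdx w) := by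
  refine lin_X (fun w w' h => X_congr fun j hj => ?_) w
  have := h 0 (by omega)
  have := h 1 (by omega)
  have := h (j - 1) (by omega)
  grind [padIdx]

theorem deg_splitIdx {n l : ℕ} {w : ℕ → ℕ} (hl : l < w 1) :
    deg (n + 2) (splitIdx l w) = deg (n + 1) w := by
  rw [deg, Finset.sum_range_succ', Finset.sum_range_succ', Finset.sum_range_succ', deg,
    Finset.sum_range_succ', Finset.sum_range_succ']
  have : ∑ k ∈ Finset.range n, splitIdx l w (k + 1 + 1 + 1) = ∑ k ∈ Finset.range n, w (k + 1 + 1) :=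
    Finset.sum_congr rfl fun k _ => by simp [splitIdx]
  rw [this]
  simp [splitIdx]
  omega

theorem deg_padIdx (n : ℕ) (w : ℕ → ℕ) : deg (n + 2) (padIdx w) = deg (n + 1) w := by
  rw [deg, Finset.sum_range_succ', Finset.sum_range_succ', Finset.sum_range_succ', deg,
    Finset.sum_range_succ', Finset.sum_range_succ']
  have : ∑ k ∈ Finset.range n, padIdx w (k + 1 + 1 + 1) = ∑ k ∈ Finset.range n, w (k + 1 + 1) :=
    Finset.sum_congr rfl fun k _ => by simp [padIdx]
  rw [this]
  simp [padIdx]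
  omega

theorem fc_split {n i : ℕ} (hi : 2 ≤ i) (w : ℕ → ℕ) :
    fc R (n + 2) (i + 1) (split R (n + 1) (X R (n + 2) w)) =
      split R n (fc R (n + 1) i (X R (n + 2) w)) := by
  rw [split_X, map_sum, fc_X, split_X]
  have h : mrg i w 1 = w 1 := by rw [mrg, if_pos (by omega)]
  rw [h]
  refine Finset.sum_congr rfl fun l _ => ?_
  rw [fc_X]
  exact X_congr fun j _ => by grind [mrg, splitIdx]

theorem fc_pad {n i : ℕ} (hi : 2 ≤ i) (w : ℕ → ℕ) :
    fc R (n + 2) (i + 1) (pad R (n + 1) (X R (n + 2) w)) =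
      pad R n (fc R (n + 1) i (X R (n + 2) w)) := by
  rw [pad_X, fc_X, fc_X, pad_X]
  exact X_congr fun j _ => by grind [mrg, padIdx]

theorem fc_rot_split (n : ℕ) (w : ℕ → ℕ) :
    fc R (n + 2) 0 (rot (gr R) (n + 3) (split R (n + 1) (X R (n + 2) w))) =
      split R n (fc R (n + 1) 0 (rot (gr R) (n + 2) (X R (n + 2) w))) := by
  rw [split_X, map_sum, map_sum, rot_X, map_zsmul, map_zsmul, fc_X, split_X, ← Finset.sum_zsmul]
  have h : mrg 0 (rotIdx (n + 2) w) 1 = w 1 := by simp [mrg, rotIdx]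
  rw [h]
  refine Finset.sum_congr rfl fun l hl => ?_
  have h1 : splitIdx l w (n + 3) = w (n + 2) := by simp [splitIdx]
  rw [rot_X, map_zsmul, fc_X, deg_splitIdx (Finset.mem_range.1 hl), h1]
  congr 1
  exact X_congr fun j _ => by grind [mrg, splitIdx, rotIdx]

theorem fc_rot_pad (n : ℕ) (w : ℕ → ℕ) :
    fc R (n + 2) 0 (rot (gr R) (n + 3) (pad R (n + 1) (X R (n + 2) w))) =
      pad R n (fc R (n + 1) 0 (rot (gr R) (n + 2) (X R (n + 2) w))) := by
  rw [pad_X, rot_X, rot_X, map_zsmul, map_zsmul, map_zsmul, fc_X, fc_X, pad_X, deg_padIdx]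
  have h1 : padIdx w (n + 3) = w (n + 2) := by simp [padIdx]
  rw [h1]
  congr 1
  exact X_congr fun j _ => by grind [mrg, padIdx, rotIdx]

/-- An operator that only touches the first two factors commutes, up to the index shift, with all
faces away from them, so these cancel by sign in `b K + K b`. What remains are the faces 0, 1, 2
after `K` and 0, 1 before it. -/
theorem b_homotopy {n : ℕ} {w : ℕ → ℕ}
    {K : ∀ n, T R (AddMonoidAlgebra R ℕ) (n + 1) →ₗ[R] T R (AddMonoidAlgebra R ℕ) (n + 2)}
    (h1 : ∀ i, 2 ≤ i → fc R (n + 2) (i + 1) (K (n + 1) (X R (n + 2) w)) =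
      K n (fc R (n + 1) i (X R (n + 2) w)))
    (h2 : fc R (n + 2) 0 (rot (gr R) (n + 3) (K (n + 1) (X R (n + 2) w))) =
      K n (fc R (n + 1) 0 (rot (gr R) (n + 2) (X R (n + 2) w)))) :
    b (gr R) (n + 2) (K (n + 1) (X R (n + 2) w)) + K n (b (gr R) (n + 1) (X R (n + 2) w)) =
      fc R (n + 2) 0 (K (n + 1) (X R (n + 2) w)) - fc R (n + 2) 1 (K (n + 1) (X R (n + 2) w)) +
      fc R (n + 2) 2 (K (n + 1) (X R (n + 2) w)) + K n (fc R (n + 1) 0 (X R (n + 2) w)) -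
      K n (fc R (n + 1) 1 (X R (n + 2) w)) := by
  rw [b_apply, b_apply, bP_apply, bP_apply, Finset.sum_range_succ', Finset.sum_range_succ',
    Finset.sum_range_succ', Finset.sum_range_succ' _ (n + 1), Finset.sum_range_succ' _ n,
    t_apply, t_apply, map_zsmul, map_zsmul, h2, map_add, map_add, map_add, map_sum, map_zsmul]
  have h3 : ∑ k ∈ Finset.range n, sfc R (n + 2) (k + 1 + 1 + 1) (K (n + 1) (X R (n + 2) w)) =
      - ∑ k ∈ Finset.range n, K n (sfc R (n + 1) (k + 1 + 1) (X R (n + 2) w)) := by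
    rw [← Finset.sum_neg_distrib]
    refine Finset.sum_congr rfl fun k _ => ?_
    rw [sfc_apply, h1 _ (by omega), sfc_apply, map_zsmul, pow_succ _ (k + 1 + 1), mul_neg_one, neg_smul]
  rw [h3, pow_succ _ (n + 1 + 1), mul_neg_one, neg_smul]
  simp only [sfc_apply, zero_add, pow_zero, one_smul, pow_one, neg_smul, map_neg,
    show (1 + 1 : ℕ) = 2 from rfl, even_two.neg_one_pow]
  abel

variable (R) in
/-- The contracting homotopy of the Hochschild complex in degrees at least two. -/
def contr (n : ℕ) : T R (AddMonoidAlgebra R ℕ) (n + 1) →ₗ[R] T R (AddMonoidAlgebra R ℕ) (n + 2) :=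
  pad R n - split R n

/-- For `split`, the faces 0 and 1 telescope and the other three terms cancel because `c ↦ ∑ x^l ⊗ x
⊗ x^(c-1-l)` is a derivation. The telescoping leaves the monomial with its second factor absorbed in
the first, which is what `pad` compensates. -/
theorem contr_homotopy (n : ℕ) (c : T R (AddMonoidAlgebra R ℕ) (n + 2)) :
    b (gr R) (n + 2) (contr R (n + 1) c) + contr R n (b (gr R) (n + 1) c) = c := by
  suffices h : b (gr R) (n + 2) ∘ₗ contr R (n + 1) + contr R n ∘ₗ b (gr R) (n + 1) = LinearMap.id from
    LinearMap.congr_fun h c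
  refine hom_ext fun w => ?_
  have hs := b_homotopy (R := R) (n := n) (w := w) (K := split R) (fun i hi => fc_split hi w)
    (fc_rot_split n w)
  have hp := b_homotopy (R := R) (n := n) (w := w) (K := pad R) (fun i hi => fc_pad hi w)
    (fc_rot_pad n w)
  have e1 : fc R (n + 2) 0 (pad R (n + 1) (X R (n + 2) w)) =
      fc R (n + 2) 1 (pad R (n + 1) (X R (n + 2) w)) := by
    rw [pad_X, fc_X, fc_X]
    exact X_congr fun j _ => by grind [mrg, padIdx]
  have e2 : pad R n (fc R (n + 1) 0 (X R (n + 2) w)) = pad R n (fc R (n + 1) 1 (X R (n + 2) w)) := by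
    rw [fc_X, fc_X, pad_X, pad_X]
    exact X_congr fun j _ => by grind [mrg, padIdx]
  -- Moving one power of `x` at a time from the second factor to the first: the sum over `l`
  -- telescopes.
  have e3 : fc R (n + 2) 0 (split R (n + 1) (X R (n + 2) w)) -
      fc R (n + 2) 1 (split R (n + 1) (X R (n + 2) w)) =
      fc R (n + 2) 2 (pad R (n + 1) (X R (n + 2) w)) - X R (n + 2) w := by
    have h0 : ∀ l ∈ Finset.range (w 1), fc R (n + 2) 0 (X R (n + 3) (splitIdx l w)) -
        fc R (n + 2) 1 (X R (n + 3) (splitIdx l w)) =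
        X R (n + 2) (fun j => if j = 0 then w 0 + (l + 1) else if j = 1 then w 1 - (l + 1) else w j) -
        X R (n + 2) (fun j => if j = 0 then w 0 + l else if j = 1 then w 1 - l else w j) := by
      intro l hl
      have := Finset.mem_range.1 hl
      rw [fc_X, fc_X]
      congr 1
      · exact X_congr fun j _ => by grind [mrg, splitIdx]
      · exact X_congr fun j _ => by grind [mrg, splitIdx]
    rw [split_X, map_sum, map_sum, ← Finset.sum_sub_distrib, Finset.sum_congr rfl h0,
      Finset.sum_range_sub (fun l => X R (n + 2)
        (fun j => if j = 0 then w 0 + l else if j = 1 then w 1 - l else w j)), pad_X, fc_X]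
    congr 1
    · exact X_congr fun j _ => by grind [mrg, padIdx]
    · exact X_congr fun j _ => by grind
  -- Splitting `x^(w 1 + w 2)` is splitting either `x^(w 1)` or `x^(w 2)`; the range is cut
  -- accordingly.
  have e4 : fc R (n + 2) 2 (split R (n + 1) (X R (n + 2) w)) +
      split R n (fc R (n + 1) 0 (X R (n + 2) w)) - split R n (fc R (n + 1) 1 (X R (n + 2) w)) = 0 := by
    rw [split_X, map_sum, fc_X, fc_X, split_X, split_X]
    have h1 : mrg 1 w 1 = w 1 + w 2 := by simp [mrg]
    have h0 : mrg 0 w 1 = w 2 := by simp [mrg]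
    rw [h1, h0, Finset.sum_range_add, sub_eq_zero]
    congr 1
    · refine Finset.sum_congr rfl fun l hl => ?_
      have := Finset.mem_range.1 hl
      rw [fc_X]
      exact X_congr fun j _ => by grind [mrg, splitIdx]
    · refine Finset.sum_congr rfl fun l hl => ?_
      exact X_congr fun j _ => by grind [mrg, splitIdx]
  simp only [LinearMap.add_apply, LinearMap.comp_apply, contr, LinearMap.sub_apply, map_sub,
    LinearMap.id_apply]
  calc _ = (b (gr R) (n + 2) (pad R (n + 1) (X R (n + 2) w)) +
        pad R n (b (gr R) (n + 1) (X R (n + 2) w))) -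
      (b (gr R) (n + 2) (split R (n + 1) (X R (n + 2) w)) +
        split R n (b (gr R) (n + 1) (X R (n + 2) w))) := by abel
    _ = X R (n + 2) w := by
      rw [hs, hp, e1, e2, add_assoc _ (fc R (n + 2) 2 _) (split R n _), add_sub_assoc _ _ (split R n _),
        e4, e3]
      abel

theorem contr_mem_intDeg {n : ℕ} {q : ℤ} {c : T R (AddMonoidAlgebra R ℕ) (n + 1)}
    (hc : c ∈ intDeg (gr R) (n + 1) q) : contr R n c ∈ intDeg (gr R) (n + 2) q := by
  refine intDeg_induction (f := contr R n) (fun w hw => ?_) hc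
  rw [contr, LinearMap.sub_apply, pad_X, split_X]
  refine sub_mem (X_mem_intDeg _ _ (by rw [deg_padIdx, hw])) (sum_mem fun l hl => ?_)
  exact X_mem_intDeg _ _ (by rw [deg_splitIdx (Finset.mem_range.1 hl), hw])

/-- The multi-index of `x^a ⊗ x^c`. -/
def pairIdx (a c : ℕ) (j : ℕ) : ℕ := if j = 0 then a else c

/-- In tensor degree one the cyclic face no longer cancels: it sends each summand of `split` to a
signed copy of `x^(d-1) ⊗ x`. So the obstruction to contracting is a multiple of this one chain, and
only the signed count depends on the parity of `d`. -/
theorem b_contr_X (w : ℕ → ℕ) :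
    b (gr R) 1 (contr R 0 (X R 1 w)) = X R 1 w -
      (∑ l ∈ Finset.range (w 1), (-1 : ℤ) ^ (l * (deg 1 w + 1))) •
        X R 1 (pairIdx (deg 1 w - 1) 1) := by
  have hb : ∀ c : T R (AddMonoidAlgebra R ℕ) 2, b (gr R) 1 c =
      fc R 1 0 c - fc R 1 1 c + fc R 1 0 (rot (gr R) 2 c) := fun c => by
    rw [b_apply, bP_apply, Finset.sum_range_succ, Finset.sum_range_one, t_apply, sfc_apply, sfc_apply]
    simp only [pow_zero, one_smul, pow_one, neg_smul, show (1 + 1 : ℕ) = 2 from rfl,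
      even_two.neg_one_pow, sub_eq_add_neg]
  have hd : deg 1 w = w 0 + w 1 := by simp [deg, Finset.sum_range_succ]
  have hp : b (gr R) 1 (pad R 0 (X R 1 w)) = X R 1 (pairIdx (w 0 + w 1) 0) := by
    have h0 : padIdx w 2 = 0 := by simp [padIdx]
    rw [hb, pad_X, rot_X, map_zsmul, fc_X, fc_X, fc_X, h0, zero_mul, pow_zero, one_smul]
    have e1 : X R 1 (mrg 0 (padIdx w)) = X R 1 (mrg 1 (padIdx w)) :=
      X_congr fun j _ => by grind [mrg, padIdx]
    rw [e1, sub_self, zero_add]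
    exact X_congr fun j _ => by grind [mrg, padIdx, rotIdx, pairIdx]
  have hs : b (gr R) 1 (split R 0 (X R 1 w)) = X R 1 (pairIdx (w 0 + w 1) 0) - X R 1 w +
      (∑ l ∈ Finset.range (w 1), (-1 : ℤ) ^ (l * (deg 1 w + 1))) •
        X R 1 (pairIdx (deg 1 w - 1) 1) := by
    rw [hb, split_X, map_sum, map_sum, map_sum, map_sum, ← Finset.sum_sub_distrib]
    congr 1
    · have h0 : ∀ l ∈ Finset.range (w 1), fc R 1 0 (X R 2 (splitIdx l w)) -
          fc R 1 1 (X R 2 (splitIdx l w)) =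
          X R 1 (pairIdx (w 0 + (l + 1)) (w 1 - (l + 1))) - X R 1 (pairIdx (w 0 + l) (w 1 - l)) := by
        intro l hl
        have := Finset.mem_range.1 hl
        rw [fc_X, fc_X]
        congr 1
        · exact X_congr fun j _ => by grind [mrg, splitIdx, pairIdx]
        · exact X_congr fun j _ => by grind [mrg, splitIdx, pairIdx]
      rw [Finset.sum_congr rfl h0,
        Finset.sum_range_sub (fun l => X R 1 (pairIdx (w 0 + l) (w 1 - l)))]
      congr 1
      · rw [Nat.sub_self]
      · exact X_congr fun j _ => by grind [pairIdx]
    · rw [← Finset.sum_range_reflect, Finset.sum_smul]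
      refine Finset.sum_congr rfl fun l hl => ?_
      have := Finset.mem_range.1 hl
      have h2 : splitIdx (w 1 - 1 - l) w 2 = l := by simp [splitIdx]; omega
      rw [rot_X, deg_splitIdx (by omega), h2, map_zsmul, fc_X]
      congr 1
      exact X_congr fun j _ => by grind [mrg, splitIdx, rotIdx, pairIdx]
  rw [contr, LinearMap.sub_apply, map_sub, hp, hs]
  abel

variable (R) in
/-- The functional `x^a ⊗ x^c ↦ c` on one-chains. -/
def snd : T R (AddMonoidAlgebra R ℕ) 1 →ₗ[R] R := lin 1 (fun w => (w 1 : R))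

theorem snd_X (w : ℕ → ℕ) : snd R (X R 1 w) = w 1 :=
  lin_X (fun w w' h => by rw [h 1 le_rfl]) w

variable (R) in
/-- The coefficient of `x^k` in a zero-chain. -/
def coef (k : ℕ) : T R (AddMonoidAlgebra R ℕ) 0 →ₗ[R] R := lin 0 (fun w => if w 0 = k then 1 else 0)

theorem coef_X (k : ℕ) (w : ℕ → ℕ) : coef R k (X R 0 w) = if w 0 = k then 1 else 0 :=
  lin_X (fun w w' h => by rw [h 0 le_rfl]) w

theorem eq_coef_smul {k : ℕ} {c : T R (AddMonoidAlgebra R ℕ) 0} (hc : c ∈ intDeg (gr R) 0 (k : ℤ)) :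
    c = coef R k c • X R 0 (fun _ => k) := by
  refine eq_of_intDeg (f := LinearMap.id)
    (g := (LinearMap.toSpanSingleton R _ (X R 0 (fun _ => k))) ∘ₗ coef R k) (fun w hw => ?_) hc
  have : w 0 = k := by simpa [deg] using hw
  simp only [LinearMap.id_apply, LinearMap.comp_apply, coef_X, this, if_true,
    LinearMap.toSpanSingleton_apply, one_smul]
  exact X_congr fun j hj => by rw [Nat.le_zero.1 hj, this]

/-- In odd internal degree all signs are `+1`, so the count is the second exponent, which is what
`snd` reads off. -/
theorem b_contr_odd {q : ℕ} (hq : Odd q) {c : T R (AddMonoidAlgebra R ℕ) 1}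
    (hc : c ∈ intDeg (gr R) 1 (q : ℤ)) (h0 : snd R c = 0) : b (gr R) 1 (contr R 0 c) = c := by
  have h := eq_of_intDeg (f := b (gr R) 1 ∘ₗ contr R 0) (g := LinearMap.id -
    (LinearMap.toSpanSingleton R _ (X R 1 (pairIdx (q - 1) 1))) ∘ₗ snd R) (fun w hw => ?_) hc
  · simpa [h0] using h
  · have hw' : deg 1 w = q := by exact_mod_cast hw
    have : ∀ l, (-1 : ℤ) ^ (l * (q + 1)) = 1 := fun l =>
      ((hq.add_one).mul_left l).neg_one_pow
    change b (gr R) 1 (contr R 0 (X R 1 w)) = X R 1 w - snd R (X R 1 w) • X R 1 (pairIdx (q - 1) 1)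
    rw [b_contr_X, hw', snd_X]
    simp only [this, Finset.sum_const, Finset.card_range, nsmul_eq_mul,
      mul_one, ← Int.cast_smul_eq_zsmul R, Int.cast_natCast]

theorem b_zero_X (w : ℕ → ℕ) : b (gr R) 0 (X R 1 w) =
    X R 0 (fun _ => deg 1 w) - (-1 : ℤ) ^ (w 1 * (deg 1 w + 1)) • X R 0 (fun _ => deg 1 w) := by
  rw [b_apply, bP_apply, Finset.sum_range_one, t_apply, sfc_apply, rot_X]
  simp only [pow_zero, one_smul, zero_add, pow_one, neg_smul, map_neg, map_zsmul, fc_X]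
  rw [← sub_eq_add_neg]
  have hd : deg 1 w = w 0 + w 1 := by simp [deg, Finset.sum_range_succ]
  congr 1
  · exact X_congr fun j hj => by grind [mrg]
  · congr 1
    exact X_congr fun j hj => by grind [mrg, rotIdx]

/-- In even internal degree the signs alternate and the count is the parity of the second exponent.
The boundary to tensor degree zero is twice this parity times `x^q`, so for a cycle it vanishes once
`2` is invertible. -/
theorem b_contr_even (h2 : IsUnit (2 : R)) {q : ℕ} (hq : Even q) {c : T R (AddMonoidAlgebra R ℕ) 1}
    (hc : c ∈ intDeg (gr R) 1 (q : ℤ)) (h0 : b (gr R) 0 c = 0) : b (gr R) 1 (contr R 0 c) = c := by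
  set par : T R (AddMonoidAlgebra R ℕ) 1 →ₗ[R] R := lin 1 (fun w => if Odd (w 1) then 1 else 0)
  have hpar : ∀ w, par (X R 1 w) = if Odd (w 1) then 1 else 0 := fun w =>
    lin_X (fun w w' h => by rw [h 1 le_rfl]) w
  have hsgn : ∀ l, (-1 : ℤ) ^ (l * (q + 1)) = (-1) ^ l := fun l => by
    rw [mul_comm, pow_mul, (hq.add_one).neg_one_pow]
  have hsum : ∀ m, ∑ l ∈ Finset.range m, (-1 : ℤ) ^ l = if Odd m then 1 else 0 := fun m => by
    induction m with
    | zero => simp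
    | succ m ih =>
      rw [Finset.sum_range_succ, ih]
      rcases Nat.even_or_odd m with h | h
      · simp [h.neg_one_pow, Nat.not_odd_iff_even.2 h, h.add_one]
      · simp [h.neg_one_pow, h, Nat.not_odd_iff_even.2 h.add_one]
  have hcoef : (2 : R) * par c = 0 := by
    have h := eq_of_intDeg (f := coef R q ∘ₗ b (gr R) 0) (g := (2 : R) • par) (fun w hw => ?_) hc
    · simpa [h0] using h.symm
    · have hw' : deg 1 w = q := by exact_mod_cast hw
      change coef R q (b (gr R) 0 (X R 1 w)) = (2 : R) • par (X R 1 w)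
      rw [b_zero_X, hw', hsgn, map_sub, map_zsmul, coef_X, if_pos rfl, hpar]
      rcases Nat.even_or_odd (w 1) with h | h
      · simp [h.neg_one_pow, Nat.not_odd_iff_even.2 h]
      · simp only [h.neg_one_pow, h, if_true, smul_eq_mul, mul_one, neg_smul, one_smul]
        norm_num
  have hp0 : par c = 0 := (h2.mul_right_eq_zero).1 hcoef
  have h := eq_of_intDeg (f := b (gr R) 1 ∘ₗ contr R 0) (g := LinearMap.id -
    (LinearMap.toSpanSingleton R _ (X R 1 (pairIdx (q - 1) 1))) ∘ₗ par) (fun w hw => ?_) hc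
  · simpa [hp0] using h
  · have hw' : deg 1 w = q := by exact_mod_cast hw
    change b (gr R) 1 (contr R 0 (X R 1 w)) = X R 1 w - par (X R 1 w) • X R 1 (pairIdx (q - 1) 1)
    rw [b_contr_X, hw', hpar]
    simp only [hsgn, hsum]
    split_ifs <;> simp

end Contraction

end Hoch

/-! ### Comparison of mixed complexes -/

theorem exists_dependent_seq {α : ℕ → Type*} {Inv : ∀ j, α j → Prop}
    {Rel : ∀ j, α j → α (j + 1) → Prop} {a₀ : α 0} (h0 : Inv 0 a₀)
    (hs : ∀ j a, Inv j a → ∃ a', Inv (j + 1) a' ∧ Rel j a a') :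
    ∃ s : ∀ j, α j, s 0 = a₀ ∧ (∀ j, Inv j (s j)) ∧ ∀ j, Rel j (s j) (s (j + 1)) := by
  choose next h1 h2 using hs
  let s : ∀ j, {a : α j // Inv j a} := fun j =>
    Nat.rec ⟨a₀, h0⟩ (fun j a => ⟨next j a.1 a.2, h1 j a.1 a.2⟩) j
  exact ⟨fun j => (s j).1, rfl, fun j => (s j).2, fun j => h2 j (s j).1 (s j).2⟩

namespace Mixed

variable {R : Type u} [CommRing R] {M : Type v} [AddCommGroup M] [Module R M]
  {N : Type*} [AddCommGroup N] [Module R N]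

/-- The long exact sequence argument: a surjective chain map with acyclic kernel induces an
isomorphism on homology. Acyclicity enters once to correct a lift to a cycle and once to lift a
bounding chain. -/
theorem homology_equiv {M' : ℤ → Submodule R M} {N' : ℤ → Submodule R N}
    {D : (ℕ → M) →ₗ[R] (ℕ → M)} {E : (ℕ → N) →ₗ[R] (ℕ → N)} {k : ℤ} (π : M →ₗ[R] N)
    (hDM : ∀ i f, f ∈ tot M' k i → D f ∈ tot M' k (i - 1))
    (hDD : ∀ f, D (D f) = 0)
    (hπ : ∀ f, E (fun j => π (f j)) = fun j => π (D f j))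
    (hmem : ∀ m, ∀ c ∈ M' m, π c ∈ N' m)
    (hsurj : ∀ m, ∀ e ∈ N' m, ∃ c ∈ M' m, π c = e)
    (hacyc : ∀ i f, f ∈ tot M' k i → (∀ j, π (f j) = 0) → D f = 0 →
      ∃ y ∈ tot M' k (i + 1), (∀ j, π (y j) = 0) ∧ D y = f) (i : ℤ) :
    Nonempty (homology M' D k i ≃ₗ[R] homology N' E k i) := by
  set P : (ℕ → M) →ₗ[R] (ℕ → N) := LinearMap.pi fun j => π ∘ₗ LinearMap.proj j with hP
  have hPa : ∀ f, P f = fun j => π (f j) := fun f => rfl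
  have hPD : ∀ f, E (P f) = P (D f) := hπ
  have hPtot : ∀ i f, f ∈ tot M' k i → P f ∈ tot N' k i := fun i f hf j => hmem _ _ (hf j)
  have hlift : ∀ i e, e ∈ tot N' k i → ∃ f ∈ tot M' k i, P f = e := by
    intro i e he
    choose f hf using fun j => hsurj _ _ (he j)
    exact ⟨f, fun j => (hf j).1, funext fun j => (hf j).2⟩
  have hcyc : ∀ z ∈ cycles M' D k i, P z ∈ cycles N' E k i := by
    rintro z ⟨hz1, hz2⟩
    refine ⟨hPtot _ _ hz1, ?_⟩
    rw [SetLike.mem_coe, LinearMap.mem_ker] at hz2 ⊢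
    rw [hPD, hz2, map_zero]
  set φ : cycles M' D k i →ₗ[R] homology N' E k i :=
    Submodule.mkQ _ ∘ₗ P.restrict hcyc with hφ
  have hφs : Function.Surjective φ := by
    intro x
    obtain ⟨⟨z, hz⟩, rfl⟩ := Submodule.mkQ_surjective _ x
    obtain ⟨f, hf, hfz⟩ := hlift i z hz.1
    have hz2 : E z = 0 := hz.2
    -- The lift `f` need not be a cycle, but `D f` is a cycle in the kernel; subtracting a kernel
    -- chain bounding it repairs this.
    obtain ⟨y, hy, hy0, hyD⟩ := hacyc (i - 1) (D f) (hDM _ _ hf)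
      (fun j => by
        have : P (D f) = 0 := by rw [← hPD, hfz, hz2]
        exact congrFun this j) (hDD f)
    rw [sub_add_cancel] at hy
    have hcy : f - y ∈ cycles M' D k i := ⟨sub_mem hf hy, by
      rw [SetLike.mem_coe, LinearMap.mem_ker, map_sub, hyD, sub_self]⟩
    refine ⟨⟨f - y, hcy⟩, ?_⟩
    rw [hφ, LinearMap.comp_apply]
    congr 1
    refine Subtype.ext ?_
    show P (f - y) = z
    rw [map_sub, hfz, show P y = 0 from funext hy0, sub_zero]
  have hφk : LinearMap.ker φ = (boundaries M' D k i).comap (cycles M' D k i).subtype := by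
    ext ⟨z, hz⟩
    rw [LinearMap.mem_ker, hφ, LinearMap.comp_apply, Submodule.mkQ_apply,
      Submodule.Quotient.mk_eq_zero, Submodule.mem_comap, Submodule.mem_comap]
    show P z ∈ boundaries N' E k i ↔ z ∈ boundaries M' D k i
    constructor
    · rintro ⟨e, he, hez⟩
      obtain ⟨f, hf, hfe⟩ := hlift _ e he
      have hDf := hDM _ _ hf
      rw [add_sub_cancel_right] at hDf
      obtain ⟨y, hy, -, hyD⟩ := hacyc i (z - D f) (sub_mem hz.1 hDf)
        (fun j => by
          have : P (z - D f) = 0 := by rw [map_sub, ← hPD, hfe, hez, sub_self]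
          exact congrFun this j) (by
          have : D z = 0 := hz.2
          rw [map_sub, hDD, this, sub_zero])
      exact ⟨y + f, add_mem hy hf, by rw [map_add, hyD, sub_add_cancel]⟩
    · rintro ⟨y, hy, rfl⟩
      exact ⟨P y, hPtot _ _ hy, hPD y⟩
  exact ⟨(Submodule.quotEquivOfEq _ _ hφk.symm).trans (φ.quotKerEquivOfSurjective hφs)⟩

theorem negD_zero (d B : M →ₗ[R] M) (f : ℕ → M) : negD d B f 0 = d (f 0) := rfl

theorem negD_succ (d B : M →ₗ[R] M) (f : ℕ → M) (j : ℕ) :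
    negD d B f (j + 1) = d (f (j + 1)) + B (f j) := rfl

theorem cycD_apply (d B : M →ₗ[R] M) (f : ℕ → M) (j : ℕ) :
    cycD d B f j = d (f j) + B (f (j + 1)) := rfl

section Comparison

variable {M' : ℤ → Submodule R M} {N' : ℤ → Submodule R N} {d B : M →ₗ[R] M} {e C : N →ₗ[R] N}

/-- Acyclicity of the kernel for `d` alone suffices: the equations `d y_(j+1) = f_(j+1) - B y_j` are
solved one after the other, and no convergence is needed because the total complex is a product. -/
theorem negD_homology_equiv (π : M →ₗ[R] N)
    (hdd : ∀ c, d (d c) = 0) (hBB : ∀ c, B (B c) = 0) (hdB : ∀ c, d (B c) + B (d c) = 0)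
    (hd : ∀ m, ∀ c ∈ M' m, d c ∈ M' (m - 1)) (hB : ∀ m, ∀ c ∈ M' m, B c ∈ M' (m + 1))
    (hπd : ∀ c, π (d c) = e (π c)) (hπB : ∀ c, π (B c) = C (π c))
    (hmem : ∀ m, ∀ c ∈ M' m, π c ∈ N' m)
    (hsurj : ∀ m, ∀ x ∈ N' m, ∃ c ∈ M' m, π c = x)
    (hacyc : ∀ m, ∀ c ∈ M' m, π c = 0 → d c = 0 → ∃ y ∈ M' (m + 1), π y = 0 ∧ d y = c) (i : ℤ) :
    Nonempty (homology M' (negD d B) 2 i ≃ₗ[R] homology N' (negD e C) 2 i) := by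
  refine homology_equiv π ?_ ?_ ?_ hmem hsurj ?_ i
  · intro i f hf j
    rcases j with _ | j
    · have := hd _ _ (hf 0)
      rw [negD_zero]
      convert this using 2
      push_cast; ring
    · have h1 := hd _ _ (hf (j + 1))
      have h2 := hB _ _ (hf j)
      have e1 : i - 1 + 2 * ((j + 1 : ℕ) : ℤ) = i + 2 * ((j + 1 : ℕ) : ℤ) - 1 := by ring
      have e2 : i + 2 * ((j + 1 : ℕ) : ℤ) - 1 = i + 2 * (j : ℤ) + 1 := by push_cast; ring
      rw [negD_succ, e1]
      refine add_mem h1 ?_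
      rw [e2]; exact h2
  · intro f
    funext j
    rcases j with _ | _ | j
    · simp only [negD_zero, hdd, Pi.zero_apply]
    · simp only [negD_zero, negD_succ, map_add, hdd, Pi.zero_apply, zero_add, hdB]
    · simp only [negD_succ, map_add, hdd, Pi.zero_apply, zero_add, hBB, add_zero, hdB]
  · intro f
    funext j
    rcases j with _ | j
    · simp only [negD_zero, hπd]
    · simp only [negD_succ, map_add, hπd, hπB]
  · intro i f hf hπf hDf
    have hf0 : d (f 0) = 0 := congrFun hDf 0
    have hfs : ∀ j, d (f (j + 1)) + B (f j) = 0 := fun j => congrFun hDf (j + 1)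
    have e0 : i + 2 * ((0 : ℕ) : ℤ) = i := by simp
    have e0' : i + 1 + 2 * ((0 : ℕ) : ℤ) = i + 1 := by simp
    obtain ⟨y₀, hy₀, hπy₀, hdy₀⟩ := hacyc i (f 0) (by simpa [e0] using hf 0) (hπf 0) hf0
    obtain ⟨y, hy0, hy1, hy2⟩ := exists_dependent_seq (α := fun _ => M)
      -- The condition `B (d y_j) = B f_j` is exactly what makes the next right-hand side a
      -- `d`-cycle; it persists since `B` kills `B y_j`.
      (Inv := fun j y => y ∈ M' (i + 1 + 2 * (j : ℤ)) ∧ π y = 0 ∧ B (d y) = B (f j))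
      (Rel := fun j y y' => d y' = f (j + 1) - B y) (a₀ := y₀)
      ⟨by rw [e0']; exact hy₀, hπy₀, by rw [hdy₀]⟩ (by
        rintro j y ⟨h1, h2, h3⟩
        have ha := hB _ _ h1
        have hb := hf (j + 1)
        have e1 : i + 2 * ((j + 1 : ℕ) : ℤ) = i + 1 + 2 * (j : ℤ) + 1 := by push_cast; ring
        have e2 : i + 1 + 2 * (j : ℤ) + 1 + 1 = i + 1 + 2 * ((j + 1 : ℕ) : ℤ) := by push_cast; ring
        rw [e1] at hb
        obtain ⟨y', h4, h5, h6⟩ := hacyc _ (f (j + 1) - B y) (sub_mem hb ha)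
          (by rw [map_sub, hπf, hπB, h2, map_zero, sub_zero])
          (by rw [map_sub, eq_neg_of_add_eq_zero_left (hfs j), eq_neg_of_add_eq_zero_left (hdB y), h3,
            sub_self])
        exact ⟨y', ⟨e2 ▸ h4, h5, by rw [h6, map_sub, hBB, sub_zero]⟩, h6⟩)
    refine ⟨y, fun j => (hy1 j).1, fun j => (hy1 j).2.1, ?_⟩
    funext j
    rcases j with _ | j
    · rw [negD_zero, hy0, hdy₀]
    · rw [negD_succ, hy2, sub_add_cancel]

/-- Here the equation at `j` involves `y_(j+1)`, so one solves downwards, starting at an index `J`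
beyond which all components sit in negative degree and vanish. -/
theorem cycD_homology_equiv (π : M →ₗ[R] N)
    (hdd : ∀ c, d (d c) = 0) (hBB : ∀ c, B (B c) = 0) (hdB : ∀ c, d (B c) + B (d c) = 0)
    (hd : ∀ m, ∀ c ∈ M' m, d c ∈ M' (m - 1)) (hB : ∀ m, ∀ c ∈ M' m, B c ∈ M' (m + 1))
    (hπd : ∀ c, π (d c) = e (π c)) (hπB : ∀ c, π (B c) = C (π c))
    (hmem : ∀ m, ∀ c ∈ M' m, π c ∈ N' m)
    (hsurj : ∀ m, ∀ x ∈ N' m, ∃ c ∈ M' m, π c = x)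
    (hneg : ∀ m < 0, ∀ c ∈ M' m, c = 0)
    (hacyc : ∀ m, ∀ c ∈ M' m, π c = 0 → d c = 0 → ∃ y ∈ M' (m + 1), π y = 0 ∧ d y = c) (i : ℤ) :
    Nonempty (homology M' (cycD d B) (-2) i ≃ₗ[R] homology N' (cycD e C) (-2) i) := by
  refine homology_equiv π ?_ ?_ ?_ hmem hsurj ?_ i
  · intro i f hf j
    have h1 := hd _ _ (hf j)
    have h2 := hB _ _ (hf (j + 1))
    have e1 : i - 1 + -2 * (j : ℤ) = i + -2 * (j : ℤ) - 1 := by ring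
    have e2 : i + -2 * (j : ℤ) - 1 = i + -2 * ((j + 1 : ℕ) : ℤ) + 1 := by push_cast; ring
    rw [cycD_apply, e1]
    refine add_mem h1 ?_
    rw [e2]; exact h2
  · intro f
    funext j
    simp only [cycD_apply, map_add, hdd, Pi.zero_apply, zero_add, hBB, add_zero, hdB]
  · intro f
    funext j
    simp only [cycD_apply, map_add, hπd, hπB]
  · intro i f hf hπf hDf
    have hfs : ∀ j, d (f j) + B (f (j + 1)) = 0 := fun j => congrFun hDf j
    obtain ⟨J, hJ⟩ : ∃ J : ℕ, i + -2 * (J : ℤ) < 0 := ⟨i.toNat + 1, by omega⟩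
    have hf0 : ∀ j, J ≤ j → f j = 0 := fun j hj => hneg _ (by omega) _ (hf j)
    -- The recursion index counts down from `J`: `s k` is the component at `J - k`.
    obtain ⟨s, hs0, hs1, hs2⟩ := exists_dependent_seq (α := fun _ => M)
      (Inv := fun k y => k ≤ J → y ∈ M' (i + 1 + -2 * ((J - k : ℕ) : ℤ)) ∧ π y = 0 ∧
        B (d y) = B (f (J - k)))
      (Rel := fun k y y' => k + 1 ≤ J → d y' = f (J - (k + 1)) - B y) (a₀ := 0)
      (fun _ => ⟨zero_mem _, map_zero _, by rw [Nat.sub_zero, hf0 J le_rfl, map_zero]⟩) (by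
        intro k y h
        by_cases hk : k + 1 ≤ J
        swap
        · exact ⟨0, fun h' => absurd h' hk, fun h' => absurd h' hk⟩
        obtain ⟨h1, h2, h3⟩ := h (by omega)
        have ha := hB _ _ h1
        have hb := hf (J - (k + 1))
        have e0 : J - k = J - (k + 1) + 1 := by omega
        have e1 : i + 1 + -2 * ((J - k : ℕ) : ℤ) + 1 = i + -2 * ((J - (k + 1) : ℕ) : ℤ) := by
          rw [e0]; push_cast; ring
        have e2 : i + -2 * ((J - (k + 1) : ℕ) : ℤ) + 1 = i + 1 + -2 * ((J - (k + 1) : ℕ) : ℤ) := by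
          ring
        rw [e1] at ha
        have h7 := hfs (J - (k + 1))
        rw [← e0] at h7
        obtain ⟨y', h4, h5, h6⟩ := hacyc _ (f (J - (k + 1)) - B y) (sub_mem hb ha)
          (by rw [map_sub, hπf, hπB, h2, map_zero, sub_zero])
          (by rw [map_sub, eq_neg_of_add_eq_zero_left h7, eq_neg_of_add_eq_zero_left (hdB y), h3,
            sub_self])
        exact ⟨y', fun _ => ⟨e2 ▸ h4, h5, by rw [h6, map_sub, hBB, sub_zero]⟩, fun _ => h6⟩)
    refine ⟨fun j => if j ≤ J then s (J - j) else 0, fun j => ?_, fun j => ?_, ?_⟩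
    · show (if j ≤ J then s (J - j) else 0) ∈ _
      split_ifs with h
      · have := (hs1 (J - j) (by omega)).1
        rwa [Nat.sub_sub_self h] at this
      · exact zero_mem _
    · show π (if j ≤ J then s (J - j) else 0) = 0
      split_ifs with h
      · exact (hs1 (J - j) (by omega)).2.1
      · exact map_zero _
    · funext j
      rw [cycD_apply]
      rcases lt_trichotomy j J with h | h | h
      · have := hs2 (J - (j + 1)) (by omega)
        rw [if_pos h.le, if_pos (by omega), show J - j = J - (j + 1) + 1 by omega, this,
          sub_add_cancel]
        congr 1; omega
      · subst h
        rw [if_pos le_rfl, if_neg (by omega), Nat.sub_self, hs0, map_zero, map_zero, add_zero,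
          hf0 j le_rfl]
      · rw [if_neg (by omega), if_neg (by omega), map_zero, map_zero, add_zero, hf0 j h.le]

end Comparison

end Mixed

/-! ### A small model of the mixed complex of `R//p` -/

namespace Small

open Hoch

variable (R : Type u) [CommRing R] (p : ℕ)

/-- The differential of the small mixed complex. -/
def dE : (ℕ → R) →ₗ[R] (ℕ → R) :=
  LinearMap.pi fun n => if n = 0 then (p : R) • LinearMap.proj 1 else
    if Even n then (p : R) ^ 2 • LinearMap.proj (n + 1) else 0

/-- Connes' operator of the small mixed complex. -/
def BE : (ℕ → R) →ₗ[R] (ℕ → R) :=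
  LinearMap.pi fun n => if Even n then (2 * ((n - 1 : ℕ) : R)) • LinearMap.proj (n - 1) else 0

/-- The grading of the small mixed complex. -/
def grE (m : ℤ) : Submodule R (ℕ → R) where
  carrier := {f | ∀ n : ℕ, (n : ℤ) ≠ m → f n = 0}
  add_mem' := fun hf hg n hn => by rw [Pi.add_apply, hf n hn, hg n hn, add_zero]
  zero_mem' := fun _ _ => rfl
  smul_mem' := fun r f hf n hn => by rw [Pi.smul_apply, hf n hn, smul_zero]

/-- The functional `x^a ⊗ x^c ↦ c` on the one-chains with `a + c + 1 = n`. -/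
def mu (n : ℕ) : T R (AddMonoidAlgebra R ℕ) 1 →ₗ[R] R :=
  lin 1 (fun w => if deg 1 w + 1 = n then (w 1 : R) else 0)

/-- The comparison map from the Hochschild chains to the small mixed complex. -/
def proj : (∀ n, T R (AddMonoidAlgebra R ℕ) n) →ₗ[R] (ℕ → R) :=
  LinearMap.pi fun n => if Even n ∧ n ≠ 0 then
    (p : R) • (coef R n ∘ₗ LinearMap.proj 0) + (2 : R) • (mu R n ∘ₗ LinearMap.proj 1)
    else coef R n ∘ₗ LinearMap.proj 0

variable {R p}

theorem dE_zero (f : ℕ → R) : dE R p f 0 = p * f 1 := rfl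

theorem dE_even {n : ℕ} (hn : Even n) (h0 : n ≠ 0) (f : ℕ → R) :
    dE R p f n = p ^ 2 * f (n + 1) := by
  simp [dE, hn, h0]

theorem dE_odd {n : ℕ} (hn : Odd n) (f : ℕ → R) : dE R p f n = 0 := by
  simp [dE, Nat.not_even_iff_odd.2 hn, hn.pos.ne']

theorem BE_even {n : ℕ} (hn : Even n) (f : ℕ → R) :
    BE R f n = 2 * ((n - 1 : ℕ) : R) * f (n - 1) := by
  simp [BE, hn]

theorem BE_odd {n : ℕ} (hn : Odd n) (f : ℕ → R) : BE R f n = 0 := by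
  simp [BE, Nat.not_even_iff_odd.2 hn]

theorem proj_even {n : ℕ} (hn : Even n) (h0 : n ≠ 0) (c : ∀ n, T R (AddMonoidAlgebra R ℕ) n) :
    proj R p c n = p * coef R n (c 0) + 2 * mu R n (c 1) := by
  simp [proj, hn, h0]

theorem proj_odd {n : ℕ} (hn : Odd n) (c : ∀ n, T R (AddMonoidAlgebra R ℕ) n) :
    proj R p c n = coef R n (c 0) := by
  simp [proj, Nat.not_even_iff_odd.2 hn]

theorem proj_zero (c : ∀ n, T R (AddMonoidAlgebra R ℕ) n) : proj R p c 0 = coef R 0 (c 0) := by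
  simp [proj]

/-! ### Compatibility of `proj` with the differentials and with Connes' operator -/

theorem mu_X (n : ℕ) (w : ℕ → ℕ) :
    mu R n (X R 1 w) = if deg 1 w + 1 = n then (w 1 : R) else 0 :=
  lin_X (fun w w' h => by rw [h 1 le_rfl, deg_congr h]) w

theorem coef_eq_zero {n : ℕ} {q : ℤ} (h : q ≠ n) {c : T R (AddMonoidAlgebra R ℕ) 0}
    (hc : c ∈ intDeg (gr R) 0 q) : coef R n c = 0 := by
  refine eq_of_intDeg (f := coef R n) (g := 0) (fun w hw => ?_) hc
  have hd : deg 0 w = w 0 := by simp [deg]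
  rw [coef_X, if_neg]
  · rfl
  · intro h'
    exact h (by rw [← hw, hd, h'])

theorem mu_eq_zero {n : ℕ} {q : ℤ} (h : q + 1 ≠ n) {c : T R (AddMonoidAlgebra R ℕ) 1}
    (hc : c ∈ intDeg (gr R) 1 q) : mu R n c = 0 := by
  refine eq_of_intDeg (f := mu R n) (g := 0) (fun w hw => ?_) hc
  change mu R n (X R 1 w) = 0
  rw [mu_X, if_neg]
  intro h'
  exact h (by rw [← hw, ← h']; push_cast; rfl)

theorem mu_eq_snd {n : ℕ} {q : ℤ} (h : q + 1 = n) {c : T R (AddMonoidAlgebra R ℕ) 1}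
    (hc : c ∈ intDeg (gr R) 1 q) : mu R n c = snd R c := by
  refine eq_of_intDeg (f := mu R n) (g := snd R) (fun w hw => ?_) hc
  change mu R n (X R 1 w) = snd R (X R 1 w)
  rw [mu_X, snd_X, if_pos]
  have hw' : (deg 1 w : ℤ) = q := hw
  omega

theorem coef_int {n : ℕ} (hn : Even n) (c : T R (AddMonoidAlgebra R ℕ) 0) :
    coef R n (int (killP R p) 0 c) = p * coef R (n + 1) c := by
  suffices h : coef R n ∘ₗ int (killP R p) 0 = (p : R) • coef R (n + 1) from LinearMap.congr_fun h c
  refine hom_ext fun w => ?_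
  simp only [LinearMap.comp_apply, LinearMap.smul_apply, smul_eq_mul, int_X]
  rw [Finset.sum_range_one, coef_X, intTerm]
  by_cases ho : Odd (w 0)
  · have := ho.pos
    rw [if_pos ho, Finset.range_zero, Finset.sum_empty, pow_zero, one_smul, map_smul, coef_X,
      smul_eq_mul, dec, if_pos rfl]
    congr 1
    split_ifs <;> first | rfl | omega
  · rw [if_neg ho, map_zero, if_neg, mul_zero]
    intro h
    exact ho (h ▸ hn.add_one)

theorem coef_int_odd {n : ℕ} (hn : Odd n) (c : T R (AddMonoidAlgebra R ℕ) 0) :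
    coef R n (int (killP R p) 0 c) = 0 := by
  suffices h : coef R n ∘ₗ int (killP R p) 0 = 0 from LinearMap.congr_fun h c
  refine hom_ext fun w => ?_
  simp only [LinearMap.comp_apply, LinearMap.zero_apply, int_X]
  rw [Finset.sum_range_one, intTerm]
  by_cases ho : Odd (w 0)
  · rw [if_pos ho, map_zsmul, map_smul, coef_X, if_neg, smul_zero, smul_zero]
    rw [dec, if_pos rfl]
    obtain ⟨a, ha⟩ := ho
    obtain ⟨b, hb⟩ := hn
    omega
  · rw [if_neg ho, map_zero]

theorem int_one_X (w : ℕ → ℕ) : int (killP R p) 1 (X R 1 w) =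
    (if Odd (w 0) then (p : R) • X R 1 (dec 0 w) else 0) +
    (if Odd (w 1) then (-1 : ℤ) ^ (w 0) • (p : R) • X R 1 (dec 1 w) else 0) := by
  rw [int_X, Finset.sum_range_succ, Finset.sum_range_one, intTerm, intTerm, Finset.range_zero,
    Finset.sum_empty, pow_zero, one_smul, Finset.sum_range_one]

/-- Commutators have no `x^n` component here: for odd `n` the graded commutator of two powers
vanishes, and `x^0` only arises from `1 ⊗ 1`. -/
theorem coef_b {n : ℕ} (hn : Odd n ∨ n = 0) (c : T R (AddMonoidAlgebra R ℕ) 1) :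
    coef R n (b (gr R) 0 c) = 0 := by
  suffices h : coef R n ∘ₗ b (gr R) 0 = 0 from LinearMap.congr_fun h c
  refine hom_ext fun w => ?_
  change coef R n (b (gr R) 0 (X R 1 w)) = 0
  have hd : deg 1 w = w 0 + w 1 := by simp [deg, Finset.sum_range_succ]
  rw [b_zero_X, map_sub, map_zsmul, coef_X]
  split_ifs with h
  · have : Even (w 1 * (deg 1 w + 1)) := by
      rcases hn with hn | hn
      · rw [h]; exact (hn.add_one).mul_left _
      · rw [show w 1 = 0 by omega]; simp
    rw [this.neg_one_pow, one_smul, sub_self]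
  · simp

/-- Both sides are nonzero only on `x^a ⊗ x^c` with `a` and `c` odd, where the commutator is `2 x^n`
and the internal differential lowers one exponent at a time. This relation dictates the weights `p`
and `2` in `proj`, and with them the coefficient `p²` in the small model. -/
theorem coef_b_even {n : ℕ} (hn : Even n) (c : T R (AddMonoidAlgebra R ℕ) 1) :
    p * coef R n (b (gr R) 0 c) = 2 * mu R n (int (killP R p) 1 c) := by
  suffices h : (p : R) • (coef R n ∘ₗ b (gr R) 0) = (2 : R) • (mu R n ∘ₗ int (killP R p) 1) from
    LinearMap.congr_fun h c
  refine hom_ext fun w => ?_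
  change p * coef R n (b (gr R) 0 (X R 1 w)) = 2 * mu R n (int (killP R p) 1 (X R 1 w))
  have hd : deg 1 w = w 0 + w 1 := by simp [deg, Finset.sum_range_succ]
  have hd0 : Odd (w 0) → deg 1 (dec 0 w) + 1 = deg 1 w := fun h => deg_dec (by omega) h.pos.ne'
  have hd1 : Odd (w 1) → deg 1 (dec 1 w) + 1 = deg 1 w := fun h => deg_dec (by omega) h.pos.ne'
  have h01 : dec 0 w 1 = w 1 := by simp [dec]
  have h11 : dec 1 w 1 = w 1 - 1 := by simp [dec]
  rw [b_zero_X, map_sub, map_zsmul, coef_X, int_one_X, map_add]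
  by_cases h : deg 1 w = n
  · rcases Nat.even_or_odd (w 1) with h1 | h1
    · have h0 : ¬ Odd (w 0) := by
        intro h0
        rw [← h, hd] at hn
        exact Nat.not_even_iff_odd.2 (h0.add_even h1) hn
      rw [if_pos h, (h1.mul_right _).neg_one_pow, one_smul, sub_self, mul_zero, if_neg h0,
        if_neg (Nat.not_odd_iff_even.2 h1)]
      simp
    · have h0 : Odd (w 0) := by
        by_contra h0
        rw [← h, hd] at hn
        exact Nat.not_even_iff_odd.2 ((Nat.not_odd_iff_even.1 h0).add_odd h1) hn
      have h3 : Odd (w 1 * (deg 1 w + 1)) := by rw [h]; exact h1.mul hn.add_one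
      rw [if_pos h, h3.neg_one_pow, if_pos h0, if_pos h1, h0.neg_one_pow, map_smul, map_zsmul,
        map_smul, mu_X, mu_X, hd0 h0, hd1 h1, if_pos h, if_pos h, h01, h11, Nat.cast_sub h1.pos]
      simp only [neg_smul, one_smul, smul_eq_mul, Nat.cast_one]
      ring
  · rw [if_neg h, smul_zero, sub_self, mul_zero]
    split_ifs with h0 h1 h1
    · rw [map_smul, map_zsmul, map_smul, mu_X, mu_X, hd0 h0, hd1 h1, if_neg h]; simp [h]
    · rw [map_smul, mu_X, hd0 h0, if_neg h]; simp
    · rw [map_zsmul, map_smul, mu_X, hd1 h1, if_neg h]; simp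
    · simp

/-- The relevant internal degree `n - 1` is odd, so there are no Koszul signs and the three faces
contribute `w 2 - (w 1 + w 2) + w 1 = 0`. -/
theorem mu_b {n : ℕ} (hn : Even n) (c : T R (AddMonoidAlgebra R ℕ) 2) :
    mu R n (b (gr R) 1 c) = 0 := by
  suffices h : mu R n ∘ₗ b (gr R) 1 = 0 from LinearMap.congr_fun h c
  refine hom_ext fun w => ?_
  change mu R n (b (gr R) 1 (X R 2 w)) = 0
  rw [b_apply, bP_apply, Finset.sum_range_succ, Finset.sum_range_one, t_apply, sfc_apply, sfc_apply,
    rot_X]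
  simp only [pow_zero, one_smul, pow_one, neg_smul, map_neg, map_zsmul, map_add, fc_X,
    show (1 + 1 : ℕ) = 2 from rfl, even_two.neg_one_pow, mu_X]
  rw [deg_mrg (Nat.zero_le 1), deg_mrg le_rfl, deg_mrg (Nat.zero_le 1), deg_rotIdx]
  simp only [show (1 + 1 : ℕ) = 2 from rfl]
  split_ifs with h
  · rw [h, (hn.mul_left _).neg_one_pow, one_smul]
    simp [mrg, rotIdx]
  · simp

theorem proj_totd (c : ∀ n, T R (AddMonoidAlgebra R ℕ) n) :
    proj R p (totd (killP R p) c) = dE R p (proj R p c) := by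
  have h0 : totd (killP R p) c 0 = b (gr R) 0 (c 1) + int (killP R p) 0 (c 0) := by
    rw [totd_apply, pow_zero, one_smul]
  have h1 : totd (killP R p) c 1 = b (gr R) 1 (c 2) - int (killP R p) 1 (c 1) := by
    rw [totd_apply, pow_one, neg_smul, one_smul, sub_eq_add_neg]
  funext n
  rcases Nat.even_or_odd n with hn | hn
  · rcases eq_or_ne n 0 with rfl | hn0
    · rw [proj_zero, dE_zero, proj_odd odd_one, h0, map_add, coef_b (Or.inr rfl),
        coef_int Even.zero, zero_add]
      rfl
    · rw [proj_even hn hn0, dE_even hn hn0, proj_odd hn.add_one, h0, h1, map_add, map_sub, mul_add,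
        coef_b_even hn, coef_int hn, mu_b hn]
      ring
  · rw [proj_odd hn, dE_odd hn, h0, map_add, coef_b (Or.inl hn), coef_int_odd hn, add_zero]

theorem mu_B {n : ℕ} (h0 : n ≠ 0) (c : T R (AddMonoidAlgebra R ℕ) 0) :
    mu R n (B (gr R) 0 c) = ((n - 1 : ℕ) : R) * coef R (n - 1) c := by
  suffices h : mu R n ∘ₗ B (gr R) 0 = ((n - 1 : ℕ) : R) • coef R (n - 1) from
    LinearMap.congr_fun h c
  refine hom_ext fun w => ?_
  change mu R n (B (gr R) 0 (X R 0 w)) = ((n - 1 : ℕ) : R) * coef R (n - 1) (X R 0 w)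
  have hd : deg 1 (shiftIdx w) = w 0 := by rw [deg_shiftIdx]; simp [deg]
  have hs1 : shiftIdx w 1 = w 0 := by simp [shiftIdx]
  have hr1 : rotIdx 1 (shiftIdx w) 1 = 0 := by simp [shiftIdx, rotIdx]
  rw [B_apply, N_apply, Finset.sum_range_one, pow_zero, Module.End.one_apply, s_X, t_apply, rot_X,
    map_sub, map_zsmul, map_zsmul, mu_X, mu_X, deg_rotIdx, hd, hs1, hr1, coef_X]
  simp only [Nat.cast_zero, ite_self, smul_zero, sub_zero, mul_ite, mul_one, mul_zero]
  split_ifs with h1 h2 h2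
  · rw [h2]
  · omega
  · omega
  · rfl

theorem proj_totB (c : ∀ n, T R (AddMonoidAlgebra R ℕ) n) :
    proj R p (totB (gr R) c) = BE R (proj R p c) := by
  funext n
  rcases Nat.even_or_odd n with hn | hn
  · rcases eq_or_ne n 0 with rfl | hn0
    · rw [proj_zero, BE_even Even.zero, totB_zero, map_zero]; simp
    · have : Odd (n - 1) := by
        obtain ⟨k, hk⟩ := hn
        exact ⟨k - 1, by omega⟩
      rw [proj_even hn hn0, BE_even hn, proj_odd this, totB_zero, totB_succ, mu_B hn0, map_zero]
      ring
  · rw [proj_odd hn, BE_odd hn, totB_zero, map_zero]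

theorem proj_mem {m : ℤ} {c : ∀ n, T R (AddMonoidAlgebra R ℕ) n} (hc : c ∈ totDeg (gr R) m) :
    proj R p c ∈ grE R m := by
  intro n hn
  have h0 := hc 0
  have h1 := hc 1
  have e0 : coef R n (c 0) = 0 := coef_eq_zero (by push_cast; omega) h0
  rcases Nat.even_or_odd n with hn | hn
  · rcases eq_or_ne n 0 with rfl | hn0
    · rw [proj_zero, e0]
    · rw [proj_even hn hn0, e0, mu_eq_zero (by push_cast; omega) h1]; simp
  · rw [proj_odd hn, e0]

/-! ### Surjectivity of `proj` and acyclicity of its kernel -/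

theorem single_mem_totDeg {k : ℕ} {x : T R (AddMonoidAlgebra R ℕ) k} {m : ℤ}
    (hx : x ∈ intDeg (gr R) k (m - k)) : Pi.single k x ∈ totDeg (gr R) m := by
  intro n
  rcases eq_or_ne n k with rfl | h
  · rwa [Pi.single_eq_same]
  · rw [Pi.single_eq_of_ne h]; exact zero_mem _

theorem proj_surj (h2 : IsUnit (2 : R)) {m : ℤ} {e : ℕ → R} (he : e ∈ grE R m) :
    ∃ c ∈ totDeg (gr R) m, proj R p c = e := by
  rcases lt_or_ge m 0 with hm | hm
  · refine ⟨0, zero_mem _, ?_⟩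
    rw [map_zero]
    funext n
    rw [he n (by omega), Pi.zero_apply]
  lift m to ℕ using hm
  suffices h : ∃ c ∈ totDeg (gr R) (m : ℤ), proj R p c m = e m by
    obtain ⟨c, hc, hcm⟩ := h
    refine ⟨c, hc, funext fun n => ?_⟩
    rcases eq_or_ne n m with rfl | hn
    · exact hcm
    · rw [proj_mem hc n (by exact_mod_cast hn), he n (by exact_mod_cast hn)]
  have hX : X R 0 (fun _ => m) ∈ intDeg (gr R) 0 ((m : ℤ) - (0 : ℕ)) :=
    X_mem_intDeg _ _ (by simp [deg])
  have hc0 : Pi.single 0 (e m • X R 0 (fun _ => m)) ∈ totDeg (gr R) (m : ℤ) :=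
    single_mem_totDeg (Submodule.smul_mem _ _ hX)
  rcases Nat.even_or_odd m with hn | hn
  · rcases eq_or_ne m 0 with rfl | hn0
    · refine ⟨_, hc0, ?_⟩
      rw [proj_zero, Pi.single_eq_same, map_smul, coef_X, if_pos rfl, smul_eq_mul, mul_one]
    · obtain ⟨u, hu⟩ := h2.exists_right_inv
      have hX1 : X R 1 (pairIdx (m - 2) 1) ∈ intDeg (gr R) 1 ((m : ℤ) - (1 : ℕ)) :=
        X_mem_intDeg _ _ (by
          obtain ⟨k, hk⟩ := hn
          simp [deg, Finset.sum_range_succ, pairIdx]; omega)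
      -- In positive even degree the preimage is half of `x^(m-2) ⊗ x`, on which `proj` has value `2
      -- · (1/2)`.
      refine ⟨Pi.single 1 ((e m * u) • X R 1 (pairIdx (m - 2) 1)),
        single_mem_totDeg (Submodule.smul_mem _ _ hX1), ?_⟩
      rw [proj_even hn hn0, Pi.single_eq_same, Pi.single_eq_of_ne (by decide), map_zero, map_smul,
        mu_eq_snd (by push_cast; ring) hX1, snd_X]
      simp only [pairIdx, smul_eq_mul]
      push_cast
      linear_combination (e m) * hu
  · refine ⟨_, hc0, ?_⟩
    rw [proj_odd hn, Pi.single_eq_same, map_smul, coef_X, if_pos rfl, smul_eq_mul, mul_one]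

/-- Once the components in tensor degrees 0 and 1 are settled, the higher ones are produced
successively by `contr`: the next right-hand side is a `b`-cycle in tensor degree at least two,
where the contraction has no obstruction. -/
theorem exists_totd_eq (h2 : IsUnit (2 : R)) {m : ℤ} {c : ∀ n, T R (AddMonoidAlgebra R ℕ) n}
    (hc : c ∈ totDeg (gr R) m) (hd : totd (killP R p) c = 0) {y₁ : T R (AddMonoidAlgebra R ℕ) 1}
    (hy₁ : y₁ ∈ intDeg (gr R) 1 m) (hb : b (gr R) 0 y₁ = c 0)
    (hcontr : b (gr R) 1 (contr R 0 (c 1 + int (killP R p) 1 y₁)) =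
      c 1 + int (killP R p) 1 y₁) :
    ∃ y ∈ totDeg (gr R) (m + 1), y 0 = 0 ∧ y 1 = y₁ ∧ totd (killP R p) y = c := by
  have hdn : ∀ n, b (gr R) n (c (n + 1)) + (-1 : ℤ) ^ n • int (killP R p) n (c n) = 0 :=
    fun n => congrFun hd n
  have hii : ∀ n x, int (killP R p) n (int (killP R p) n x) = 0 := fun n x =>
    LinearMap.congr_fun (int_comp_int h2 p n) x
  obtain ⟨s, hs0, hs1, hs2⟩ := exists_dependent_seq
    (α := fun n => T R (AddMonoidAlgebra R ℕ) (n + 1))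
    (Inv := fun n y => y ∈ intDeg (gr R) (n + 1) (m - n) ∧
      b (gr R) (n + 1) (contr R n (c (n + 1) - (-1 : ℤ) ^ (n + 1) • int (killP R p) (n + 1) y)) =
        c (n + 1) - (-1 : ℤ) ^ (n + 1) • int (killP R p) (n + 1) y)
    (Rel := fun n y y' => b (gr R) (n + 1) y' =
      c (n + 1) - (-1 : ℤ) ^ (n + 1) • int (killP R p) (n + 1) y)
    (a₀ := y₁) ⟨by simpa using hy₁, by simpa using hcontr⟩ (by
      rintro n y ⟨hy, h⟩
      refine ⟨contr R n (c (n + 1) - (-1 : ℤ) ^ (n + 1) • int (killP R p) (n + 1) y), ⟨?_, ?_⟩, h⟩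
      · refine contr_mem_intDeg (sub_mem ?_ (zsmul_mem ?_ _))
        · exact hc (n + 1)
        · have := int_mem_intDeg (p := p) hy
          have e : m - ((n + 1 : ℕ) : ℤ) = m - n - 1 := by push_cast; ring
          rw [e]; exact this
      · set y' := contr R n (c (n + 1) - (-1 : ℤ) ^ (n + 1) • int (killP R p) (n + 1) y)
        have hcl : b (gr R) (n + 1) (c (n + 2) -
            (-1 : ℤ) ^ (n + 2) • int (killP R p) (n + 2) y') = 0 := by
          have hn := hdn (n + 1)
          rw [map_sub, map_zsmul, ← int_b, h, map_sub, map_zsmul, hii, zsmul_zero, sub_zero,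
            eq_neg_of_add_eq_zero_left hn, pow_succ _ (n + 1), mul_neg_one, neg_smul, sub_neg_eq_add,
            neg_add_cancel]
        have hH := contr_homotopy n (c (n + 2) - (-1 : ℤ) ^ (n + 2) • int (killP R p) (n + 2) y')
        rw [hcl, map_zero, add_zero] at hH
        exact hH)
  refine ⟨fun n => match n with
    | 0 => 0
    | n + 1 => s n, ?_, rfl, hs0, ?_⟩
  · rintro (_ | n)
    · exact zero_mem _
    · have e : m + 1 - ((n + 1 : ℕ) : ℤ) = m - n := by push_cast; ring
      rw [e]
      exact (hs1 n).1
  · funext n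
    rw [totd_apply]
    rcases n with _ | n
    · change b (gr R) 0 (s 0) + (-1 : ℤ) ^ 0 • int (killP R p) 0 0 = c 0
      rw [hs0, hb, map_zero, zsmul_zero, add_zero]
    · change b (gr R) (n + 1) (s (n + 1)) + (-1 : ℤ) ^ (n + 1) • int (killP R p) (n + 1) (s n) = _
      rw [hs2 n, sub_add_cancel]

theorem proj_acyclic (h2 : IsUnit (2 : R)) {m : ℤ} {c : ∀ n, T R (AddMonoidAlgebra R ℕ) n}
    (hc : c ∈ totDeg (gr R) m) (hπ : proj R p c = 0) (hd : totd (killP R p) c = 0) :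
    ∃ y ∈ totDeg (gr R) (m + 1), proj R p y = 0 ∧ totd (killP R p) y = c := by
  rcases lt_or_ge m 0 with hm | hm
  · exact ⟨0, zero_mem _, map_zero _, by rw [map_zero, totDeg_neg hm hc]⟩
  lift m to ℕ using hm
  have hc0 : c 0 ∈ intDeg (gr R) 0 (m : ℤ) := by simpa using hc 0
  have hc1 : c 1 ∈ intDeg (gr R) 1 ((m : ℤ) - 1) := by simpa using hc 1
  have hd0 : b (gr R) 0 (c 1) + int (killP R p) 0 (c 0) = 0 := by
    have := congrFun hd 0
    rw [totd_apply, pow_zero, one_smul] at this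
    exact this
  -- In total degree `m + 1` the map `proj` reads the one-chain only if `m + 1` is even.
  have finish : ∀ y ∈ totDeg (gr R) ((m : ℤ) + 1), y 0 = 0 → (Even m ∨ y 1 = 0) →
      proj R p y = 0 := by
    intro y hy hy0 hm
    funext n
    rcases Nat.even_or_odd n with hn | hn
    · rcases eq_or_ne n 0 with rfl | hn0
      · rw [proj_zero, hy0, map_zero, Pi.zero_apply]
      · rw [proj_even hn hn0, hy0, map_zero, mul_zero, zero_add, Pi.zero_apply]
        rcases hm with hm | hm
        · rw [mu_eq_zero (q := m) _ (by simpa using hy 1), mul_zero]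
          rintro h
          have h' : m + 1 = n := by exact_mod_cast h
          exact Nat.not_even_iff_odd.2 hm.add_one (h' ▸ hn)
        · rw [hm, map_zero, mul_zero]
    · rw [proj_odd hn, hy0, map_zero, Pi.zero_apply]
  have hzero : coef R m (c 0) = 0 → (b (gr R) 1 (contr R 0 (c 1)) = c 1) →
      ∃ y ∈ totDeg (gr R) ((m : ℤ) + 1), proj R p y = 0 ∧ totd (killP R p) y = c := by
    intro h h'
    have hc00 : c 0 = 0 := by rw [eq_coef_smul hc0, h, zero_smul]
    obtain ⟨y, hy, hy0, hy1, hyd⟩ := exists_totd_eq h2 hc hd (y₁ := 0) (zero_mem _)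
      (by rw [map_zero, hc00]) (by rw [map_zero, add_zero, h'])
    exact ⟨y, hy, finish y hy hy0 (Or.inr hy1), hyd⟩
  rcases Nat.even_or_odd m with hn | hn
  · rcases eq_or_ne m 0 with rfl | hn0
    · refine hzero ?_ ?_
      · have := congrFun hπ 0
        rwa [proj_zero] at this
      · rw [intDeg_neg (by simp) hc1]; simp
    · obtain ⟨u, hu⟩ := h2.exists_right_inv
      have hodd : Odd (m - 1) := by
        obtain ⟨k, hk⟩ := hn
        exact ⟨k - 1, by omega⟩
      have em : ((m - 1 : ℕ) : ℤ) = (m : ℤ) - 1 := by omega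
      rw [← em] at hc1
      have hw0 : pairIdx (m - 1) 1 0 = m - 1 := rfl
      have hw1 : pairIdx (m - 1) 1 1 = 1 := rfl
      have hdeg : deg 1 (pairIdx (m - 1) 1) = m := by
        rw [deg, Finset.sum_range_succ, Finset.sum_range_one, hw0, hw1]; omega
      set γ := coef R m (c 0) with hγ
      -- For even `m` the boundary of `x^(m-1) ⊗ x` is `2 x^m`, so half of it bounds the zero-chain
      -- component. The vanishing of `proj c` then says precisely that the corrected one-chain has
      -- zero `snd`.
      set y₁ := (γ * u) • X R 1 (pairIdx (m - 1) 1) with hy₁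
      have hy₁m : y₁ ∈ intDeg (gr R) 1 (m : ℤ) :=
        Submodule.smul_mem _ _ (X_mem_intDeg _ _ (by rw [hdeg]))
      have hsum : c 1 + int (killP R p) 1 y₁ ∈ intDeg (gr R) 1 ((m - 1 : ℕ) : ℤ) := by
        refine add_mem hc1 ?_
        rw [em]
        exact int_mem_intDeg hy₁m
      have hb : b (gr R) 0 y₁ = c 0 := by
        rw [hy₁, map_smul, b_zero_X, hdeg, hw1, one_mul, hn.add_one.neg_one_pow, neg_smul, one_smul,
          sub_neg_eq_add, ← two_smul R, smul_smul, eq_coef_smul hc0, ← hγ]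
        congr 1
        linear_combination γ * hu
      have hsnd : snd R (c 1 + int (killP R p) 1 y₁) = 0 := by
        have h01 : dec 0 (pairIdx (m - 1) 1) 1 = 1 := rfl
        have h11 : dec 1 (pairIdx (m - 1) 1) 1 = 0 := rfl
        have hp := congrFun hπ m
        rw [proj_even hn hn0, mu_eq_snd (by omega) hc1, ← hγ, Pi.zero_apply] at hp
        rw [map_add, hy₁, map_smul, int_one_X, hw0, hw1, if_pos hodd, if_pos odd_one, map_smul,
          map_add, map_smul, map_zsmul, map_smul, snd_X, snd_X, h01, h11]
        simp only [Nat.cast_one, Nat.cast_zero, smul_eq_mul, mul_zero, zsmul_zero, add_zero, mul_one]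
        linear_combination u * hp - snd R (c 1) * hu
      obtain ⟨y, hy, hy0, hy1, hyd⟩ := exists_totd_eq h2 hc hd hy₁m hb (b_contr_odd hodd hsum hsnd)
      exact ⟨y, hy, finish y hy hy0 (Or.inl hn), hyd⟩
  · have em : ((m - 1 : ℕ) : ℤ) = (m : ℤ) - 1 := by have := hn.pos; omega
    have hev : Even (m - 1) := by
      obtain ⟨k, hk⟩ := hn
      exact ⟨k, by omega⟩
    have hcz : coef R m (c 0) = 0 := by
      have := congrFun hπ m
      rwa [proj_odd hn] at this
    rw [← em] at hc1
    refine hzero hcz (b_contr_even h2 hev hc1 ?_)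
    have hc00 : c 0 = 0 := by rw [eq_coef_smul hc0, hcz, zero_smul]
    rw [hc00, map_zero, add_zero] at hd0
    exact hd0

theorem HCneg_equiv (h2 : IsUnit (2 : R)) (i : ℤ) :
    Nonempty (HCneg (killP R p) i ≃ₗ[R]
      Mixed.homology (grE R) (Mixed.negD (dE R p) (BE R)) 2 i) :=
  Mixed.negD_homology_equiv (proj R p) (totd_totd h2 p) totB_totB (totd_totB p)
    (fun _ _ h => totd_mem_totDeg h) (fun _ _ h => totB_mem_totDeg h) proj_totd proj_totB
    (fun _ _ h => proj_mem h) (fun _ _ h => proj_surj h2 h)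
    (fun _ _ h h' h'' => proj_acyclic h2 h h' h'') i

theorem HC_equiv (h2 : IsUnit (2 : R)) (i : ℤ) :
    Nonempty (HC (killP R p) i ≃ₗ[R]
      Mixed.homology (grE R) (Mixed.cycD (dE R p) (BE R)) (-2) i) :=
  Mixed.cycD_homology_equiv (proj R p) (totd_totd h2 p) totB_totB (totd_totB p)
    (fun _ _ h => totd_mem_totDeg h) (fun _ _ h => totB_mem_totDeg h) proj_totd proj_totB
    (fun _ _ h => proj_mem h) (fun _ _ h => proj_surj h2 h)
    (fun _ hm _ h => totDeg_neg hm h) (fun _ _ h h' h'' => proj_acyclic h2 h h' h'') i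

end Small

/-! ### Modules presented by chains of relations between powers of one element -/

/-- Exponents of a chain of relations `q^(s m) ε_m = q^(r (m + 1)) ε_(m + 1)`, together with the
exponents `α m` such that `ε_m ↦ q^(α m)` respects the relations, and for each `k` the end of a
cluster of indices starting at `k + 1` on which these exponents are at least `α (k + 1)`. -/
structure PowerChain where
  s : ℕ → ℕ
  r : ℕ → ℕ
  α : ℕ → ℕ
  e : ℕ → ℕ
  α_zero : α 0 = 0
  step : ∀ m, α (m + 1) + r (m + 1) = α m + s m
  s_mono : Monotone s
  lt_e : ∀ k, k < e k
  le_cluster : ∀ k m, k < m → m ≤ e k → α (k + 1) ≤ α m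
  cluster_lt : ∀ k m, k + 1 < m → m ≤ e k → r m < r (k + 1)
  le_end : ∀ k, α k ≤ α (e k)

namespace PowerChain

variable {R : Type u} [CommRing R] (C : PowerChain) (q : R)

/-- The map whose cokernel is presented by the relations of the chain. -/
def rel (F : ℕ → R) : ℕ → R
  | 0 => q ^ C.s 0 * F 0
  | m + 1 => q ^ C.s (m + 1) * F (m + 1) - q ^ C.r (m + 1) * F m

/-- The weighted sum `∑_{m < L} q^(α m) g m`. -/
def wsum (L : ℕ) : (ℕ → R) →ₗ[R] R :=
  ∑ m ∈ Finset.range L, q ^ C.α m • LinearMap.proj m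

/-- The functional `∑_{k < m ≤ l} q^(α m - α (k + 1)) g m`. -/
def clusterSum (k l : ℕ) : (ℕ → R) →ₗ[R] R :=
  ∑ m ∈ Finset.Ioc k l, q ^ (C.α m - C.α (k + 1)) • LinearMap.proj m

variable {q}

theorem wsum_apply (L : ℕ) (g : ℕ → R) :
    C.wsum q L g = ∑ m ∈ Finset.range L, q ^ C.α m * g m := by
  simp [wsum]

theorem clusterSum_apply (k l : ℕ) (g : ℕ → R) :
    C.clusterSum q k l g = ∑ m ∈ Finset.Ioc k l, q ^ (C.α m - C.α (k + 1)) * g m := by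
  simp [clusterSum]

theorem pow_mul_clusterSum {k l : ℕ} (hl : l ≤ C.e k) (g : ℕ → R) :
    q ^ C.α (k + 1) * C.clusterSum q k l g = ∑ m ∈ Finset.Ioc k l, q ^ C.α m * g m := by
  rw [clusterSum_apply, Finset.mul_sum]
  refine Finset.sum_congr rfl fun m hm => ?_
  have := Finset.mem_Ioc.1 hm
  rw [← mul_assoc, ← pow_add, Nat.add_sub_cancel' (C.le_cluster k m this.1 (this.2.trans hl))]

/-- The weights satisfy `α (m+1) + r (m+1) = α m + s m`, so the sum of the relations telescopes and
only the last unknown survives. -/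
theorem wsum_rel (L : ℕ) (F : ℕ → R) :
    C.wsum q (L + 1) (C.rel q F) = q ^ (C.α L + C.s L) * F L := by
  induction L with
  | zero => rw [wsum_apply, Finset.sum_range_one, rel, ← mul_assoc, ← pow_add]
  | succ L ih =>
    rw [wsum_apply, Finset.sum_range_succ, ← wsum_apply, ih, rel, mul_sub, ← mul_assoc, ← mul_assoc,
      ← pow_add, ← pow_add, C.step]
    ring

theorem sum_Ioc_eq {k l : ℕ} (h : k ≤ l) (g : ℕ → R) :
    ∑ m ∈ Finset.Ioc k l, q ^ C.α m * g m = C.wsum q (l + 1) g - C.wsum q (k + 1) g := by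
  rw [wsum_apply, wsum_apply, ← Finset.sum_Ico_eq_sub _ (by omega)]
  refine Finset.sum_congr (Finset.ext fun m => ?_) fun _ _ => rfl
  rw [Finset.mem_Ioc, Finset.mem_Ico]
  omega

theorem s_le {j k : ℕ} (h : j ≤ k) : C.s j ≤ C.s k := C.s_mono h

theorem pow_cancel (hq : ∀ x : R, q * x = 0 → x = 0) {n : ℕ} {x y : R}
    (h : q ^ n * x = q ^ n * y) : x = y := by
  induction n with
  | zero => simpa using h
  | succ n ih =>
    apply ih
    rw [← sub_eq_zero]
    apply hq
    rw [mul_sub, ← mul_assoc, ← mul_assoc, ← pow_succ', h, sub_self]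

/-- After multiplication by `q^(α (k+1))` the cluster sum telescopes to a difference of two end
terms. The lower one has exponent `α k + s k = α (k+1) + r (k+1)`, and the upper one is at least as
divisible because `α` and `s` do not drop from `k` to `l`. -/
theorem pow_dvd_clusterSum_rel (hq : ∀ x : R, q * x = 0 → x = 0) {k l : ℕ} (hk : k < l)
    (hl : l ≤ C.e k) (h : C.α k ≤ C.α l) {g F : ℕ → R} (hg : ∀ m ≤ l, g m = C.rel q F m) :
    q ^ C.r (k + 1) ∣ C.clusterSum q k l g := by
  have h0 : C.clusterSum q k l g = C.clusterSum q k l (C.rel q F) := by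
    rw [clusterSum_apply, clusterSum_apply]
    exact Finset.sum_congr rfl fun m hm => by rw [hg m (Finset.mem_Ioc.1 hm).2]
  have h1 := C.pow_mul_clusterSum (q := q) hl (C.rel q F)
  rw [C.sum_Ioc_eq hk.le, wsum_rel, wsum_rel] at h1
  have h2 := C.s_le hk.le
  obtain ⟨d, hd⟩ : ∃ d, C.α l + C.s l = C.α (k + 1) + C.r (k + 1) + d :=
    ⟨C.α l + C.s l - (C.α k + C.s k), by rw [C.step]; omega⟩
  refine ⟨q ^ d * F l - F k, ?_⟩
  rw [h0]
  apply pow_cancel hq (n := C.α (k + 1))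
  rw [h1, hd, ← C.step]
  ring

/-- Telescoping forces `q^(α m + s m) F m` to be the partial weighted sum, which determines `F m` by
cancellation; where the sum is not divisible the value `0` is a placeholder. A single `F` thus
serves all admissible `m`. -/
theorem exists_rel_eq (hq : ∀ x : R, q * x = 0 → x = 0) (g : ℕ → R) :
    ∃ F : ℕ → R, ∀ m, (∀ m' ≤ m, q ^ (C.α m' + C.s m') ∣ C.wsum q (m' + 1) g) →
      g m = C.rel q F m := by
  classical
  refine ⟨fun m => if h : q ^ (C.α m + C.s m) ∣ C.wsum q (m + 1) g then h.choose else 0,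
    fun m hm => ?_⟩
  set F := fun m => if h : q ^ (C.α m + C.s m) ∣ C.wsum q (m + 1) g then h.choose else 0 with hF
  have hFm : ∀ m' ≤ m, q ^ (C.α m' + C.s m') * F m' = C.wsum q (m' + 1) g := by
    intro m' h'
    simp only [hF]
    rw [dif_pos (hm m' h')]
    exact (hm m' h').choose_spec.symm
  apply pow_cancel hq (n := C.α m)
  rcases m with _ | m
  · rw [rel, ← mul_assoc, ← pow_add, hFm 0 le_rfl, wsum_apply, Finset.sum_range_one]
  · rw [rel, mul_sub, ← mul_assoc, ← mul_assoc, ← pow_add, ← pow_add, C.step, hFm _ le_rfl,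
      hFm m (by omega), wsum_apply, wsum_apply, Finset.sum_range_succ]
    ring

/-- The tail is cut at `l`, `e l`, `e (e l)`, and so on. By `le_end` the exponents at these cuts
never fall below `α j`, so the hypothesis applies to every piece. -/
theorem pow_dvd_tail {j M : ℕ} {g : ℕ → R}
    (h : ∀ k, j ≤ k → k < M → C.α j ≤ C.α k →
      q ^ (C.α j + C.s j) ∣ ∑ m ∈ Finset.Ioc k (min (C.e k) M), q ^ C.α m * g m)
    {l : ℕ} (hjl : j ≤ l) (hl : l ≤ M) (hα : C.α j ≤ C.α l) :
    q ^ (C.α j + C.s j) ∣ ∑ m ∈ Finset.Ioc l M, q ^ C.α m * g m := by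
  induction hd : M - l using Nat.strong_induction_on generalizing l with
  | _ d ih =>
    rcases hl.eq_or_lt with rfl | hl
    · simp
    have h1 := C.lt_e l
    have h2 : Finset.Ioc l M = Finset.Ioc l (min (C.e l) M) ∪ Finset.Ioc (min (C.e l) M) M := by
      rw [Finset.Ioc_union_Ioc_eq_Ioc (by omega) (by omega)]
    rw [h2, Finset.sum_union]
    · refine dvd_add (h l hjl hl hα) ?_
      rcases le_total (C.e l) M with h3 | h3
      · rw [min_eq_left h3]
        exact ih (M - C.e l) (by omega) (by omega) h3 (hα.trans (C.le_end l)) rfl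
      · rw [min_eq_right h3]; simp
    · rw [Finset.disjoint_left]
      intro m hm hm'
      have := Finset.mem_Ioc.1 hm
      have := Finset.mem_Ioc.1 hm'
      omega

/-- The cluster sum of `k` contains `g (k+1)` with coefficient one, and its other entries `g m` have
`r m < r (k+1)`. The system is therefore triangular for the order by `r`, and is solved by
well-founded recursion, with `G k` standing for `g (k+1)`. -/
theorem exists_clusterSum_eq (l : ℕ → ℕ) (hl : ∀ k, l k ≤ C.e k) (a : R) (β : ℕ → R) :
    ∃ g : ℕ → R, g 0 = a ∧ ∀ k, k < l k → C.clusterSum q k (l k) g = β k := by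
  have wf : WellFounded (fun k k' : ℕ => C.r (k + 1) < C.r (k' + 1)) :=
    InvImage.wf (fun k => C.r (k + 1)) Nat.lt_wfRel.wf
  let G : ℕ → R := wf.fix fun k G => β k - ∑ m ∈ (Finset.Ioc (k + 1) (l k)).attach,
    q ^ (C.α m - C.α (k + 1)) * (G (m - 1) (by
      have := Finset.mem_Ioc.1 m.2
      rw [Nat.sub_add_cancel (by omega)]
      exact C.cluster_lt k m this.1 (this.2.trans (hl k))))
  have hG : ∀ k, G k = β k - ∑ m ∈ Finset.Ioc (k + 1) (l k), q ^ (C.α m - C.α (k + 1)) * G (m - 1) := by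
    intro k
    rw [← Finset.sum_attach]
    exact wf.fix_eq _ k
  refine ⟨fun m => if m = 0 then a else G (m - 1), rfl, fun k hk => ?_⟩
  have h1 : Finset.Ioc k (l k) = insert (k + 1) (Finset.Ioc (k + 1) (l k)) := by
    ext m
    simp only [Finset.mem_Ioc, Finset.mem_insert]
    omega
  rw [clusterSum_apply, h1, Finset.sum_insert (by simp)]
  have h2 : ∑ m ∈ Finset.Ioc (k + 1) (l k), q ^ (C.α m - C.α (k + 1)) *
      (if m = 0 then a else G (m - 1)) =
      ∑ m ∈ Finset.Ioc (k + 1) (l k), q ^ (C.α m - C.α (k + 1)) * G (m - 1) :=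
    Finset.sum_congr rfl fun m hm => by
      have := Finset.mem_Ioc.1 hm
      rw [if_neg (by omega)]
  rw [h2]
  simp only [Nat.sub_self, pow_zero, one_mul, Nat.succ_ne_zero, if_false, Nat.add_sub_cancel]
  rw [hG k, sub_add_cancel]

theorem mk_eq_zero_iff (n : ℕ) (x : R) :
    (Submodule.Quotient.mk x : R ⧸ Ideal.span {q ^ n}) = 0 ↔ q ^ n ∣ x := by
  rw [Submodule.Quotient.mk_eq_zero, Ideal.mem_span_singleton]

/-- The module presented by a finite chain of relations. -/
theorem finite_cokernel (hq : ∀ x : R, q * x = 0 → x = 0) {M : ℕ} (hM : ∀ m ≤ M, C.α m ≤ C.α M) :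
    ∃ Ψ : (ℕ → R) →ₗ[R] (R ⧸ Ideal.span {q ^ (C.α M + C.s M)}) ×
        ∀ k : Fin M, R ⧸ Ideal.span {q ^ C.r ((k : ℕ) + 1)},
      Function.Surjective Ψ ∧ ∀ g, Ψ g = 0 ↔ ∃ F, ∀ m ≤ M, g m = C.rel q F m := by
  refine ⟨LinearMap.prod (Submodule.mkQ _ ∘ₗ C.wsum q (M + 1)) (LinearMap.pi fun k : Fin M =>
    Submodule.mkQ _ ∘ₗ C.clusterSum q k (min (C.e k) M)), ?_, ?_⟩
  · rintro ⟨a, β⟩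
    obtain ⟨a, rfl⟩ := Submodule.mkQ_surjective _ a
    choose β' hβ' using fun k => Submodule.mkQ_surjective _ (β k)
    obtain ⟨g, -, hg⟩ := C.exists_clusterSum_eq (q := q) (fun k => min (C.e k) M)
      (fun k => min_le_left _ _) 0 (fun k => if h : k < M then β' ⟨k, h⟩ else 0)
    -- The entry at `0` belongs to no cluster and has weight `q^0 = 1`, so it adjusts the total sum
    -- freely.
    refine ⟨fun m => if m = 0 then a - C.wsum q (M + 1) g + g 0 else g m, ?_⟩
    refine Prod.ext ?_ (funext fun k => ?_)
    · show Submodule.mkQ _ (C.wsum q (M + 1) _) = Submodule.mkQ _ a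
      congr 1
      rw [wsum_apply, wsum_apply, Finset.sum_range_succ', Finset.sum_range_succ', C.α_zero]
      simp
      ring
    · show Submodule.mkQ _ (C.clusterSum q k (min (C.e k) M) _) = β k
      rw [← hβ' k]
      congr 1
      have h1 := hg k (by have := C.lt_e k; have := k.2; omega)
      rw [dif_pos k.2] at h1
      rw [← h1, clusterSum_apply, clusterSum_apply]
      refine Finset.sum_congr rfl fun m hm => ?_
      have := Finset.mem_Ioc.1 hm
      rw [if_neg (by omega)]
  · intro g
    have hΨ : (LinearMap.prod (Submodule.mkQ (Ideal.span {q ^ (C.α M + C.s M)}) ∘ₗ C.wsum q (M + 1))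
        (LinearMap.pi fun k : Fin M => Submodule.mkQ (Ideal.span {q ^ C.r ((k : ℕ) + 1)}) ∘ₗ
          C.clusterSum q k (min (C.e k) M))) g = 0 ↔
        q ^ (C.α M + C.s M) ∣ C.wsum q (M + 1) g ∧
          ∀ k < M, q ^ C.r (k + 1) ∣ C.clusterSum q k (min (C.e k) M) g := by
      rw [Prod.ext_iff, funext_iff]
      constructor
      · rintro ⟨h1, h2⟩
        exact ⟨(mk_eq_zero_iff _ _).1 h1, fun k hk => (mk_eq_zero_iff _ _).1 (h2 ⟨k, hk⟩)⟩
      · rintro ⟨h1, h2⟩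
        exact ⟨(mk_eq_zero_iff _ _).2 h1, fun k => (mk_eq_zero_iff _ _).2 (h2 k k.2)⟩
    rw [hΨ]
    constructor
    · rintro ⟨h1, h2⟩
      obtain ⟨F, hF⟩ := C.exists_rel_eq hq g
      refine ⟨F, fun m hm => hF m fun j hj => ?_⟩
      -- The total sum and every tail are sufficiently divisible, hence so is every initial sum;
      -- this is the condition under which `F` solves the relations.
      have htail : q ^ (C.α j + C.s j) ∣ ∑ m ∈ Finset.Ioc j M, q ^ C.α m * g m := by
        refine C.pow_dvd_tail (fun k hjk hk hα => ?_) le_rfl (hj.trans hm) le_rfl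
        rw [← C.pow_mul_clusterSum (min_le_left _ _)]
        have h3 := mul_dvd_mul_left (q ^ C.α (k + 1)) (h2 k hk)
        rw [← pow_add, C.step] at h3
        have := C.s_le hjk
        exact (pow_dvd_pow q (by omega)).trans h3
      rw [C.sum_Ioc_eq (hj.trans hm)] at htail
      have h3 := hM j (hj.trans hm)
      have h4 := C.s_le (hj.trans hm)
      have h5 := (pow_dvd_pow q (show C.α j + C.s j ≤ C.α M + C.s M by omega)).trans h1
      have := dvd_sub h5 htail
      rwa [sub_sub_cancel] at this
    · rintro ⟨F, hF⟩
      constructor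
      · have : C.wsum q (M + 1) g = C.wsum q (M + 1) (C.rel q F) := by
          rw [wsum_apply, wsum_apply]
          exact Finset.sum_congr rfl fun m hm => by
            rw [hF m (by have := Finset.mem_range.1 hm; omega)]
        rw [this, wsum_rel]
        exact dvd_mul_right _ _
      · intro k hk
        have := C.lt_e k
        refine C.pow_dvd_clusterSum_rel hq (by omega) (min_le_left _ _) ?_
          (fun m hm => hF m (hm.trans (min_le_right _ _)))
        rcases le_total (C.e k) M with h3 | h3
        · rw [min_eq_left h3]; exact C.le_end k
        · rw [min_eq_right h3]; exact hM k hk.le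

/-! ### Infinite chains and the completion -/

theorem mem_span_pow_smul_top (n : ℕ) (x : R) :
    x ∈ (Ideal.span {q} ^ n • ⊤ : Submodule R R) ↔ q ^ n ∣ x := by
  rw [Ideal.span_singleton_pow, smul_eq_mul, Ideal.mul_top, Ideal.mem_span_singleton]

theorem pow_dvd_wsum_sub {n K L : ℕ} (hK : ∀ m, K ≤ m → n ≤ C.α m) (hL : K ≤ L) (g : ℕ → R) :
    q ^ n ∣ C.wsum q L g - C.wsum q K g := by
  rw [wsum_apply, wsum_apply, ← Finset.sum_Ico_eq_sub _ hL]
  refine Finset.dvd_sum fun m hm => Dvd.dvd.mul_right (pow_dvd_pow q (hK m ?_)) _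
  exact (Finset.mem_Ico.1 hm).1

/-- The sum `∑ q^(α m) g m` in the completion. -/
theorem exists_completed_wsum (hα : ∀ N, ∃ K, ∀ m, K ≤ m → N ≤ C.α m) :
    ∃ Φ : (ℕ → R) →ₗ[R] AdicCompletion (Ideal.span {q}) R,
      ∀ (n K : ℕ) (g : ℕ → R), (∀ m, K ≤ m → n ≤ C.α m) →
        (Φ g).val n = Submodule.Quotient.mk (C.wsum q K g) := by
  choose K hK using hα
  have hmk : ∀ n L L' g, (∀ m, L ≤ m → n ≤ C.α m) → (∀ m, L' ≤ m → n ≤ C.α m) →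
      (Submodule.Quotient.mk (C.wsum q L g) : R ⧸ (Ideal.span {q} ^ n • ⊤ : Submodule R R)) =
        Submodule.Quotient.mk (C.wsum q L' g) := by
    intro n L L' g h h'
    rw [Submodule.Quotient.eq, mem_span_pow_smul_top]
    have h1 := C.pow_dvd_wsum_sub (q := q) h (le_max_left L L') g
    have h2 := C.pow_dvd_wsum_sub (q := q) h' (le_max_right L L') g
    have := dvd_sub h2 h1
    rwa [sub_sub_sub_cancel_left] at this
  refine ⟨AdicCompletion.lift _ (fun n => Submodule.mkQ _ ∘ₗ C.wsum q (K n)) ?_, ?_⟩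
  · intro m n hmn
    refine LinearMap.ext fun g => ?_
    exact hmk m (K n) (K m) g (fun j hj => hmn.trans (hK n j hj)) (hK m)
  · intro n L g h
    exact hmk n (K n) L g (hK n) h

theorem exists_free_sequence (hα : ∀ N, ∃ K, ∀ m, K ≤ m → N ≤ C.α m)
    (hfree : ∀ N, ∃ k ≥ N, ∀ k' < k, C.e k' ≤ k) :
    ∃ κ : ℕ → ℕ, (∀ t, κ t < κ (t + 1)) ∧ (∀ t, ∀ k < κ t, C.e k ≤ κ t) ∧
      ∀ t, C.α (κ t) + C.s (κ t) < C.α (κ (t + 1)) + C.s (κ (t + 1)) := by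
  obtain ⟨k₀, -, hk₀⟩ := hfree 0
  obtain ⟨κ, -, h1, h2⟩ := exists_dependent_seq (α := fun _ => ℕ)
    (Inv := fun _ k => ∀ k' < k, C.e k' ≤ k)
    (Rel := fun _ k k' => k < k' ∧ C.α k + C.s k < C.α k' + C.s k') (a₀ := k₀) hk₀ (by
      intro _ k _
      obtain ⟨K, hK⟩ := hα (C.α k + C.s k + 1)
      obtain ⟨k', hk', hfk⟩ := hfree (max K (k + 1))
      have := hK k' ((le_max_left _ _).trans hk')
      have := (le_max_right K (k + 1)).trans hk'
      exact ⟨k', hfk, by omega, by omega⟩)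
  exact ⟨κ, fun t => (h2 t).1, h1, fun t => (h2 t).2⟩

/-- An element of the completion is written as a series whose terms sit just after the indices `κ
t`, which no cluster starting earlier crosses. The entry there carries a factor `q^(r (κ t + 1))`,
so it is invisible to the cluster of `κ t`, and no other cluster contains it. -/
theorem exists_wsum_eq (hα : ∀ N, ∃ K, ∀ m, K ≤ m → N ≤ C.α m)
    (hfree : ∀ N, ∃ k ≥ N, ∀ k' < k, C.e k' ≤ k) {Φ : (ℕ → R) →ₗ[R] AdicCompletion (Ideal.span {q}) R}
    (hΦ : ∀ (n K : ℕ) (g : ℕ → R), (∀ m, K ≤ m → n ≤ C.α m) →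
      (Φ g).val n = Submodule.Quotient.mk (C.wsum q K g))
    (a : AdicCompletion (Ideal.span {q}) R) :
    ∃ h : ℕ → R, Φ h = a ∧ ∀ k, q ^ C.r (k + 1) ∣ C.clusterSum q k (C.e k) h := by
  classical
  obtain ⟨κ, hκ, hκf, hκb⟩ := C.exists_free_sequence hα hfree
  have hκm : StrictMono κ := strictMono_nat_of_lt_succ hκ
  set b : ℕ → ℕ := fun t => C.α (κ t) + C.s (κ t) with hb
  have hbm : StrictMono b := strictMono_nat_of_lt_succ hκb
  choose x hx using fun n => Submodule.Quotient.mk_surjective _ (a.val n)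
  have hxx : ∀ n n', n ≤ n' → q ^ n ∣ x n' - x n := by
    intro n n' h
    have h1 := a.2 h
    rw [← mem_span_pow_smul_top, ← Submodule.Quotient.eq]
    rw [hx n, ← h1]
    change _ = AdicCompletion.transitionMap _ _ h (a.val n')
    rw [← hx n']
    rfl
  choose c hc using fun t => hxx (b t) (b (t + 1)) (hbm (Nat.lt_succ_self t)).le
  -- The factor `q^(r m)` turns the weight `q^(α m)` at `m = κ t + 1` into `q^(b t)`, which matches
  -- the difference of consecutive approximations.
  set h : ℕ → R := fun m => if m = 0 then x (b 0) else
    if hm : ∃ t, κ t + 1 = m then q ^ C.r m * c hm.choose else 0 with hh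
  have hh0 : h 0 = x (b 0) := rfl
  have hht : ∀ t, h (κ t + 1) = q ^ C.r (κ t + 1) * c t := by
    intro t
    have he : ∃ t', κ t' + 1 = κ t + 1 := ⟨t, rfl⟩
    simp only [hh]
    rw [if_neg (by omega), dif_pos he, hκm.injective (Nat.succ_injective he.choose_spec)]
  have hhn : ∀ m, m ≠ 0 → (∀ t, κ t + 1 ≠ m) → h m = 0 := by
    intro m hm hmt
    simp only [hh]
    rw [if_neg hm, dif_neg (by rintro ⟨t, ht⟩; exact hmt t ht)]
  have hsum : ∀ t, C.wsum q (κ t + 1) h = x (b t) := by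
    intro t
    induction t with
    | zero =>
      rw [wsum_apply, Finset.sum_eq_single 0, C.α_zero, pow_zero, one_mul]
      · exact hh0
      · intro m hm hm0
        have h1 := Finset.mem_range.1 hm
        rw [hhn m hm0, mul_zero]
        intro t ht
        have := hκm.monotone (Nat.zero_le t)
        omega
      · intro h0
        exact absurd (Finset.mem_range.2 (Nat.succ_pos _)) h0
    | succ t ih =>
      have h1 := hκ t
      have h2 : C.wsum q (κ (t + 1) + 1) h - C.wsum q (κ t + 1) h = x (b (t + 1)) - x (b t) := by
        rw [wsum_apply, wsum_apply, ← Finset.sum_Ico_eq_sub _ (by omega),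
          Finset.sum_eq_single (κ t + 1), hht, ← mul_assoc, ← pow_add, C.step, hc]
        · intro m hm hm0
          have h3 := Finset.mem_Ico.1 hm
          rw [hhn m (by omega), mul_zero]
          intro t' ht'
          have h4 : t < t' := by
            rw [← hκm.lt_iff_lt]
            omega
          have h5 : t' < t + 1 := by
            rw [← hκm.lt_iff_lt]
            omega
          omega
        · intro h0
          exact absurd (Finset.mem_Ico.2 ⟨le_rfl, by omega⟩) h0
      rw [ih] at h2
      linear_combination h2
  refine ⟨h, ?_, fun k => ?_⟩
  · refine AdicCompletion.ext fun n => ?_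
    obtain ⟨K, hK⟩ := hα n
    set t := max n K
    have h1 : t ≤ κ t := hκm.id_le t
    have h2 : t ≤ b t := hbm.id_le t
    have h3 : K ≤ t := le_max_right _ _
    have h4 : n ≤ t := le_max_left _ _
    rw [hΦ n (κ t + 1) h (fun m hm => hK m (by omega)), hsum, ← hx n, Submodule.Quotient.eq,
      mem_span_pow_smul_top]
    exact hxx n (b t) (by omega)
  · rw [clusterSum_apply]
    refine Finset.dvd_sum fun m hm => ?_
    have h1 := Finset.mem_Ioc.1 hm
    by_cases ht : ∃ t, κ t + 1 = m
    · obtain ⟨t, rfl⟩ := ht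
      have h2 : ¬ k < κ t := fun h3 => by
        have := hκf t k h3
        omega
      have h3 : κ t = k := by omega
      rw [hht, h3]
      exact Dvd.dvd.mul_left (dvd_mul_right _ _) _
    · rw [hhn m (by omega) (fun t h => ht ⟨t, h⟩), mul_zero]
      exact dvd_zero _

/-- The module presented by an infinite chain of relations, in the product sense. -/
theorem infinite_cokernel (hq : ∀ x : R, q * x = 0 → x = 0)
    (hα : ∀ N, ∃ K, ∀ m, K ≤ m → N ≤ C.α m)
    (hfree : ∀ N, ∃ k ≥ N, ∀ k' < k, C.e k' ≤ k) :
    ∃ Ψ : (ℕ → R) →ₗ[R] AdicCompletion (Ideal.span {q}) R ×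
        ∀ k : ℕ, R ⧸ Ideal.span {q ^ C.r (k + 1)},
      Function.Surjective Ψ ∧ ∀ g, Ψ g = 0 ↔ ∃ F, ∀ m, g m = C.rel q F m := by
  obtain ⟨Φ, hΦ⟩ := C.exists_completed_wsum (q := q) hα
  refine ⟨LinearMap.prod Φ (LinearMap.pi fun k : ℕ =>
    Submodule.mkQ _ ∘ₗ C.clusterSum q k (C.e k)), ?_, ?_⟩
  · rintro ⟨a, β⟩
    choose β' hβ' using fun k => Submodule.mkQ_surjective _ (β k)
    obtain ⟨g, -, hg⟩ := C.exists_clusterSum_eq (q := q) C.e (fun k => le_rfl) 0 β'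
    obtain ⟨h, hh, hhk⟩ := C.exists_wsum_eq hα hfree hΦ (a - Φ g)
    refine ⟨g + h, Prod.ext ?_ (funext fun k => ?_)⟩
    · show Φ (g + h) = a
      rw [map_add, hh, add_sub_cancel]
    · show Submodule.Quotient.mk (C.clusterSum q k (C.e k) (g + h)) = β k
      rw [map_add, hg k (C.lt_e k), Submodule.Quotient.mk_add, (mk_eq_zero_iff _ _).2 (hhk k), add_zero]
      exact hβ' k
  · intro g
    have hΨ : (LinearMap.prod Φ (LinearMap.pi fun k : ℕ =>
        Submodule.mkQ (Ideal.span {q ^ C.r (k + 1)}) ∘ₗ C.clusterSum q k (C.e k))) g = 0 ↔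
        Φ g = 0 ∧ ∀ k, q ^ C.r (k + 1) ∣ C.clusterSum q k (C.e k) g := by
      rw [Prod.ext_iff, funext_iff]
      exact and_congr Iff.rfl (forall_congr' fun k => mk_eq_zero_iff _ _)
    rw [hΨ]
    constructor
    · rintro ⟨h1, h2⟩
      obtain ⟨F, hF⟩ := C.exists_rel_eq hq g
      refine ⟨F, fun m => hF m fun j _ => ?_⟩
      -- Beyond `M` all weights are divisible by the power in question, so clusters crossing `M` may
      -- be truncated there without changing the divisibility.
      obtain ⟨K, hK⟩ := hα (C.α j + C.s j)
      set M := max K j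
      have hjM : j ≤ M := le_max_right _ _
      have hKM : ∀ m, M ≤ m → C.α j + C.s j ≤ C.α m := fun m hm => hK m ((le_max_left _ _).trans hm)
      have htail : q ^ (C.α j + C.s j) ∣ ∑ m ∈ Finset.Ioc j M, q ^ C.α m * g m := by
        refine C.pow_dvd_tail (fun k hjk hk hα => ?_) le_rfl hjM le_rfl
        have h3 := mul_dvd_mul_left (q ^ C.α (k + 1)) (h2 k)
        rw [← pow_add, C.step, C.pow_mul_clusterSum le_rfl] at h3
        have := C.s_le hjk
        have h4 := (pow_dvd_pow q (show C.α j + C.s j ≤ C.α k + C.s k by omega)).trans h3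
        rcases le_total (C.e k) M with h5 | h5
        · rwa [min_eq_left h5]
        · rw [min_eq_right h5]
          have h6 : q ^ (C.α j + C.s j) ∣ ∑ m ∈ Finset.Ioc M (C.e k), q ^ C.α m * g m :=
            Finset.dvd_sum fun m hm => Dvd.dvd.mul_right
              (pow_dvd_pow q (hKM m (Finset.mem_Ioc.1 hm).1.le)) _
          rw [C.sum_Ioc_eq (C.lt_e k).le] at h4
          rw [C.sum_Ioc_eq h5] at h6
          rw [C.sum_Ioc_eq hk.le]
          have := dvd_sub h4 h6
          rwa [sub_sub_sub_cancel_left] at this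
      rw [C.sum_Ioc_eq hjM] at htail
      have h5 : q ^ (C.α j + C.s j) ∣ C.wsum q (M + 1) g := by
        rw [← mem_span_pow_smul_top, ← Submodule.Quotient.mk_eq_zero,
          ← hΦ _ _ g (fun m hm => hKM m (by omega)), h1]
        rfl
      have := dvd_sub h5 htail
      rwa [sub_sub_cancel] at this
    · rintro ⟨F, hF⟩
      obtain rfl : g = C.rel q F := funext hF
      constructor
      · refine AdicCompletion.ext fun n => ?_
        obtain ⟨K, hK⟩ := hα n
        rw [hΦ n (K + 1) _ (fun m hm => hK m (by omega)), wsum_rel]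
        change _ = (0 : R ⧸ (Ideal.span {q} ^ n • ⊤ : Submodule R R))
        rw [Submodule.Quotient.mk_eq_zero, mem_span_pow_smul_top]
        have := hK K le_rfl
        exact Dvd.dvd.mul_right (pow_dvd_pow q (by omega)) _
      · exact fun k => C.pow_dvd_clusterSum_rel hq (C.lt_e k) le_rfl (C.le_end k) fun _ _ => rfl

end PowerChain

/-! ### Valuations -/

section Valuation

variable {p : ℕ} [hpf : Fact p.Prime]

theorem padicValNat_factorial_eq_sum (N : ℕ) :
    padicValNat p N.factorial = ∑ m ∈ Finset.range (N + 1), padicValNat p m := by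
  induction N with
  | zero => simp
  | succ N ih =>
    rw [Nat.factorial_succ, padicValNat.mul (Nat.succ_ne_zero _) (Nat.factorial_ne_zero _), ih,
      Finset.sum_range_succ _ (N + 1), add_comm]

theorem two_mul_padicValNat_factorial_lt (hp : p ≠ 2) {N : ℕ} (hN : N ≠ 0) :
    2 * padicValNat p N.factorial < N := by
  have h1 := sub_one_mul_padicValNat_factorial_lt_of_ne_zero (p := p) hN
  have h2 := hpf.out.two_le
  exact (Nat.mul_le_mul_right _ (by omega : 2 ≤ p - 1)).trans_lt h1

/-- The valuations of distinct numbers up to `N` add up to less than `N / 2`. -/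
theorem two_mul_sum_padicValNat_lt (hp : p ≠ 2) {n N : ℕ} (hN : N ≠ 0) {u : ℕ → ℕ}
    (hu : ∀ s < n, ∀ t < n, u s = u t → s = t) (huN : ∀ t < n, u t ≤ N) :
    2 * ∑ t ∈ Finset.range n, padicValNat p (u t) < N := by
  refine lt_of_le_of_lt ?_ (two_mul_padicValNat_factorial_lt hp hN)
  refine Nat.mul_le_mul_left _ ?_
  rw [padicValNat_factorial_eq_sum, ← Finset.sum_image (f := padicValNat p) (g := u)
    (fun s hs t ht h => hu s (Finset.mem_range.1 hs) t (Finset.mem_range.1 ht) h)]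
  refine Finset.sum_le_sum_of_subset fun m hm => ?_
  obtain ⟨t, ht, rfl⟩ := Finset.mem_image.1 hm
  exact Finset.mem_range.2 (Nat.lt_succ_of_le (huN t (Finset.mem_range.1 ht)))

/-- Modulo `p^a` the numbers `x` and `t` agree up to factors prime to `p`, so they are divisible by
the same powers `p^k`, `k ≤ a`; and `p^a` itself does not divide `t`. -/
theorem padicValNat_eq_of_dvd {a x t : ℕ} (ht : 0 < t) (hta : t < p ^ a) {c d : ℤ}
    (hc : IsCoprime (p : ℤ) c) (hd : IsCoprime (p : ℤ) d) (h : (p : ℤ) ^ a ∣ c * x + d * t) :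
    padicValNat p x = padicValNat p t := by
  have key : ∀ k ≤ a, p ^ k ∣ x ↔ p ^ k ∣ t := by
    intro k hk
    have h1 := (pow_dvd_pow (p : ℤ) hk).trans h
    rw [← Int.natCast_dvd_natCast, ← Int.natCast_dvd_natCast, Nat.cast_pow]
    exact ⟨fun h2 => hd.pow_left.dvd_of_dvd_mul_left ((dvd_add_right (h2.mul_left c)).1 h1),
      fun h2 => hc.pow_left.dvd_of_dvd_mul_left ((dvd_add_left (h2.mul_left d)).1 h1)⟩
  have hta' : ¬ p ^ a ∣ t := fun h => absurd (Nat.le_of_dvd ht h) (by omega)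
  have hxa : ¬ p ^ a ∣ x := fun h => hta' ((key a le_rfl).1 h)
  have hx : x ≠ 0 := by rintro rfl; exact hxa (dvd_zero _)
  have h1 : ∀ {y}, y ≠ 0 → ¬ p ^ a ∣ y → padicValNat p y ≤ a := fun {y} hy hya => by
    by_contra hlt
    exact hya ((padicValNat_dvd_iff_le hy).2 (by omega))
  apply le_antisymm
  · rw [← padicValNat_dvd_iff_le ht.ne', ← key _ (h1 hx hxa)]
    exact pow_padicValNat_dvd
  · rw [← padicValNat_dvd_iff_le hx, key _ (h1 ht.ne' hta')]
    exact pow_padicValNat_dvd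

theorem isCoprime_two (hp : p ≠ 2) : IsCoprime (p : ℤ) 2 := by
  have h : Nat.Coprime p 2 := (Nat.coprime_primes hpf.out Nat.prime_two).2 hp
  exact_mod_cast Nat.isCoprime_iff_coprime.2 h

theorem numA_odd (m : ℕ) : numA p (2 * m + 1) ≠ 0 ∧ padicValRat p (numA p (2 * m + 1)) +
    ((∑ t ∈ Finset.range (m + 1), padicValNat p (2 * t + 1) : ℕ) : ℤ) = 2 * m + 1 := by
  have hp0 : (p : ℚ) ≠ 0 := by exact_mod_cast hpf.out.ne_zero
  induction m with
  | zero =>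
    have h : numA p (2 * 0 + 1) = p := rfl
    rw [h]
    refine ⟨hp0, ?_⟩
    simp [padicValRat.self hpf.out.one_lt]
  | succ m ih =>
    obtain ⟨h0, h1⟩ := ih
    have h : numA p (2 * (m + 1) + 1) =
      (p : ℚ) ^ 2 * numA p (2 * m + 1) / ((2 * (m + 1) + 1 : ℕ) : ℚ) := rfl
    have h2 : ((2 * (m + 1) + 1 : ℕ) : ℚ) ≠ 0 := by exact_mod_cast Nat.succ_ne_zero (2 * (m + 1))
    have h3 := mul_ne_zero (pow_ne_zero 2 hp0) h0
    rw [h]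
    refine ⟨div_ne_zero h3 h2, ?_⟩
    rw [padicValRat.div h3 h2, padicValRat.mul (pow_ne_zero 2 hp0) h0, padicValRat.pow,
      padicValRat.self hpf.out.one_lt, padicValRat.of_nat, Finset.sum_range_succ]
    push_cast at h1 ⊢
    linarith

/-- The valuations of `1, 3, …, 2m + 1` add up to less than `(2m + 1)/2`, so the valuation of
`A_(2m+1)` is positive and the truncation in `vala` is harmless. -/
theorem vala_add_sum (hp : p ≠ 2) (m : ℕ) :
    vala p (2 * m + 1) + ∑ t ∈ Finset.range (m + 1), padicValNat p (2 * t + 1) = 2 * m + 1 := by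
  have h1 := (numA_odd (p := p) m).2
  have h2 := two_mul_sum_padicValNat_lt (p := p) hp (n := m + 1) (N := 2 * m + 1)
    (Nat.succ_ne_zero _) (u := fun t => 2 * t + 1) (fun s _ t _ h => by omega)
    (fun t _ => by omega)
  unfold vala
  omega

variable (p) in
/-- The valuation of `A_(2c-1)`, with the value `0` for `c = 0`. -/
def alph : ℕ → ℕ
  | 0 => 0
  | c + 1 => vala p (2 * c + 1)

theorem alph_succ (hp : p ≠ 2) (c : ℕ) :
    alph p (c + 1) + padicValNat p (2 * c + 1) = alph p c + if c = 0 then 1 else 2 := by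
  cases c with
  | zero =>
    have := vala_add_sum (p := p) hp 0
    simpa [alph] using this
  | succ c =>
    have h1 := vala_add_sum (p := p) hp c
    have h2 := vala_add_sum (p := p) hp (c + 1)
    rw [Finset.sum_range_succ] at h2
    simp only [alph, Nat.succ_ne_zero, if_false]
    omega

theorem alph_add (hp : p ≠ 2) {c : ℕ} (hc : c ≠ 0) (n : ℕ) :
    alph p (c + n) + ∑ t ∈ Finset.range n, padicValNat p (2 * (c + t) + 1) =
      alph p c + 2 * n := by
  induction n with
  | zero => simp
  | succ n ih =>
    have := alph_succ (p := p) hp (c + n)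
    rw [if_neg (by omega)] at this
    rw [Finset.sum_range_succ, show c + (n + 1) = c + n + 1 by omega]
    omega

theorem le_alph (hp : p ≠ 2) (c : ℕ) : c ≤ alph p c := by
  cases c with
  | zero => exact le_rfl
  | succ m =>
    have h1 := vala_add_sum (p := p) hp m
    have h2 := two_mul_sum_padicValNat_lt (p := p) hp (n := m + 1) (N := 2 * m + 1)
      (Nat.succ_ne_zero _) (u := fun t => 2 * t + 1) (fun s _ t _ h => by omega)
      (fun t _ => by omega)
    simp only [alph]
    omega

theorem alph_le (hp : p ≠ 2) (c : ℕ) : alph p c ≤ 2 * c - 1 := by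
  cases c with
  | zero => exact le_rfl
  | succ m =>
    have h1 := vala_add_sum (p := p) hp m
    simp only [alph]
    omega

theorem padicValNat_cluster (hp : p ≠ 2) {x t : ℕ} (ht : 0 < t) (h : t < p ^ padicValNat p x) :
    padicValNat p (x + 2 * t) = padicValNat p t := by
  refine padicValNat_eq_of_dvd ht h (c := 1) (d := -2) isCoprime_one_right
    (isCoprime_two hp).neg_right ?_
  have : ((1 : ℤ) * ((x + 2 * t : ℕ) : ℤ) + -2 * t) = x := by push_cast; ring
  rw [this]
  exact_mod_cast pow_padicValNat_dvd

/-- Each step raises `alph` by `2` minus a valuation, and within the cluster these valuations are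
those of `1, …, n`, with sum less than `n/2`. -/
theorem alph_cluster (hp : p ≠ 2) {c n : ℕ} (h : n < p ^ padicValNat p (2 * c + 1)) :
    alph p (c + 1) + n ≤ alph p (c + 1 + n) := by
  have h1 := alph_add (p := p) hp (Nat.succ_ne_zero c) n
  have h2 : ∑ t ∈ Finset.range n, padicValNat p (2 * (c + 1 + t) + 1) =
      ∑ t ∈ Finset.range n, padicValNat p (t + 1) := by
    refine Finset.sum_congr rfl fun t ht => ?_
    have := Finset.mem_range.1 ht
    rw [show 2 * (c + 1 + t) + 1 = 2 * c + 1 + 2 * (t + 1) by ring]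
    exact padicValNat_cluster hp (Nat.succ_pos _) (by omega)
  rcases Nat.eq_zero_or_pos n with rfl | hn
  · rfl
  have h3 := two_mul_sum_padicValNat_lt (p := p) hp (n := n) (N := n) hn.ne'
    (u := fun t => t + 1) (fun s _ t _ h => by omega) (fun t _ => by omega)
  rw [Nat.succ_eq_add_one, h2] at h1
  omega

/-- The chain of relations starting with the odd number `2M - 1` (with `-1` if `M = 0`). -/
def oddChain (hp : p ≠ 2) (M : ℕ) (hM : ∀ c, M ≤ c → alph p M ≤ alph p c) : PowerChain where
  s m := if M + m = 0 then 1 else 2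
  r m := padicValNat p (2 * (M + m) - 1)
  α m := alph p (M + m) - alph p M
  -- The length is chosen so that `2(M+k)+1+2t` has the valuation of `t` for every `t > 0` within
  -- the cluster.
  e k := k + p ^ padicValNat p (2 * (M + k) + 1)
  α_zero := by simp
  step m := by
    have h1 := alph_succ (p := p) hp (M + m)
    have h2 := hM (M + m) (by omega)
    have h3 := hM (M + m + 1) (by omega)
    rw [show 2 * (M + (m + 1)) - 1 = 2 * (M + m) + 1 by omega, ← add_assoc]
    omega
  s_mono m m' h := by
    dsimp only
    split_ifs <;> omega
  lt_e k := Nat.lt_add_of_pos_right (pow_pos hpf.out.pos _)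
  le_cluster k m h1 h2 := by
    have h3 := alph_cluster (p := p) hp (c := M + k) (n := m - (k + 1)) (by omega)
    rw [show M + k + 1 + (m - (k + 1)) = M + m by omega] at h3
    rw [← add_assoc]
    omega
  cluster_lt k m h1 h2 := by
    have h3 := padicValNat_cluster (p := p) hp (x := 2 * (M + k) + 1) (t := m - (k + 1)) (by omega)
      (by omega)
    rw [show 2 * (M + m) - 1 = 2 * (M + k) + 1 + 2 * (m - (k + 1)) by omega, h3,
      show 2 * (M + (k + 1)) - 1 = 2 * (M + k) + 1 by omega]
    rw [← Nat.pow_lt_pow_iff_right hpf.out.one_lt]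
    refine lt_of_le_of_lt (Nat.le_of_dvd (by omega) pow_padicValNat_dvd)
      (by omega : m - (k + 1) < p ^ padicValNat p (2 * (M + k) + 1))
  le_end k := by
    -- The step into the cluster can lower `alph` by at most `ρ - 1`, while the remaining `p^ρ - 1`
    -- steps raise it by at least their number, and `ρ < p^ρ`.
    set ρ := padicValNat p (2 * (M + k) + 1) with hρ
    have h0 : ρ < p ^ ρ := Nat.lt_pow_self hpf.out.one_lt
    have h1 := alph_succ (p := p) hp (M + k)
    have h3 := alph_cluster (p := p) hp (c := M + k) (n := p ^ ρ - 1) (by rw [← hρ]; omega)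
    rw [show M + k + 1 + (p ^ ρ - 1) = M + (k + p ^ ρ) by omega] at h3
    have h4 : 1 ≤ if M + k = 0 then 1 else 2 := by split_ifs <;> omega
    show _ ≤ alph p (M + (k + p ^ ρ)) - _
    omega

theorem oddChain_tendsto (hp : p ≠ 2) (M : ℕ) (hM : ∀ c, M ≤ c → alph p M ≤ alph p c) (N : ℕ) :
    ∃ K, ∀ m, K ≤ m → N ≤ (oddChain hp M hM).α m := by
  refine ⟨N + alph p M, fun m hm => ?_⟩
  have := le_alph (p := p) hp (M + m)
  show N ≤ alph p (M + m) - alph p M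
  omega

/-- Take the index where the odd number is a large power `p^a`. If `p^ρ` divides a smaller odd
number of the chain, it divides the difference to `p^a`, which is twice the index distance; so the
cluster of length `p^ρ` ends in time. -/
theorem oddChain_free (hp : p ≠ 2) (M : ℕ) (hM : ∀ c, M ≤ c → alph p M ≤ alph p c) (N : ℕ) :
    ∃ k ≥ N, ∀ k' < k, (oddChain hp M hM).e k' ≤ k := by
  set a := 2 * (M + N) + 1 with ha
  have h1 : a < p ^ a := Nat.lt_pow_self hpf.out.one_lt
  have h2 : Odd (p ^ a) := (hpf.out.odd_of_ne_two hp).pow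
  obtain ⟨b, hb⟩ := h2
  refine ⟨b - M, by omega, fun k hk => ?_⟩
  show k + p ^ padicValNat p (2 * (M + k) + 1) ≤ b - M
  set ρ := padicValNat p (2 * (M + k) + 1) with hρ
  have h3 : p ^ ρ ∣ 2 * (M + k) + 1 := pow_padicValNat_dvd
  have h4 : p ^ ρ ≤ 2 * (M + k) + 1 := Nat.le_of_dvd (Nat.succ_pos _) h3
  have h5 : ρ < a := (Nat.pow_lt_pow_iff_right hpf.out.one_lt).1 (by omega)
  have h6 : p ^ ρ ∣ 2 * (b - M - k) := by
    have := Nat.dvd_sub (pow_dvd_pow p h5.le) h3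
    rwa [show p ^ a - (2 * (M + k) + 1) = 2 * (b - M - k) by omega] at this
  have h7 : p ^ ρ ∣ b - M - k :=
    (((Nat.coprime_primes hpf.out Nat.prime_two).2 hp).pow_left ρ).dvd_of_dvd_mul_left h6
  have := Nat.le_of_dvd (by omega) h7
  omega

/-- Here `2M - 1 = (p^a ± 1)/2`. Going down from it, the doubled odd numbers are `p^a ± 1 - 4t`,
with the valuations of `4t ∓ 1`. The valuations of `n` such distinct numbers up to `4n` add up to
less than `2n`, the gain from `n` steps. -/
theorem alph_le_below {M a : ℕ} (hp : p ≠ 2) (ha : a ≠ 0)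
    (h : 4 * M = p ^ a + 3 ∨ 4 * M = p ^ a + 1) {c : ℕ} (hc : c ≤ M) : alph p c ≤ alph p M := by
  rcases Nat.eq_zero_or_pos c with rfl | hc0
  · exact Nat.zero_le _
  obtain ⟨n, rfl⟩ := Nat.exists_eq_add_of_le hc
  rcases Nat.eq_zero_or_pos n with rfl | hn
  · exact le_rfl
  have h1 := alph_add (p := p) hp hc0.ne' n
  rw [← Finset.sum_range_reflect] at h1
  obtain ⟨u, hu, hinj, hle⟩ : ∃ u : ℕ → ℕ, (∀ t < n, padicValNat p (2 * (c + (n - 1 - t)) + 1) =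
      padicValNat p (u t)) ∧ (∀ s < n, ∀ t < n, u s = u t → s = t) ∧ ∀ t < n, u t ≤ 4 * n := by
    rcases h with h | h
    · refine ⟨fun t => 4 * t - 1, fun t ht => ?_, fun s _ t _ h => by dsimp only at h; omega,
        fun t ht => by dsimp only; omega⟩
      -- At `t = 0` the value `4t - 1` is truncated to `0`, of valuation `0` by convention; this is
      -- correct since `p^a + 1` is prime to `p`.
      rcases Nat.eq_zero_or_pos t with rfl | ht0
      · rw [padicValNat.eq_zero_of_not_dvd (n := 2 * (c + (n - 1 - 0)) + 1)]
        · simp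
        · intro hd
          have h2 : p ∣ 1 := by
            rw [← Nat.dvd_add_right (dvd_pow_self p ha)]
            exact hd.trans ⟨2, by omega⟩
          exact hpf.out.one_lt.ne' (Nat.dvd_one.1 h2)
      · refine padicValNat_eq_of_dvd (a := a) (t := 4 * t - 1) (by omega) (by omega) (c := 2) (d := 1)
          (isCoprime_two hp) isCoprime_one_right ⟨1, ?_⟩
        zify [show 1 ≤ 4 * t by omega, show t ≤ n - 1 by omega, show 1 ≤ n by omega] at h ⊢
        linarith
    · refine ⟨fun t => 4 * t + 1, fun t ht => ?_, fun s _ t _ h => by dsimp only at h; omega,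
        fun t ht => by dsimp only; omega⟩
      refine padicValNat_eq_of_dvd (a := a) (t := 4 * t + 1) (by omega) (by omega) (c := 2) (d := 1)
        (isCoprime_two hp) isCoprime_one_right ⟨1, ?_⟩
      zify [show t ≤ n - 1 by omega, show 1 ≤ n by omega] at h ⊢
      linarith
  rw [Finset.sum_congr rfl fun t ht => hu t (Finset.mem_range.1 ht)] at h1
  have h2 := two_mul_sum_padicValNat_lt (p := p) hp (n := n) (N := 4 * n) (by omega) hinj hle
  omega

/-- Going up, the doubled odd numbers are `p^a + 4t + 5` or `p^a + 4t + 3`, and the same count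
applies as long as the excess stays below `p^a`. Further up the crude bounds `c ≤ alph p c ≤ 2c - 1`
suffice. -/
theorem alph_le_above {M a : ℕ} (hp : p ≠ 2)
    (h : 4 * M = p ^ a + 3 ∨ 4 * M = p ^ a + 1) {c : ℕ} (hc : M ≤ c) : alph p M ≤ alph p c := by
  have hpa : 0 < p ^ a := pow_pos hpf.out.pos _
  obtain ⟨n, rfl⟩ := Nat.exists_eq_add_of_le hc
  by_cases hn : p ^ a ≤ 4 * n + 1
  · have h1 := alph_le (p := p) hp M
    have h2 := le_alph (p := p) hp (M + n)
    omega
  have h1 := alph_add (p := p) hp (c := M) (by omega) n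
  obtain ⟨u, hu, hinj, hle⟩ : ∃ u : ℕ → ℕ, (∀ t < n, padicValNat p (2 * (M + t) + 1) =
      padicValNat p (u t)) ∧ (∀ s < n, ∀ t < n, u s = u t → s = t) ∧ ∀ t < n, u t ≤ 4 * n + 1 := by
    rcases h with h | h
    · refine ⟨fun t => 4 * t + 5, fun t ht => ?_, fun s _ t _ h => by dsimp only at h; omega,
        fun t ht => by dsimp only; omega⟩
      refine padicValNat_eq_of_dvd (a := a) (t := 4 * t + 5) (by omega) (by omega) (c := 2) (d := -1)
        (isCoprime_two hp) isCoprime_one_right.neg_right ⟨1, ?_⟩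
      zify at h ⊢
      linarith
    · refine ⟨fun t => 4 * t + 3, fun t ht => ?_, fun s _ t _ h => by dsimp only at h; omega,
        fun t ht => by dsimp only; omega⟩
      refine padicValNat_eq_of_dvd (a := a) (t := 4 * t + 3) (by omega) (by omega) (c := 2) (d := -1)
        (isCoprime_two hp) isCoprime_one_right.neg_right ⟨1, ?_⟩
      zify at h ⊢
      linarith
  rw [Finset.sum_congr rfl fun t ht => hu t (Finset.mem_range.1 ht)] at h1
  have h2 := two_mul_sum_padicValNat_lt (p := p) hp (n := n) (N := 4 * n + 1) (by omega) hinj hle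
  omega

end Valuation

/-! ### Rescaling chains by units -/

theorem PowerChain.exists_rescaling {R : Type u} [CommRing R] (C : PowerChain) (q : R) (ω : ℕ → Rˣ) :
    ∃ κ : ℕ → Rˣ, ∀ F : ℕ → R, κ 0 * C.rel q F 0 = q ^ C.s 0 * (κ 0 * F 0) ∧
      ∀ m, κ (m + 1) * C.rel q F (m + 1) =
        q ^ C.s (m + 1) * (κ (m + 1) * F (m + 1)) + q ^ C.r (m + 1) * ω m * (κ m * F m) := by
  -- The product of the units `-ω t` is forced by comparing the off-diagonal coefficients; the
  -- diagonal ones are unchanged.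
  refine ⟨fun m => ∏ t ∈ Finset.range m, -ω t, fun F => ⟨?_, fun m => ?_⟩⟩
  · simp [rel]
  · simp only [Finset.prod_range_succ, rel, Units.val_mul, Units.val_neg]
    ring

section LocalRing

variable {p : ℕ} [hpf : Fact p.Prime] {R : Type u} [CommRing R]

theorem isUnit_natCast_of_not_dvd [Algebra (ZLoc p) R] {n : ℕ} (h : ¬ p ∣ n) : IsUnit (n : R) := by
  have h1 : (n : ℤ) ∈ (Ideal.span {(p : ℤ)}).primeCompl := fun h2 =>
    h (Int.natCast_dvd_natCast.1 (Ideal.mem_span_singleton.1 h2))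
  have h2 := IsLocalization.map_units (ZLoc p) (⟨n, h1⟩ : (Ideal.span {(p : ℤ)}).primeCompl)
  have h3 := h2.map (algebraMap (ZLoc p) R)
  simpa using h3

theorem exists_natCast_eq_pow_mul_unit [Algebra (ZLoc p) R] {n : ℕ} (h : n ≠ 0) :
    ∃ u : Rˣ, (n : R) = (p : R) ^ padicValNat p n * u := by
  obtain ⟨m, hm⟩ := pow_padicValNat_dvd (p := p) (n := n)
  have h1 : ¬ p ∣ m := fun ⟨k, hk⟩ => pow_succ_padicValNat_not_dvd (p := p) h
    ⟨k, by rw [pow_succ, mul_assoc, ← hk]; exact hm⟩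
  obtain ⟨u, hu⟩ := isUnit_natCast_of_not_dvd (R := R) h1
  refine ⟨u, ?_⟩
  rw [hu, ← Nat.cast_pow, ← Nat.cast_mul, ← hm]

theorem span_pow_padicValNat [Algebra (ZLoc p) R] {n : ℕ} (h : n ≠ 0) :
    Ideal.span {(p : R) ^ padicValNat p n} = Ideal.span {(n : R)} := by
  obtain ⟨u, hu⟩ := exists_natCast_eq_pow_mul_unit (p := p) (R := R) h
  rw [hu, Ideal.span_singleton_mul_right_unit u.isUnit]

theorem PowerChain.exists_oddChain_rescaling [Algebra (ZLoc p) R] (hp : p ≠ 2) (M : ℕ)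
    (hM : ∀ c, M ≤ c → alph p M ≤ alph p c) :
    ∃ κ : ℕ → Rˣ, ∀ F : ℕ → R,
      κ 0 * (oddChain hp M hM).rel (p : R) F 0 = (p : R) ^ (if M = 0 then 1 else 2) * (κ 0 * F 0) ∧
      ∀ m, κ (m + 1) * (oddChain hp M hM).rel (p : R) F (m + 1) =
        (p : R) ^ 2 * (κ (m + 1) * F (m + 1)) +
          2 * ((2 * (M + m) + 1 : ℕ) : R) * (κ m * F m) := by
  have h2 : IsUnit ((2 : ℕ) : R) := isUnit_natCast_of_not_dvd (p := p) fun h =>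
    hp ((Nat.prime_dvd_prime_iff_eq hpf.out Nat.prime_two).1 h)
  obtain ⟨u2, hu2⟩ := h2
  choose u hu using fun m => exists_natCast_eq_pow_mul_unit (p := p) (R := R)
    (Nat.succ_ne_zero (2 * (M + m)))
  obtain ⟨κ, hκ⟩ := (oddChain hp M hM).exists_rescaling (p : R) (fun m => u2 * u m)
  refine ⟨κ, fun F => ⟨(hκ F).1, fun m => ?_⟩⟩
  rw [(hκ F).2 m]
  have hs : (oddChain hp M hM).s (m + 1) = 2 := by
    show (if M + (m + 1) = 0 then 1 else 2) = 2
    rw [if_neg (by omega)]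
  have hr : (oddChain hp M hM).r (m + 1) = padicValNat p (2 * (M + m)).succ :=
    congrArg (padicValNat p) (by omega)
  rw [hs, hr]
  have := hu m
  rw [Nat.succ_eq_add_one] at this ⊢
  rw [this, Units.val_mul, hu2, Nat.cast_two]
  ring

theorem mul_units_iff (κ : ℕ → Rˣ) {P : ℕ → Prop} {g : ℕ → R} {E E' : (ℕ → R) → ℕ → R}
    (h : ∀ F m, P m → κ m * E F m = E' (fun m => κ m * F m) m) :
    (∃ F, ∀ m, P m → ((κ m)⁻¹ : Rˣ) * g m = E F m) ↔ ∃ F, ∀ m, P m → g m = E' F m := by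
  constructor
  · rintro ⟨F, hF⟩
    refine ⟨fun m => κ m * F m, fun m hm => ?_⟩
    rw [← h F m hm, ← hF m hm, Units.mul_inv_cancel_left]
  · rintro ⟨F, hF⟩
    refine ⟨fun m => ((κ m)⁻¹ : Rˣ) * F m, fun m hm => ?_⟩
    have := h (fun m => ((κ m)⁻¹ : Rˣ) * F m) m hm
    simp only [Units.mul_inv_cancel_left] at this
    rw [hF m hm, ← this, Units.inv_mul_cancel_left]

variable (p) in
/-- The relations between even degrees of the small model, with `2M` the first degree. -/
def oddRel (M : ℕ) (F : ℕ → R) : ℕ → R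
  | 0 => (p : R) ^ (if M = 0 then 1 else 2) * F 0
  | m + 1 => (p : R) ^ 2 * F (m + 1) + 2 * ((2 * (M + m) + 1 : ℕ) : R) * F m

/-- Multiplication by a sequence of units. -/
def diagUnits (κ : ℕ → Rˣ) : (ℕ → R) ≃ₗ[R] (ℕ → R) :=
  LinearEquiv.piCongrRight fun m => LinearEquiv.smulOfUnit (κ m)

theorem exists_infinite_oddRel_cokernel [Algebra (ZLoc p) R] (hp : p ≠ 2)
    (hq : ∀ x : R, (p : R) * x = 0 → x = 0) (M : ℕ) (hM : ∀ c, M ≤ c → alph p M ≤ alph p c) :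
    ∃ Ψ : (ℕ → R) →ₗ[R] AdicCompletion (Ideal.span {(p : R)}) R ×
        ∀ k : ℕ, R ⧸ Ideal.span {((2 * (M + k) + 1 : ℕ) : R)},
      Function.Surjective Ψ ∧ ∀ g, Ψ g = 0 ↔ ∃ F, ∀ m, g m = oddRel p M F m := by
  obtain ⟨κ, hκ⟩ := PowerChain.exists_oddChain_rescaling (R := R) hp M hM
  obtain ⟨Ψ, hs, hk⟩ := (oddChain hp M hM).infinite_cokernel hq (oddChain_tendsto hp M hM)
    (oddChain_free hp M hM)
  have hI : ∀ k, Ideal.span {(p : R) ^ (oddChain hp M hM).r (k + 1)} =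
      Ideal.span {((2 * (M + k) + 1 : ℕ) : R)} := fun k => span_pow_padicValNat (Nat.succ_ne_zero _)
  let e := LinearEquiv.prodCongr (LinearEquiv.refl R (AdicCompletion (Ideal.span {(p : R)}) R))
    (LinearEquiv.piCongrRight fun k => Submodule.quotEquivOfEq _ _ (hI k))
  refine ⟨e.toLinearMap ∘ₗ Ψ ∘ₗ (diagUnits fun m => (κ m)⁻¹).toLinearMap,
    e.surjective.comp (hs.comp (LinearEquiv.surjective _)), fun g => ?_⟩
  have h0 := mul_units_iff κ (P := fun _ => True) (g := g) (E := (oddChain hp M hM).rel (p : R))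
    (E' := oddRel p M) (fun F m _ => by
      cases m with
      | zero => exact (hκ F).1
      | succ m => exact (hκ F).2 m)
  simp only [forall_const] at h0
  rw [← h0]
  exact (e.map_eq_zero_iff).trans (hk _)

theorem exists_finite_oddRel_cokernel [Algebra (ZLoc p) R] (hp : p ≠ 2)
    (hq : ∀ x : R, (p : R) * x = 0 → x = 0) {M : ℕ} (h0 : M ≠ 0)
    (hM : ∀ c, c ≤ M → alph p c ≤ alph p M) :
    ∃ Ψ : (ℕ → R) →ₗ[R] (R ⧸ Ideal.span {(p : R) ^ (alph p M + 2)}) ×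
        ∀ k : Fin M, R ⧸ Ideal.span {(2 * (k : ℕ) + 1 : R)},
      Function.Surjective Ψ ∧ ∀ g, Ψ g = 0 ↔ ∃ F, ∀ m ≤ M, g m = oddRel p 0 F m := by
  have hM0 : ∀ c, 0 ≤ c → alph p 0 ≤ alph p c := fun c _ => Nat.zero_le _
  have hα : ∀ c, (oddChain hp 0 hM0).α c = alph p c := fun c => by
    show alph p (0 + c) - alph p 0 = alph p c
    rw [zero_add]
    rfl
  obtain ⟨κ, hκ⟩ := PowerChain.exists_oddChain_rescaling (R := R) hp 0 hM0
  obtain ⟨Ψ, hs, hk⟩ := (oddChain hp 0 hM0).finite_cokernel hq (M := M)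
    (fun m hm => by rw [hα, hα]; exact hM m hm)
  have hI : ∀ k, Ideal.span {(p : R) ^ (oddChain hp 0 hM0).r (k + 1)} =
      Ideal.span {(2 * (k : ℕ) + 1 : R)} := fun k => by
    have h1 : (oddChain hp 0 hM0).r (k + 1) = padicValNat p (2 * k + 1) :=
      congrArg (padicValNat p) (by omega)
    rw [h1, span_pow_padicValNat (Nat.succ_ne_zero _)]
    push_cast
    rfl
  have hI' : Ideal.span {(p : R) ^ ((oddChain hp 0 hM0).α M + (oddChain hp 0 hM0).s M)} =
      Ideal.span {(p : R) ^ (alph p M + 2)} := by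
    have h1 : (oddChain hp 0 hM0).s M = 2 := if_neg (by omega)
    rw [hα, h1]
  let e := LinearEquiv.prodCongr (Submodule.quotEquivOfEq _ _ hI')
    (LinearEquiv.piCongrRight fun k : Fin M => Submodule.quotEquivOfEq _ _ (hI k))
  refine ⟨e.toLinearMap ∘ₗ Ψ ∘ₗ (diagUnits fun m => (κ m)⁻¹).toLinearMap,
    e.surjective.comp (hs.comp (LinearEquiv.surjective _)), fun g => ?_⟩
  rw [← mul_units_iff κ (E := (oddChain hp 0 hM0).rel (p : R)) (fun F m _ => by
      cases m with
      | zero => exact (hκ F).1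
      | succ m => exact (hκ F).2 m)]
  exact (e.map_eq_zero_iff).trans (hk _)

end LocalRing

/-! ### The homology of the small model -/

theorem Mixed.homology_equiv_of_presentation {R : Type u} {N : Type v} [CommRing R] [AddCommGroup N]
    [Module R N] {M' : ℤ → Submodule R N} {D : (ℕ → N) →ₗ[R] (ℕ → N)} {k i : ℤ} {T : Type*}
    [AddCommGroup T] [Module R T] (Θ : (ℕ → N) →ₗ[R] T) (hcyc : ∀ f ∈ tot M' k i, D f = 0)
    (hsurj : ∀ t, ∃ f ∈ tot M' k i, Θ f = t)
    (hker : ∀ f ∈ tot M' k i, Θ f = 0 ↔ f ∈ boundaries M' D k i) :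
    Nonempty (homology M' D k i ≃ₗ[R] T) := by
  have h1 : (boundaries M' D k i).comap (cycles M' D k i).subtype =
      LinearMap.ker (Θ ∘ₗ (cycles M' D k i).subtype) := by
    ext x
    exact (hker x x.2.1).symm
  refine ⟨(Submodule.quotEquivOfEq _ _ h1).trans (LinearMap.quotKerEquivOfSurjective _ ?_)⟩
  intro t
  obtain ⟨f, hf, rfl⟩ := hsurj t
  exact ⟨⟨f, hf, hcyc f hf⟩, rfl⟩

namespace Small

variable {R : Type u} [CommRing R] {p : ℕ}

theorem dE_mem {m : ℤ} {f : ℕ → R} (hf : f ∈ grE R m) : dE R p f ∈ grE R (m - 1) := by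
  intro n hn
  have h1 : f (n + 1) = 0 := hf _ (by push_cast; omega)
  rcases Nat.even_or_odd n with h | h
  · rcases eq_or_ne n 0 with rfl | h0
    · rw [dE_zero, h1, mul_zero]
    · rw [dE_even h h0, h1, mul_zero]
  · exact dE_odd h f

theorem BE_mem {m : ℤ} {f : ℕ → R} (hf : f ∈ grE R m) : BE R f ∈ grE R (m + 1) := by
  intro n hn
  rcases Nat.even_or_odd n with h | h
  · rcases eq_or_ne n 0 with rfl | h0
    · rw [BE_even h]; simp
    · rw [BE_even h, hf _ (by omega), mul_zero]
  · exact BE_odd h f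

theorem dE_eq_zero {m : ℤ} (hm : Even m) {f : ℕ → R} (hf : f ∈ grE R m) : dE R p f = 0 := by
  funext n
  rcases Nat.even_or_odd n with h | h
  · have h1 : f (n + 1) = 0 := hf _ (by
      rintro rfl
      have := (Int.even_coe_nat _).1 hm
      exact Nat.not_even_iff_odd.2 h.add_one this)
    rcases eq_or_ne n 0 with rfl | h0
    · rw [dE_zero, h1, mul_zero]; rfl
    · rw [dE_even h h0, h1, mul_zero]; rfl
  · exact dE_odd h f

theorem BE_eq_zero {m : ℤ} (hm : Even m) {f : ℕ → R} (hf : f ∈ grE R m) : BE R f = 0 := by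
  funext n
  rcases Nat.even_or_odd n with h | h
  · rcases eq_or_ne n 0 with rfl | h0
    · rw [BE_even h]; simp
    · rw [BE_even h, hf _ (by
        intro h1
        obtain ⟨a, ha⟩ := h
        obtain ⟨b, hb⟩ := hm
        omega), mul_zero]
      rfl
  · exact BE_odd h f

theorem tot_ext {k i : ℤ} {f g : ℕ → ℕ → R} (hf : f ∈ Mixed.tot (grE R) k i)
    (hg : g ∈ Mixed.tot (grE R) k i) (h : ∀ j n : ℕ, (n : ℤ) = i + k * j → f j n = g j n) :
    f = g := by
  funext j n
  by_cases hn : (n : ℤ) = i + k * j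
  · exact h j n hn
  · rw [hf j n hn, hg j n hn]

theorem single_mem_grE (n : ℕ) {m : ℤ} (h : (n : ℤ) = m) (x : R) :
    (Pi.single n x : ℕ → R) ∈ grE R m := fun l hl =>
  Pi.single_eq_of_ne (by rintro rfl; exact hl h) _

theorem negD_mem {i : ℤ} {F : ℕ → ℕ → R} (hF : F ∈ Mixed.tot (grE R) 2 (i + 1)) :
    Mixed.negD (dE R p) (BE R) F ∈ Mixed.tot (grE R) 2 i := by
  intro j
  have h1 := dE_mem (p := p) (hF j)
  rw [show i + 1 + 2 * (j : ℤ) - 1 = i + 2 * j by ring] at h1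
  cases j with
  | zero => exact h1
  | succ j =>
    have h2 := BE_mem (hF j)
    rw [show i + 1 + 2 * (j : ℤ) + 1 = i + 2 * ((j + 1 : ℕ) : ℤ) by push_cast; ring] at h2
    exact Submodule.add_mem _ h1 h2

theorem cycD_mem {i : ℤ} {F : ℕ → ℕ → R} (hF : F ∈ Mixed.tot (grE R) (-2) (i + 1)) :
    Mixed.cycD (dE R p) (BE R) F ∈ Mixed.tot (grE R) (-2) i := by
  intro j
  have h1 := dE_mem (p := p) (hF j)
  have h2 := BE_mem (hF (j + 1))
  rw [show i + 1 + (-2) * (j : ℤ) - 1 = i + (-2) * j by ring] at h1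
  rw [show i + 1 + (-2) * ((j + 1 : ℕ) : ℤ) + 1 = i + (-2) * j by push_cast; ring] at h2
  exact Submodule.add_mem _ h1 h2

theorem negD_eq_zero {i : ℤ} (hi : Even i) {f : ℕ → ℕ → R} (hf : f ∈ Mixed.tot (grE R) 2 i) :
    Mixed.negD (dE R p) (BE R) f = 0 := by
  have he : ∀ j : ℕ, Even (i + 2 * (j : ℤ)) := fun j => hi.add (even_two_mul _)
  funext j
  cases j with
  | zero => rw [Mixed.negD_zero, dE_eq_zero (he 0) (hf 0)]; rfl
  | succ j =>
    rw [Mixed.negD_succ, dE_eq_zero (he _) (hf _), BE_eq_zero (he _) (hf _), add_zero]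
    rfl

theorem cycD_eq_zero {i : ℤ} (hi : Even i) {f : ℕ → ℕ → R} (hf : f ∈ Mixed.tot (grE R) (-2) i) :
    Mixed.cycD (dE R p) (BE R) f = 0 := by
  have he : ∀ j : ℕ, Even (i + (-2) * (j : ℤ)) := fun j => by
    rw [neg_mul]; exact hi.add (even_two_mul _).neg
  funext j
  rw [Mixed.cycD_apply, dE_eq_zero (he _) (hf _), BE_eq_zero (he _) (hf _), add_zero]
  rfl

/-- The coordinates of an element of even degree `2 (M - Q)` of the negative cyclic complex. -/
def negCoord (R : Type u) [CommRing R] (M Q : ℕ) : (ℕ → ℕ → R) →ₗ[R] (ℕ → R) :=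
  LinearMap.pi fun m => LinearMap.proj (2 * (M + m)) ∘ₗ LinearMap.proj (Q + m)

theorem negD_coord {M Q : ℕ} (h : M = 0 ∨ Q = 0) (F : ℕ → ℕ → R) (m : ℕ) :
    Mixed.negD (dE R p) (BE R) F (Q + m) (2 * (M + m)) =
      oddRel p M (fun m => F (Q + m) (2 * (M + m) + 1)) m := by
  cases m with
  | succ m =>
    show Mixed.negD (dE R p) (BE R) F (Q + m + 1) _ = _
    rw [Mixed.negD_succ, Pi.add_apply, dE_even (even_two_mul _) (by omega),
      BE_even (even_two_mul _), show 2 * (M + (m + 1)) - 1 = 2 * (M + m) + 1 by omega]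
    rfl
  | zero =>
    simp only [oddRel, add_zero]
    have h1 : dE R p (F Q) (2 * M) = (p : R) ^ (if M = 0 then 1 else 2) * F Q (2 * M + 1) := by
      split_ifs with hM
      · rw [hM, pow_one]; exact dE_zero _
      · exact dE_even (even_two_mul _) (by omega) _
    cases Q with
    | zero => rw [Mixed.negD_zero, h1]
    | succ Q =>
      -- With `M = 0` and `Q > 0` there is an incoming Connes term, but its coefficient `2(0 - 1)`
      -- is zero by truncated subtraction.
      rcases h with rfl | h
      · rw [Mixed.negD_succ, Pi.add_apply, h1, BE_even (even_two_mul _)]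
        simp
      · omega

theorem neg_homology_equiv {i : ℤ} {M Q : ℕ} (hi : i = 2 * M - 2 * Q) (h : M = 0 ∨ Q = 0)
    {T : Type*} [AddCommGroup T] [Module R T] (Ψ : (ℕ → R) →ₗ[R] T) (hΨ : Function.Surjective Ψ)
    (hker : ∀ g, Ψ g = 0 ↔ ∃ F, ∀ m, g m = oddRel p M F m) :
    Nonempty (Mixed.homology (grE R) (Mixed.negD (dE R p) (BE R)) 2 i ≃ₗ[R] T) := by
  have hev : Even i := by rw [hi]; exact (even_two_mul _).sub (even_two_mul _)
  have hcoord : ∀ j n : ℕ, (n : ℤ) = i + 2 * j → ∃ m, j = Q + m ∧ n = 2 * (M + m) := by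
    intro j n hn
    exact ⟨j - Q, by omega, by omega⟩
  refine Mixed.homology_equiv_of_presentation (Ψ ∘ₗ negCoord R M Q)
    (fun f hf => negD_eq_zero hev hf) (fun t => ?_) (fun f hf => ?_)
  · obtain ⟨g, rfl⟩ := hΨ t
    refine ⟨fun j => if Q ≤ j then Pi.single (2 * (M + (j - Q))) (g (j - Q)) else 0,
      fun j => ?_, ?_⟩
    · dsimp only
      split_ifs with hj
      · exact single_mem_grE _ (by push_cast [Nat.cast_sub hj]; rw [hi]; ring) _
      · exact Submodule.zero_mem _
    · rw [LinearMap.comp_apply]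
      congr 1
      funext m
      simp [negCoord]
  · rw [LinearMap.comp_apply, hker]
    constructor
    · rintro ⟨F', hF'⟩
      have hF : (fun j => if Q ≤ j then Pi.single (2 * (M + (j - Q)) + 1) (F' (j - Q)) else 0) ∈
          Mixed.tot (grE R) 2 (i + 1) := by
        intro j
        dsimp only
        split_ifs with hj
        · exact single_mem_grE _ (by push_cast [Nat.cast_sub hj]; rw [hi]; ring) _
        · exact Submodule.zero_mem _
      refine ⟨_, hF, tot_ext (negD_mem hF) hf fun j n hn => ?_⟩
      obtain ⟨m, rfl, rfl⟩ := hcoord j n hn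
      rw [negD_coord h]
      refine Eq.trans ?_ (hF' m).symm
      congr 1
      funext m
      simp
    · rintro ⟨F, hF, rfl⟩
      exact ⟨fun m => F (Q + m) (2 * (M + m) + 1), fun m => negD_coord h F m⟩

/-- The coordinates of an element of even degree `2M` of the cyclic complex. -/
def cycCoord (R : Type u) [CommRing R] (M : ℕ) : (ℕ → ℕ → R) →ₗ[R] (ℕ → R) :=
  LinearMap.pi fun m => LinearMap.proj (2 * m) ∘ₗ LinearMap.proj (M - m)

theorem cycD_coord {M : ℕ} (F : ℕ → ℕ → R) {m : ℕ} (hm : m ≤ M) :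
    Mixed.cycD (dE R p) (BE R) F (M - m) (2 * m) =
      oddRel p 0 (fun m => F (M - m) (2 * m + 1)) m := by
  cases m with
  | succ m =>
    rw [Mixed.cycD_apply, Pi.add_apply, dE_even (even_two_mul _) (by omega),
      BE_even (even_two_mul _), show 2 * (m + 1) - 1 = 2 * m + 1 by omega,
      show M - (m + 1) + 1 = M - m by omega]
    simp only [oddRel, zero_add]
  | zero =>
    rw [Mixed.cycD_apply, Pi.add_apply, BE_even (even_two_mul _)]
    simp [oddRel, dE_zero]

theorem cyc_homology_equiv {M : ℕ} {T : Type*} [AddCommGroup T] [Module R T]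
    (Ψ : (ℕ → R) →ₗ[R] T) (hΨ : Function.Surjective Ψ)
    (hker : ∀ g, Ψ g = 0 ↔ ∃ F, ∀ m ≤ M, g m = oddRel p 0 F m) :
    Nonempty (Mixed.homology (grE R) (Mixed.cycD (dE R p) (BE R)) (-2) (2 * M) ≃ₗ[R] T) := by
  -- Indices above `M` carry no relation, so `Ψ` ignores those entries: a sequence vanishing up to
  -- `M` is presented by `F = 0`.
  have hΨM : ∀ g g', (∀ m ≤ M, g m = g' m) → Ψ g = Ψ g' := by
    intro g g' hg
    rw [← sub_eq_zero, ← map_sub, hker]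
    refine ⟨0, fun m hm => ?_⟩
    rw [Pi.sub_apply, hg m hm, sub_self]
    cases m <;> simp [oddRel]
  refine Mixed.homology_equiv_of_presentation (Ψ ∘ₗ cycCoord R M)
    (fun f hf => cycD_eq_zero (even_two_mul _) hf) (fun t => ?_) (fun f hf => ?_)
  · obtain ⟨g, rfl⟩ := hΨ t
    refine ⟨fun j => if j ≤ M then Pi.single (2 * (M - j)) (g (M - j)) else 0,
      fun j => ?_, ?_⟩
    · dsimp only
      split_ifs with hj
      · exact single_mem_grE _ (by push_cast [Nat.cast_sub hj]; ring) _
      · exact Submodule.zero_mem _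
    · rw [LinearMap.comp_apply]
      refine hΨM _ _ fun m hm => ?_
      simp [cycCoord, Nat.sub_sub_self hm]
  · rw [LinearMap.comp_apply, hker]
    constructor
    · rintro ⟨F', hF'⟩
      have hF : (fun j => if j ≤ M then Pi.single (2 * (M - j) + 1) (F' (M - j)) else 0) ∈
          Mixed.tot (grE R) (-2) (2 * M + 1) := by
        intro j
        dsimp only
        split_ifs with hj
        · exact single_mem_grE _ (by push_cast [Nat.cast_sub hj]; ring) _
        · exact Submodule.zero_mem _
      refine ⟨_, hF, tot_ext (cycD_mem hF) hf fun j n hn => ?_⟩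
      obtain ⟨m, hm, rfl, rfl⟩ : ∃ m ≤ M, j = M - m ∧ n = 2 * m :=
        ⟨M - j, by omega, by omega, by omega⟩
      rw [cycD_coord _ hm]
      refine Eq.trans ?_ (hF' m hm).symm
      cases m with
      | zero => simp [oddRel]
      | succ m => simp [oddRel, Nat.sub_sub_self hm, Nat.sub_sub_self (Nat.le_of_succ_le hm)]
    · rintro ⟨F, hF, rfl⟩
      exact ⟨fun m => F (M - m) (2 * m + 1), fun m hm => cycD_coord F hm⟩

/-- Multiplication by `p` or `p²` is injective, so `d` is injective in odd degrees. Hence the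
components of a cycle vanish one after the other, the Connes term from the preceding one being
already zero. -/
theorem subsingleton_neg_homology (hq : ∀ x : R, (p : R) * x = 0 → x = 0) {i : ℤ} (hi : Odd i) :
    Subsingleton (Mixed.homology (grE R) (Mixed.negD (dE R p) (BE R)) 2 i) := by
  have h : ∀ f ∈ Mixed.cycles (grE R) (Mixed.negD (dE R p) (BE R)) 2 i, f = 0 := by
    rintro f ⟨hf, hD⟩
    have hd : ∀ (j : ℕ), dE R p (f j) = 0 → f j = 0 := by
      intro j hj
      funext n
      by_cases hn : (n : ℤ) = i + 2 * j
      · obtain ⟨l, rfl⟩ : ∃ l, n = 2 * l + 1 := by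
          obtain ⟨b, hb⟩ := hi
          exact ⟨n / 2, by omega⟩
        have h1 := congrFun hj (2 * l)
        rcases Nat.eq_zero_or_pos l with rfl | hl
        · rw [mul_zero, dE_zero] at h1
          exact hq _ h1
        · rw [dE_even (even_two_mul _) (by omega), pow_two, mul_assoc] at h1
          exact hq _ (hq _ h1)
      · exact hf j n hn
    funext j
    induction j with
    | zero => exact hd 0 (by rw [← Mixed.negD_zero (dE R p) (BE R)]; exact congrFun hD 0)
    | succ j ih =>
      have h1 : Mixed.negD (dE R p) (BE R) f (j + 1) = 0 := congrFun hD (j + 1)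
      rw [Mixed.negD_succ, ih, Pi.zero_apply, map_zero, add_zero] at h1
      exact hd _ h1
  refine ⟨fun a b => ?_⟩
  obtain ⟨x, rfl⟩ := Submodule.Quotient.mk_surjective _ a
  obtain ⟨y, rfl⟩ := Submodule.Quotient.mk_surjective _ b
  exact congrArg _ (Subtype.ext ((h x x.2).trans (h y y.2).symm))

end Small

end

/-! ### Assembly of the theorem -/

theorem shift_linearEquiv {R : Type u} [CommRing R] {I J : ℕ → Ideal R} (h0 : I 0 = ⊤)
    (h : ∀ k, I (k + 1) = J k) : Nonempty ((∀ k, R ⧸ J k) ≃ₗ[R] ∀ k, R ⧸ I k) := by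
  obtain rfl : (fun k => I (k + 1)) = J := funext h
  have : Subsingleton (R ⧸ I 0) := Ideal.Quotient.subsingleton_iff.2 h0
  refine ⟨(LinearEquiv.ofBijective (LinearMap.pi fun k => LinearMap.proj (k + 1) :
    (∀ k, R ⧸ I k) →ₗ[R] ∀ k, R ⧸ I (k + 1)) ⟨fun f g hfg => funext fun k => ?_, fun f => ?_⟩).symm⟩
  · cases k with
    | zero => exact Subsingleton.elim _ _
    | succ k => exact congrFun hfg k
  · exact ⟨fun k => Nat.casesOn k 0 f, rfl⟩

theorem four_mul_eq_of_two_mul_sub_one {p a M : ℕ}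
    (h : 2 * (((2 * M : ℕ) : ℤ) - 1) = (p : ℤ) ^ a + 1 ∨
      2 * (((2 * M : ℕ) : ℤ) - 1) = (p : ℤ) ^ a - 1) :
    4 * M = p ^ a + 3 ∨ 4 * M = p ^ a + 1 := by
  rcases h with h | h
  · left
    zify
    push_cast at h
    linarith
  · right
    zify
    push_cast at h
    linarith

theorem theorem3 (p : ℕ) [Fact p.Prime] (hp : p ≠ 2) :
    ∃ Z Zbar : Set ℕ,
      -- `Z` and `Zbar` are infinite sets of positive even integers
      Z.Infinite ∧ Zbar.Infinite ∧ Zbar ⊆ Z ∧ (∀ i ∈ Z, 0 < i ∧ Even i) ∧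
      -- `Zbar`, hence `Z`, contains all even numbers of the form `(p^a ± 1)/2 + 1`
      (∀ a i : ℕ, 0 < a → Even i →
        (2 * ((i : ℤ) - 1) = (p : ℤ) ^ a + 1 ∨ 2 * ((i : ℤ) - 1) = (p : ℤ) ^ a - 1) → i ∈ Zbar) ∧
      ∀ (R : Type u) [CommRing R] [Algebra (ZLoc p) R],
        (∀ r : R, (p : R) * r = 0 → r = 0) →
        -- odd degrees
        (∀ i : ℤ, Odd i → Subsingleton (HCneg (killP R p) i)) ∧
        -- non-positive even degrees
        (∀ i : ℤ, Even i → i ≤ 0 →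
          Nonempty (HCneg (killP R p) i ≃ₗ[R]
            AdicCompletion (Ideal.span {(p : R)}) R ×
              ∀ k : ℕ, R ⧸ Ideal.span {(2 * k + 1 : R)})) ∧
        -- degrees in `Zbar`
        (∀ i ∈ Zbar,
          Nonempty (HCneg (killP R p) (i : ℤ) ≃ₗ[R]
            AdicCompletion (Ideal.span {(p : R)}) R ×
              ∀ k : ℕ, R ⧸ Ideal.span {((i : R) - 1 + 2 * k)})) ∧
        -- the cyclic homology in the degrees in `Z`
        (∀ i ∈ Z,
          Nonempty (HC (killP R p) (i : ℤ) ≃ₗ[R]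
            (R ⧸ Ideal.span {(p : R) ^ (vala p (i - 1) + 2)}) ×
              ∀ k : Fin (i / 2), R ⧸ Ideal.span {(2 * (k : ℕ) + 1 : R)})) := by
  have hpp : p.Prime := Fact.out
  set Z : Set ℕ := {i | ∃ M, M ≠ 0 ∧ i = 2 * M ∧ ∀ c ≤ M, alph p c ≤ alph p M} with hZ
  -- Maximality over smaller indices serves the finite chain, minimality over larger ones the
  -- infinite chain, and `p ∤ 2M - 1` makes the factor `R/(i - 1)` trivial.
  set Zbar : Set ℕ := {i | ∃ M, M ≠ 0 ∧ i = 2 * M ∧ (∀ c ≤ M, alph p c ≤ alph p M) ∧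
    ¬ p ∣ 2 * M - 1 ∧ ∀ c, M ≤ c → alph p M ≤ alph p c} with hZbar
  have hsub : Zbar ⊆ Z := by
    rintro i ⟨M, h0, h1, h2, -⟩
    exact ⟨M, h0, h1, h2⟩
  have hmem : ∀ a i : ℕ, 0 < a → Even i → (2 * ((i : ℤ) - 1) = (p : ℤ) ^ a + 1 ∨
      2 * ((i : ℤ) - 1) = (p : ℤ) ^ a - 1) → i ∈ Zbar := by
    intro a i ha hi h
    obtain ⟨M, rfl⟩ := hi.two_dvd
    have h4 := four_mul_eq_of_two_mul_sub_one h
    refine ⟨M, by rintro rfl; omega, rfl, fun c hc => alph_le_below hp ha.ne' h4 hc, fun hd => ?_,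
      fun c hc => alph_le_above hp h4 hc⟩
    have h5 : p ∣ p ^ a := dvd_pow_self p ha.ne'
    have h6 : p ∣ 2 * (2 * M - 1) := hd.mul_left 2
    apply hpp.one_lt.ne'
    rw [← Nat.dvd_one]
    rcases h4 with h4 | h4
    · rw [show 2 * (2 * M - 1) = p ^ a + 1 by omega] at h6
      exact (Nat.dvd_add_right h5).1 h6
    · rw [show p ^ a = 2 * (2 * M - 1) + 1 by omega] at h5
      exact (Nat.dvd_add_right h6).1 h5
  have hinf : Zbar.Infinite := by
    refine Set.infinite_of_forall_exists_gt fun N => ?_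
    have h1 : 2 * N + 4 < p ^ (2 * N + 4) := Nat.lt_pow_self hpp.one_lt
    obtain ⟨b, hb⟩ := (hpp.odd_of_ne_two hp).pow (n := 2 * N + 4)
    -- Exactly one of the two numbers `(p^a ± 1)/2 + 1` is even; it is `2⌊p^a / 4⌋ + 2`.
    refine ⟨2 * (p ^ (2 * N + 4) / 4) + 2, hmem (2 * N + 4) _ (by omega) ⟨_ / 4 + 1, by ring⟩ ?_,
      by omega⟩
    have h2 : p ^ (2 * N + 4) = 4 * (p ^ (2 * N + 4) / 4) + 1 ∨
        p ^ (2 * N + 4) = 4 * (p ^ (2 * N + 4) / 4) + 3 := by omega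
    generalize p ^ (2 * N + 4) / 4 = c at h2
    rw [← Nat.cast_pow]
    rcases h2 with h2 | h2 <;> rw [h2] <;> push_cast
    · left; ring
    · right; ring
  refine ⟨Z, Zbar, hinf.mono hsub, hinf, hsub, ?_, hmem, ?_⟩
  · rintro i ⟨M, h0, rfl, -⟩
    exact ⟨by omega, even_two_mul M⟩
  intro R _ _ hq
  have h2 : IsUnit (2 : R) := by
    have h : IsUnit ((2 : ℕ) : R) := isUnit_natCast_of_not_dvd (p := p) fun h =>
      hp ((Nat.prime_dvd_prime_iff_eq hpp Nat.prime_two).1 h)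
    rwa [Nat.cast_two] at h
  refine ⟨fun i hi => ?_, fun i hi hi0 => ?_, ?_, ?_⟩
  · obtain ⟨e⟩ := Small.HCneg_equiv (p := p) h2 i
    have := Small.subsingleton_neg_homology hq hi
    exact e.toEquiv.subsingleton
  · obtain ⟨e⟩ := Small.HCneg_equiv (p := p) h2 i
    obtain ⟨Ψ, hs, hk⟩ := exists_infinite_oddRel_cokernel hp hq 0 fun c _ => Nat.zero_le _
    -- In degree `i = -2Q` the first `Q` components have negative degree and vanish, so the chain
    -- always starts in degree zero.
    obtain ⟨e'⟩ := Small.neg_homology_equiv (i := i) (M := 0) (Q := (-i / 2).toNat)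
      (by obtain ⟨b, hb⟩ := hi; omega) (Or.inl rfl) Ψ hs hk
    have hI : ∀ k : ℕ, Ideal.span {((2 * (0 + k) + 1 : ℕ) : R)} = Ideal.span {(2 * k + 1 : R)} :=
      fun k => by rw [zero_add]; push_cast; rfl
    exact ⟨(e.trans e').trans (LinearEquiv.prodCongr (LinearEquiv.refl R _)
      (LinearEquiv.piCongrRight fun k => Submodule.quotEquivOfEq _ _ (hI k)))⟩
  · rintro i ⟨M, h0, rfl, -, hd, hM⟩
    obtain ⟨e⟩ := Small.HCneg_equiv (p := p) h2 ((2 * M : ℕ) : ℤ)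
    obtain ⟨Ψ, hs, hk⟩ := exists_infinite_oddRel_cokernel hp hq M hM
    obtain ⟨e'⟩ := Small.neg_homology_equiv (i := ((2 * M : ℕ) : ℤ)) (M := M) (Q := 0)
      (by push_cast; ring) (Or.inr rfl) Ψ hs hk
    -- The chain starting in degree `i = 2M` yields the factors `R/(i+1), R/(i+3), …`; the factor
    -- `R/(i-1)` is inserted for free because `i - 1` is a unit.
    obtain ⟨e''⟩ := shift_linearEquiv
      (I := fun k : ℕ => Ideal.span {(((2 * M : ℕ) : R) - 1 + 2 * k)})
      (J := fun k : ℕ => Ideal.span {((2 * (M + k) + 1 : ℕ) : R)}) (by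
        rw [Ideal.span_singleton_eq_top]
        have := isUnit_natCast_of_not_dvd (R := R) hd
        rw [Nat.cast_sub (by omega), Nat.cast_one] at this
        simpa using this) (fun k => by
        congr 2
        push_cast
        ring)
    exact ⟨(e.trans e').trans (LinearEquiv.prodCongr (LinearEquiv.refl R _) e'')⟩
  · rintro i ⟨M, h0, rfl, hM⟩
    obtain ⟨e⟩ := Small.HC_equiv (p := p) h2 ((2 * M : ℕ) : ℤ)
    obtain ⟨Ψ, hs, hk⟩ := exists_finite_oddRel_cokernel (R := R) hp hq h0 hM
    obtain ⟨e'⟩ := Small.cyc_homology_equiv Ψ hs hk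
    rw [show 2 * (M : ℤ) = ((2 * M : ℕ) : ℤ) by push_cast; ring] at e'
    obtain ⟨m, rfl⟩ := Nat.exists_eq_succ_of_ne_zero h0
    rw [show vala p (2 * (m + 1) - 1) = alph p (m + 1) from rfl,
      show 2 * (m + 1) / 2 = m + 1 by omega]
    exact ⟨e.trans e'⟩
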